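/- **Setting.** A partial monitoring (PM) game with $k\ge 2$ actions and $d$ outcomes is a loss matrix $\mathcal L\in[0,1]^{k\times d}$ with rows $\ell_a$, together with a feedback matrix $\Phi\in\Sigma^{k\times d}$. Let $m$ be the maximum number of distinct symbols in a row of $\Phi$, and let $\mathcal P_n$ be the probability simplex in $\mathbb R^n$. In round $t\in\{1,\dots,T\}$, $T\ge2$, the environment picks $x_t\in[d]$ (possibly at random and depending on the past rounds) and simultaneously the learner picks $A_t\in[k]$, observing only $\sigma_t=\Phi_{A_tx_t}$. The regret is $\mathsf{Reg}_T=\mathbb E[\sum_{t}\mathcal L_{A_tx_t}]-\min_a\mathbb E[\sum_t\mathcal L_{ax_t}]$. The cell of $a$ is $\mathcal C_a=\{u\in\mathcal P_d:(\ell_a-\ell_b)^\top u\le0\ \forall b\}$. An action $a$ with $\mathcal C_a\neq\emptyset$ is Pareto optimal ($a\in\Pi$) if $\dim\mathcal C_a=d-1$ and degenerate if $\dim\mathcal C_a<d-1$. Actions $a,b\in\Pi$ are neighbors if $\mathcal C_a\cap\mathcal C_b\ne\emptyset$ has dimension $d-2$. The game is locally observable if for all neighbors $a,b$ there is $w:[k]\times\Sigma\to\mathbb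 R$ with $w(c,\cdot)=0$ for $c\notin\{a,b\}$ and $\sum_cw(c,\Phi_{cx})=\mathcal L_{ax}-\mathcal L_{bx}$ for all $x$. Let the game be of one of three kinds $\mathcal M$: full information (FI: each feedback symbol determines the losses of all actions), multi-armed bandit (MAB: $\Phi_{ax}=\mathcal L_{ax}$, up to a renaming of the symbols), or PM-local (locally observable, without degenerate actions and without two actions with equal loss rows). Put $$(B,\bar V,r_{\mathcal M})=(\tfrac12,\tfrac12,1)\ \text{for FI},\qquad (\tfrac k2,\tfrac k2,1)\ \text{for MAB},\qquad (2mk^2,\,3m^2k^3,\,2k)\ \text{for PM-local}.$$ **Algorithm.** For $q\in\mathcal P_k$ let $\mathcal P_k'(q)=\{q\}$ for FI and MAB, and $\mathcal P_k'(q)=\{p\in\mathcal P_k:p\ge q/(2k)\}$ for PM-local. For $G:[k]\times\Sigma\to\mathbb R^k$, $\eta>0$ and $\Psi_q(z)=\langle q,e^{-z}+z-1\rangle$ let $$\mathrm{bias}_q(G;x)=\Big\langle q,\mathcal Le_x-\sum_aG(a,\Phi_{ax})\Big\rangle+\max_{c\in\Pi}\Big(\sum_aG(a,\Phi_{ax})_c-\mathcal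 L_{cx}\Big),$$ $$\mathsf{ST}(p,G;q,\eta)=\max_{x\in[d]}\Big[\frac{(p-q)^\top\mathcal Le_x}{\eta}+\frac{\mathrm{bias}_q(G;x)}{\eta}+\frac1{\eta^2}\sum_ap_a\Psi_q\Big(\frac{\eta\,G(a,\Phi_{ax})}{p_a}\Big)\Big],$$ and $\mathrm{opt}'_q(\eta)=\inf_{p\in\mathcal P'_k(q),\,G}\mathsf{ST}(p,G;q,\eta)$. In round $t$, with $\eta_t=1/\beta_t$ and $H$ the Shannon entropy, the algorithm computes $q_t=\arg\min_{q\in\mathcal P_k}\langle\sum_{s<t}\hat y_s,q\rangle+\beta_t\sum_aq_a\log q_a$ and $V'_t=\max\{0,\mathrm{opt}'_{q_t}(\eta_t)\}$; it takes $p_t\in\mathcal P_k'(q_t)$ and $G_t$ with $\mathsf{ST}(p_t,G_t;q_t,\eta_t)\le\mathrm{opt}'_{q_t}(\eta_t)+1/T$ (for instance exact minimizers, when they exist), samples $A_t\sim p_t$, sets $\hat y_t=G_t(A_t,\sigma_t)/p_{tA_t}$, and uses the stability-penalty-adaptive learning rate $$\beta_1=B\sqrt{\frac{\log(1+T)}{\log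 k}},\qquad \beta_{t+1}=\beta_t+\frac{c_1V'_t}{\sqrt{\bar VH(q_1)+\sum_{s=1}^{t-1}V'_sH(q_{s+1})}},\qquad c_1=\sqrt{\frac{\log(1+T)}2}.$$ **Statement.** Such an algorithm exists for every game of the three kinds, and there is an absolute constant $K>0$ (independent of the game, of $k,d,T$, of the environment, and of the choice of $(p_t,G_t)$) such that every such algorithm satisfies the following. 1. (Adversarial regime.) For every environment, $$\mathsf{Reg}_T\le\Big(1+\frac{K}{\log(1+T)}\Big)\,\mathbb E\Big[\sqrt{2\sum_{t=1}^TV'_t\,\log (k)\log(1+T)}\Big]+K\,B\sqrt{\log (k)\log (T)}.$$ In particular $\mathsf{Reg}_T=O\big(\mathbb E[\sqrt{\sum_tV'_t\log (k)\log(1+T)}]+B\sqrt{\log (k)\log (T)}\big)$. 2. (Self-bounding regime.) Let $\Delta\in[0,2]^k$, $C\ge0$, $a^*\in[k]$ with $\Delta_{\min}=\min_{a\ne a^*}\Delta_a>0$, and suppose that the environment satisfies the $(\Delta,C,T)$ self-bounding constraint: every learner playing against it has $\mathsf{Reg}_T\ge\mathbb E[\sum_{t=1}^T\Delta_{A_t}-C]$.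 Then $$\mathsf{Reg}_T\le K\Big(\frac{r_{\mathcal M}\bar V\log (T)\log(kT)}{\Delta_{\min}}+\sqrt{\frac{C\,r_{\mathcal M}\bar V\log (T)\log(kT)}{\Delta_{\min}}}+B\sqrt{\log (k)\log (T)}\Big).$$ -/

import Mathlib

open scoped BigOperators

noncomputable section

namespace PM

/-- A partial monitoring game with `k` actions, `d` outcomes and feedback symbols in `Sym`:
a loss matrix with entries in `[0,1]` and a feedback matrix. -/
structure Game (k d : ℕ) (Sym : Type*) where
  loss : Fin k → Fin d → ℝ
  loss_mem : ∀ a x, loss a x ∈ Set.Icc (0 : ℝ) 1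
  feedback : Fin k → Fin d → Sym

namespace Game

variable {k d : ℕ} {Sym : Type*} (𝒢 : Game k d Sym)

/-- The maximum number of distinct symbols in a single row of the feedback matrix. -/
def numSym : ℕ := Finset.univ.sup fun a => (Set.range (𝒢.feedback a)).ncard

/-- The distributions over outcomes for which action `a` is optimal. -/
def cell (a : Fin k) : Set (Fin d → ℝ) :=
  {u | u ∈ stdSimplex ℝ (Fin d) ∧ ∀ b, ∑ x, (𝒢.loss a x - 𝒢.loss b x) * u x ≤ 0}

end Game

/-- The dimension of the affine hull of a (nonempty) set. -/
def affDim {d : ℕ} (S : Set (Fin d → ℝ)) : ℕ := Module.finrank ℝ (affineSpan ℝ S).direction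

namespace Game

variable {k d : ℕ} {Sym : Type*} (𝒢 : Game k d Sym)

def IsPareto (a : Fin k) : Prop := (𝒢.cell a).Nonempty ∧ affDim (𝒢.cell a) + 1 = d

def IsDegenerate (a : Fin k) : Prop := (𝒢.cell a).Nonempty ∧ affDim (𝒢.cell a) + 1 < d

def AreNeighbors (a b : Fin k) : Prop :=
  𝒢.IsPareto a ∧ 𝒢.IsPareto b ∧ (𝒢.cell a ∩ 𝒢.cell b).Nonempty ∧
    affDim (𝒢.cell a ∩ 𝒢.cell b) + 2 = d

def NonDegenerate : Prop := ∀ a, ¬ 𝒢.IsDegenerate a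

def NoDuplicates : Prop := ∀ a b, a ≠ b → 𝒢.loss a ≠ 𝒢.loss b

def LocallyObservable : Prop :=
  ∀ a b, 𝒢.AreNeighbors a b → ∃ w : Fin k → Sym → ℝ,
    (∀ c, c ≠ a → c ≠ b → ∀ σ, w c σ = 0) ∧
    ∀ x, ∑ c, w c (𝒢.feedback c x) = 𝒢.loss a x - 𝒢.loss b x

end Game

/-- The three classes of games: full information, multi-armed bandits, and non-degenerate locally
observable partial monitoring. -/
inductive Model
  | FI
  | MAB
  | PMlocal

/-- Membership of a game in a class. In full information games every feedback symbol reveals the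
loss of every action; in bandits the feedback is the loss of the chosen action, up to a renaming of
the symbols. -/
def Game.IsModel {k d : ℕ} {Sym : Type*} (𝒢 : Game k d Sym) : Model → Prop
  | .FI => ∀ a x y, 𝒢.feedback a x = 𝒢.feedback a y → ∀ b, 𝒢.loss b x = 𝒢.loss b y
  | .MAB => ∀ a x y, 𝒢.feedback a x = 𝒢.feedback a y ↔ 𝒢.loss a x = 𝒢.loss a y
  | .PMlocal => 𝒢.NonDegenerate ∧ 𝒢.NoDuplicates ∧ 𝒢.LocallyObservable

namespace Model

/-- The worst-case value `V̄` for games with `k` actions and at most `m` symbols per row. -/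
def Vbar (k m : ℕ) : Model → ℝ
  | .FI => 1 / 2
  | .MAB => (k : ℝ) / 2
  | .PMlocal => 3 * (m : ℝ) ^ 2 * (k : ℝ) ^ 3

/-- The input parameter `B` of the algorithm. -/
def B (k m : ℕ) : Model → ℝ
  | .FI => 1 / 2
  | .MAB => (k : ℝ) / 2
  | .PMlocal => 2 * (m : ℝ) * (k : ℝ) ^ 2

/-- The factor `r_M`. -/
def r (k : ℕ) : Model → ℝ
  | .FI => 1
  | .MAB => 1
  | .PMlocal => 2 * (k : ℝ)

/-- The restricted set of sampling distributions. -/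
def feasible {k : ℕ} (M : Model) (q : Fin k → ℝ) : Set (Fin k → ℝ) :=
  {p | p ∈ stdSimplex ℝ (Fin k) ∧
    match M with
    | .FI => p = q
    | .MAB => p = q
    | .PMlocal => ∀ a, q a / (2 * k) ≤ p a}

end Model

/-! ### Exploration by optimization -/

/-- `Ψ_q(z) = ⟨q, exp(-z) + z - 1⟩`. -/
def psi {k : ℕ} (q z : Fin k → ℝ) : ℝ := ∑ b, q b * (Real.exp (-z b) + z b - 1)

/-- Shannon entropy. -/
def entropy {k : ℕ} (q : Fin k → ℝ) : ℝ := ∑ a, Real.negMulLog (q a)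

namespace Game

variable {k d : ℕ} {Sym : Type*} (𝒢 : Game k d Sym)

/-- The bias of the estimation function `G`. -/
def bias (q : Fin k → ℝ) (G : Fin k → Sym → Fin k → ℝ) (x : Fin d) : ℝ :=
  ∑ b, q b * (𝒢.loss b x - ∑ a, G a (𝒢.feedback a x) b) +
    ⨆ c : {c : Fin k // 𝒢.IsPareto c}, (∑ a, G a (𝒢.feedback a x) c - 𝒢.loss c x)

/-- The objective `ST(p, G; q, η)`. -/
def stabTrans (p : Fin k → ℝ) (G : Fin k → Sym → Fin k → ℝ) (q : Fin k → ℝ) (η : ℝ) : ℝ :=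
  ⨆ x : Fin d, ((∑ a, (p a - q a) * 𝒢.loss a x) / η + 𝒢.bias q G x / η +
    1 / η ^ 2 * ∑ a, p a * psi q fun b => η * G a (𝒢.feedback a x) b / p a)

/-- The optimal value `opt'_q(η)` of the restricted problem. -/
def optVal (M : Model) (q : Fin k → ℝ) (η : ℝ) : ℝ :=
  sInf {v | ∃ p ∈ M.feasible q, ∃ G : Fin k → Sym → Fin k → ℝ, v = 𝒢.stabTrans p G q η}

/-- The truncation `max {0, opt'_q(η)}`. -/
def optTrunc (M : Model) (q : Fin k → ℝ) (η : ℝ) : ℝ := max 0 (𝒢.optVal M q η)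

end Game

/-! ### Learners, environments, regret -/

/-- A learner, as a behaviour strategy: after each finite sequence of past actions and feedback
symbols (in chronological order), a distribution over actions. -/
structure Learner (k : ℕ) (Sym : Type*) where
  law : List (Fin k × Sym) → Fin k → ℝ
  law_mem : ∀ h, law h ∈ stdSimplex ℝ (Fin k)

/-- A (possibly randomized and adaptive) environment, as a behaviour strategy: after each finite
sequence of past actions and outcomes, a distribution over outcomes. -/
structure Environment (k d : ℕ) where
  law : List (Fin k × Fin d) → Fin d → ℝ
  law_mem : ∀ h, law h ∈ stdSimplex ℝ (Fin d)

/-- The first `t` rounds of a play of `T` rounds. -/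
def hist {k d T : ℕ} (ω : Fin T → Fin k × Fin d) (t : ℕ) : List (Fin k × Fin d) :=
  (List.ofFn ω).take t

namespace Game

variable {k d : ℕ} {Sym : Type*} (𝒢 : Game k d Sym)

/-- What the learner sees of a sequence of rounds. -/
def observe (h : List (Fin k × Fin d)) : List (Fin k × Sym) :=
  h.map fun o => (o.1, 𝒢.feedback o.1 o.2)

/-- The probability of a play `ω = (A_t, x_t)_t`; in each round the action and the outcome are
drawn independently given the past. -/
def playProb (π : Learner k Sym) (env : Environment k d) {T : ℕ}
    (ω : Fin T → Fin k × Fin d) : ℝ :=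
  ∏ t : Fin T, π.law (𝒢.observe (hist ω t)) (ω t).1 * env.law (hist ω t) (ω t).2

/-- Expectation over the plays of `T` rounds. -/
def expect (π : Learner k Sym) (env : Environment k d) (T : ℕ)
    (f : (Fin T → Fin k × Fin d) → ℝ) : ℝ :=
  ∑ ω : Fin T → Fin k × Fin d, 𝒢.playProb π env ω * f ω

/-- `Reg_T`, the regret against the best fixed action `a* = argmin_a E[∑ L_{a x_t}]`. -/
def regret (π : Learner k Sym) (env : Environment k d) (T : ℕ) : ℝ :=
  𝒢.expect π env T (fun ω => ∑ t, 𝒢.loss (ω t).1 (ω t).2) -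
    ⨅ a : Fin k, 𝒢.expect π env T (fun ω => ∑ t, 𝒢.loss a (ω t).2)

/-- The environment satisfies the `(Δ, C, T)` self-bounding constraint. -/
def SelfBounding (env : Environment k d) (Δ : Fin k → ℝ) (C : ℝ) (T : ℕ) : Prop :=
  ∀ π : Learner k Sym,
    𝒢.expect π env T (fun ω => (∑ t, Δ (ω t).1) - C) ≤ 𝒢.regret π env T

end Game

/-- `Δ_min = min_{a ≠ a*} Δ_a`. -/
def gapMin {k : ℕ} (Δ : Fin k → ℝ) (astar : Fin k) : ℝ := ⨅ a : {a : Fin k // a ≠ astar}, Δ a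

/-! ### The algorithm -/

/-- Exploration by optimization with the stability-penalty-adaptive learning rate, for horizon `T`.
All quantities of round `t` are functions of the list `h` of the `t - 1` past actions and feedback
symbols: `q h` is the output `q_t` of follow-the-regularized-leader, `β h = 1 / η_t`, and
`(p h, G h)` is a solution of the restricted optimization problem. Exact minimizers are allowed, but
since the infimum need not be attained (when there are dominated actions), only minimality up to
`1 / T` is required. -/
structure Algorithm {k d : ℕ} {Sym : Type*} (𝒢 : Game k d Sym) (M : Model) (T : ℕ) where
  q : List (Fin k × Sym) → Fin k → ℝ
  β : List (Fin k × Sym) → ℝ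
  p : List (Fin k × Sym) → Fin k → ℝ
  G : List (Fin k × Sym) → Fin k → Sym → Fin k → ℝ
  q_mem : ∀ h, q h ∈ stdSimplex ℝ (Fin k)
  /-- Follow the regularized leader, with the estimates `G_s(A_s, σ_s) / p_{s A_s}` and the
  regularizer `β_t ∑ q_b log q_b`. -/
  q_min : ∀ h, IsMinOn
    (fun u : Fin k → ℝ =>
      ∑ b, (∑ i : Fin h.length,
        G (h.take i) (h.get i).1 (h.get i).2 b / p (h.take i) (h.get i).1) * u b +
      β h * ∑ b, u b * Real.log (u b))
    (stdSimplex ℝ (Fin k)) (q h)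
  β_one : β [] = M.B k 𝒢.numSym * √(Real.log (1 + T) / Real.log k)
  β_succ : ∀ h o, β (h ++ [o]) = β h +
    √(Real.log (1 + T) / 2) * 𝒢.optTrunc M (q h) (1 / β h) /
      √(M.Vbar k 𝒢.numSym * entropy (q []) +
        ∑ s ∈ Finset.range h.length,
          𝒢.optTrunc M (q (h.take s)) (1 / β (h.take s)) * entropy (q (h.take (s + 1))))
  p_mem : ∀ h, p h ∈ M.feasible (q h)
  near_min : ∀ h, 𝒢.stabTrans (p h) (G h) (q h) (1 / β h) ≤
    𝒢.optVal M (q h) (1 / β h) + 1 / T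

namespace Algorithm

variable {k d : ℕ} {Sym : Type*} {𝒢 : Game k d Sym} {M : Model} {T : ℕ}

/-- The algorithm as a learner: sample `A_t` from `p_t`. -/
def toLearner (alg : Algorithm 𝒢 M T) : Learner k Sym where
  law := alg.p
  law_mem h := (alg.p_mem h).1

/-- `V'_{t+1}` on the play `ω` (rounds are numbered from `0` here). -/
def V (alg : Algorithm 𝒢 M T) (ω : Fin T → Fin k × Fin d) (t : ℕ) : ℝ :=
  𝒢.optTrunc M (alg.q (𝒢.observe (hist ω t))) (1 / alg.β (𝒢.observe (hist ω t)))

end Algorithm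

end PM

end

/-! The regret is first bounded, in expectation, by the path quantity `pathBound`: `β₁ log k + 1/β₁
+ ∑ V'_t/β_t + ∑ (β_{t+1} - β_t) H(q_{t+1})`. This splits into two parts. Follow the regularized
leader, whose one-step inequality (`ftrl_step`) is an exact identity up to a relative entropy,
controls the regret on the estimated losses (`ftrl_regret_le`). Conditionally on the past,
near-optimality of `(p_t, G_t)` controls the rest by `V'_t/β_t + 1/(T β_t)` (`sum_p_mul_gap_le`).
The bias only protects against Pareto optimal comparators; this suffices because the cells of Pareto
optimal actions cover the simplex (`exists_isPareto_optimal`).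

The path quantity is then a deterministic function of a recursion for `β_t`, and only `V'_t ≤ 9 V̄`
is needed to sum it. If the entropies are bounded by `log k`, the penalty gives the main term with
constant 1 and the stability sum is smaller by a factor of order `1/log(1+T)`. If the entropies are
kept, the whole is of order `√(log T · (V̄ log k + ∑ V'_t H(q_{t+1})))`. In a self-bounding
environment the entropy is at most `(1 - q_{t,a*}) log(kT) + 1/T`, the expected weight outside `a*`
is at most `r/Δ_min` times the regret plus `C`, and the resulting quadratic inequality for the
regret is solved.

The bound on `V'_t` uses explicit unbiased estimators for full information and bandits. For locally
observable games a minimax theorem, proved by separating convex sets, lets the sampling distribution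
depend on a mixed outcome `ν`. For fixed `ν`, every Pareto optimal action is joined to a best one by
a chain of neighbors with decreasing loss at `ν`. Spreading the weight `q_b` over the chain of `b`
does not increase the loss at `ν`, and it makes the variance of the chain estimators of order
`m²k²`. This step needs `η B ≤ 1`, which holds when `k ≤ T + 1`; for larger `k` the trivial bound
`T` on the regret is already below the last term. -/

namespace PM

noncomputable section

/-! ### Geometry of cells -/

/-- A nonempty open set is not covered by finitely many proper subspaces. -/
theorem exists_mem_open_forall_notMem_submodule {d : ℕ} {ι : Type*} [Finite ι]
    {O : Set (Fin d → ℝ)} (hO : IsOpen O) (hne : O.Nonempty)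
    (W : ι → Submodule ℝ (Fin d → ℝ)) (hW : ∀ i, W i ≠ ⊤) : ∃ v ∈ O, ∀ i, v ∉ W i := by
  by_contra! hcon
  have hsub : O ⊆ ⋃ i, (W i : Set (Fin d → ℝ)) := fun v hv => by
    obtain ⟨i, hi⟩ := hcon v hv
    exact Set.mem_iUnion.2 ⟨i, hi⟩
  have hzero : MeasureTheory.volume (⋃ i, (W i : Set (Fin d → ℝ))) = 0 :=
    MeasureTheory.measure_iUnion_null fun i =>
      MeasureTheory.Measure.addHaar_submodule MeasureTheory.volume (W i) (hW i)
  have hpos : 0 < MeasureTheory.volume O := hO.measure_pos _ hne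
  exact absurd (MeasureTheory.measure_mono_null hsub hzero) hpos.ne'

theorem isOpen_setOf_forall_pos {d : ℕ} : IsOpen {v : Fin d → ℝ | ∀ x, 0 < v x} := by
  have : {v : Fin d → ℝ | ∀ x, 0 < v x} = ⋂ x, {v : Fin d → ℝ | 0 < v x} := by ext v; simp
  rw [this]
  exact isOpen_iInter_of_finite fun x => isOpen_lt continuous_const (continuous_apply x)

/-- A small push along the all-ones vector leaves the boundary of the orthant without leaving `O`.
Generic points with positive coordinates can therefore be found near any nonnegative vector. -/
theorem inter_setOf_forall_pos_nonempty {d : ℕ} {O : Set (Fin d → ℝ)} (hO : IsOpen O)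
    {u : Fin d → ℝ} (huO : u ∈ O) (hu : ∀ x, 0 ≤ u x) :
    (O ∩ {v | ∀ x, 0 < v x}).Nonempty := by
  have hcont : Continuous fun t : ℝ => u + t • (fun _ : Fin d => (1 : ℝ)) := by fun_prop
  have h0 : ∀ᶠ t in nhds (0 : ℝ), u + t • (fun _ : Fin d => (1 : ℝ)) ∈ O :=
    hcont.continuousAt.eventually_mem (by simpa using hO.mem_nhds huO)
  obtain ⟨t, ht, htp⟩ := ((h0.filter_mono nhdsWithin_le_nhds).and
    (self_mem_nhdsWithin : Set.Ioi (0 : ℝ) ∈ nhdsWithin 0 (Set.Ioi 0))).exists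
  refine ⟨_, ht, fun x => ?_⟩
  have := hu x
  have : (0 : ℝ) < t := htp
  simp
  linarith

/-- The sum of the coordinates as a linear functional. -/
def coordSum (d : ℕ) : (Fin d → ℝ) →ₗ[ℝ] ℝ := ∑ x, LinearMap.proj x

@[simp] theorem coordSum_apply {d : ℕ} (u : Fin d → ℝ) : coordSum d u = ∑ x, u x := by
  simp [coordSum]

/-- Affine dimension and linear dimension of a set in the hyperplane `∑ u = 1`. -/
theorem finrank_span_eq_affDim_add_one {d : ℕ} {S : Set (Fin d → ℝ)} (hne : S.Nonempty)
    (hS : ∀ u ∈ S, ∑ x, u x = 1) :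
    Module.finrank ℝ (Submodule.span ℝ S) = affDim S + 1 := by
  obtain ⟨c, hc⟩ := hne
  have hdir : (affineSpan ℝ S).direction = vectorSpan ℝ S := direction_affineSpan ℝ S
  have hker : vectorSpan ℝ S ≤ LinearMap.ker (coordSum d) := by
    rw [vectorSpan_def, Submodule.span_le]
    rintro _ ⟨u, hu, v, hv, rfl⟩
    simp [hS u hu, hS v hv]
  have hle : vectorSpan ℝ S ≤ Submodule.span ℝ S := by
    rw [vectorSpan_def, Submodule.span_le]
    rintro _ ⟨u, hu, v, hv, rfl⟩
    exact Submodule.sub_mem _ (Submodule.subset_span hu) (Submodule.subset_span hv)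
  -- The coordinate sum vanishes on the directions but equals 1 at `c`, so adding `c` gains exactly
  -- one dimension.
  have hlt : vectorSpan ℝ S < Submodule.span ℝ S := by
    refine lt_of_le_of_ne hle fun h => ?_
    have : c ∈ LinearMap.ker (coordSum d) := hker (h ▸ Submodule.subset_span hc)
    simp [hS c hc] at this
  have h1 := Submodule.finrank_lt_finrank_of_lt hlt
  have hsup : Submodule.span ℝ S ≤ vectorSpan ℝ S ⊔ Submodule.span ℝ {c} := by
    rw [Submodule.span_le]
    intro u hu
    have : u = (u - c) + c := by abel
    rw [this]
    exact Submodule.add_mem_sup (vsub_mem_vectorSpan ℝ hu hc) (Submodule.mem_span_singleton_self c)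
  have h2 := Submodule.finrank_mono hsup
  have h3 := Submodule.finrank_add_le_finrank_add_finrank (vectorSpan ℝ S) (Submodule.span ℝ {c})
  have h4 : Module.finrank ℝ (Submodule.span ℝ {c}) ≤ 1 := (finrank_span_le_card {c}).trans (by simp)
  unfold affDim
  rw [hdir]
  omega

namespace Game

variable {k d : ℕ} {Sym : Type*} (𝒢 : Game k d Sym)

/-- The linear functional `u ↦ ⟨ℓ_a - ℓ_b, u⟩`. -/
def excess (a b : Fin k) : (Fin d → ℝ) →ₗ[ℝ] ℝ :=
  ∑ x, (𝒢.loss a x - 𝒢.loss b x) • LinearMap.proj x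

theorem excess_apply (a b : Fin k) (u : Fin d → ℝ) :
    𝒢.excess a b u = ∑ x, (𝒢.loss a x - 𝒢.loss b x) * u x := by
  simp [excess]

theorem excess_eq_sub (a b : Fin k) (u : Fin d → ℝ) :
    𝒢.excess a b u = ∑ x, 𝒢.loss a x * u x - ∑ x, 𝒢.loss b x * u x := by
  simp [excess_apply, sub_mul]

theorem continuous_excess (a b : Fin k) : Continuous (𝒢.excess a b) :=
  LinearMap.continuous_of_finiteDimensional _

theorem ker_excess_ne_top {a b : Fin k} (h : 𝒢.loss a ≠ 𝒢.loss b) :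
    LinearMap.ker (𝒢.excess a b) ≠ ⊤ := by
  intro htop
  apply h
  funext x
  have : Pi.single x 1 ∈ LinearMap.ker (𝒢.excess a b) := htop ▸ Submodule.mem_top
  rw [LinearMap.mem_ker, excess_apply] at this
  simp [Pi.single_apply] at this
  linarith

/-- The cone over the cell of `a`. -/
def cone (a : Fin k) : Set (Fin d → ℝ) :=
  {u | (∀ x, 0 ≤ u x) ∧ ∀ b, 𝒢.excess a b u ≤ 0}

theorem cell_subset_cone (a : Fin k) : 𝒢.cell a ⊆ 𝒢.cone a := fun u hu =>
  ⟨hu.1.1, fun b => by rw [excess_apply]; exact hu.2 b⟩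

theorem exists_smul_mem_simplex {u : Fin d → ℝ} (hu : ∀ x, 0 ≤ u x) (hne : u ≠ 0) :
    0 < ∑ x, u x ∧ (∑ x, u x)⁻¹ • u ∈ stdSimplex ℝ (Fin d) := by
  have hs : 0 < ∑ x, u x := by
    obtain ⟨x, hx⟩ := Function.ne_iff.1 hne
    exact Finset.sum_pos' (fun i _ => hu i) ⟨x, Finset.mem_univ _, lt_of_le_of_ne (hu x) (Ne.symm hx)⟩
  refine ⟨hs, fun x => mul_nonneg (inv_nonneg.2 hs.le) (hu x), ?_⟩
  simp only [Pi.smul_apply, smul_eq_mul, ← Finset.mul_sum]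
  exact inv_mul_cancel₀ hs.ne'

theorem smul_mem_cell {a : Fin k} {u : Fin d → ℝ} (hu : u ∈ 𝒢.cone a) (hne : u ≠ 0) :
    (∑ x, u x)⁻¹ • u ∈ 𝒢.cell a := by
  obtain ⟨hs, hmem⟩ := exists_smul_mem_simplex hu.1 hne
  refine ⟨hmem, fun b => ?_⟩
  rw [← excess_apply, map_smul, smul_eq_mul]
  exact mul_nonpos_of_nonneg_of_nonpos (inv_nonneg.2 hs.le) (hu.2 b)

theorem mem_span_of_smul_mem {S : Set (Fin d → ℝ)} {u : Fin d → ℝ} {r : ℝ} (hr : r ≠ 0)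
    (h : r • u ∈ S) : u ∈ Submodule.span ℝ S :=
  (Submodule.smul_mem_iff _ hr).1 (Submodule.subset_span h)

/-- Homogenizing turns the affine condition into a linear one: the cell of an action that is not
Pareto optimal lies in a proper subspace, which generic points avoid. Positivity of `d` matters
because an empty cell would span everything when `d = 0`. -/
theorem isPareto_iff_span_eq_top (hd : 0 < d) (a : Fin k) :
    𝒢.IsPareto a ↔ Submodule.span ℝ (𝒢.cell a) = ⊤ := by
  have htop : Module.finrank ℝ (Fin d → ℝ) = d := by simp
  constructor
  · rintro ⟨hne, hdim⟩
    have := finrank_span_eq_affDim_add_one hne fun u hu => hu.1.2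
    exact Submodule.eq_top_of_finrank_eq (by rw [this, hdim, htop])
  · intro h
    have hne : (𝒢.cell a).Nonempty := by
      by_contra hemp
      rw [Set.not_nonempty_iff_eq_empty.1 hemp, Submodule.span_empty] at h
      have : Nonempty (Fin d) := ⟨⟨0, hd⟩⟩
      exact bot_ne_top h
    refine ⟨hne, ?_⟩
    rw [← finrank_span_eq_affDim_add_one hne fun u hu => hu.1.2, h, finrank_top, htop]

/-- The cells of the Pareto optimal actions cover the nonnegative orthant. -/
theorem exists_isPareto_optimal (hk : 0 < k) (hd : 0 < d) {u : Fin d → ℝ} (hu : ∀ x, 0 ≤ u x) :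
    ∃ c, 𝒢.IsPareto c ∧ ∀ b, 𝒢.excess c b u ≤ 0 := by
  by_contra! hcon
  choose! f hf using hcon
  -- If no Pareto optimal action is optimal at `u`, the same strict failures persist on a
  -- neighborhood, so `u` may be replaced by a generic point.
  let O : Set (Fin d → ℝ) := {v | ∀ c, 𝒢.IsPareto c → 0 < 𝒢.excess c (f c) v}
  have hO : IsOpen O := by
    have : O = ⋂ c, ⋂ (_ : 𝒢.IsPareto c), {v | 0 < 𝒢.excess c (f c) v} := by
      ext v; simp [O]
    rw [this]
    exact isOpen_iInter_of_finite fun c => isOpen_iInter_of_finite fun _ =>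
      isOpen_lt continuous_const (𝒢.continuous_excess _ _)
  obtain ⟨v, ⟨hvO, hvP⟩, hv⟩ := exists_mem_open_forall_notMem_submodule
    (hO.inter isOpen_setOf_forall_pos)
    (inter_setOf_forall_pos_nonempty hO (fun c hc => hf c hc : u ∈ O) hu)
    (fun a : {a : Fin k // ¬ 𝒢.IsPareto a} => Submodule.span ℝ (𝒢.cell a))
    (fun a h => a.2 ((𝒢.isPareto_iff_span_eq_top hd a).2 h))
  have : Nonempty (Fin k) := ⟨⟨0, hk⟩⟩
  -- The minimizer at `v` can be neither Pareto optimal, by `hvO`, nor anything else, because `v`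
  -- avoids the spans of the other cells.
  obtain ⟨a, ha⟩ := Finite.exists_min fun a => ∑ x, 𝒢.loss a x * v x
  have hcone : v ∈ 𝒢.cone a :=
    ⟨fun x => (hvP x).le, fun b => by rw [excess_eq_sub]; linarith [ha b]⟩
  have hv0 : v ≠ 0 := fun h => by have := hvP ⟨0, hd⟩; simp [h] at this
  have hspan : v ∈ Submodule.span ℝ (𝒢.cell a) :=
    mem_span_of_smul_mem (inv_ne_zero (exists_smul_mem_simplex hcone.1 hv0).1.ne')
      (𝒢.smul_mem_cell hcone hv0)
  by_cases hp : 𝒢.IsPareto a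
  · exact absurd (hcone.2 (f a)) (not_le.2 (hvO a hp))
  · exact hv ⟨a, hp⟩ hspan

theorem isPareto_of_nonempty (h : 𝒢.NonDegenerate) {a : Fin k}
    (hne : (𝒢.cell a).Nonempty) : 𝒢.IsPareto a := by
  have h1 := finrank_span_eq_affDim_add_one hne fun u hu => hu.1.2
  have h2 : Module.finrank ℝ (Submodule.span ℝ (𝒢.cell a)) ≤ d := by
    simpa using Submodule.finrank_le (Submodule.span ℝ (𝒢.cell a))
  refine ⟨hne, ?_⟩
  have := h a
  unfold IsDegenerate at this
  push Not at this
  have := this hne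
  omega

theorem convex_cone (a : Fin k) : Convex ℝ (𝒢.cone a) := by
  intro u hu v hv s t hs ht _
  refine ⟨fun x => ?_, fun b => ?_⟩
  · exact add_nonneg (mul_nonneg hs (hu.1 x)) (mul_nonneg ht (hv.1 x))
  · rw [map_add, map_smul, map_smul, smul_eq_mul, smul_eq_mul]
    exact add_nonpos (mul_nonpos_of_nonneg_of_nonpos hs (hu.2 b))
      (mul_nonpos_of_nonneg_of_nonpos ht (hv.2 b))

/-- A convex set with full affine span has interior points. Since the cone contains 0, its affine
span is its linear span. -/
theorem interior_cone_nonempty (hd : 0 < d) {a : Fin k} (ha : 𝒢.IsPareto a) :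
    (interior (𝒢.cone a)).Nonempty := by
  rw [(𝒢.convex_cone a).interior_nonempty_iff_affineSpan_eq_top]
  have h0 : (0 : Fin d → ℝ) ∈ 𝒢.cone a := ⟨fun x => le_rfl, fun b => by simp⟩
  have hspan : Submodule.span ℝ (𝒢.cone a) = ⊤ := by
    rw [eq_top_iff, ← (𝒢.isPareto_iff_span_eq_top hd a).1 ha]
    exact Submodule.span_mono (𝒢.cell_subset_cone a)
  have h := affineSpan_insert_zero (k := ℝ) (𝒢.cone a)
  rw [Set.insert_eq_of_mem h0, hspan] at h
  exact SetLike.coe_injective (by simpa using h)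

/-- A nonzero linear functional that is nonpositive on an open set cannot vanish there. -/
theorem excess_neg_of_mem_interior {a b : Fin k} (hab : 𝒢.loss a ≠ 𝒢.loss b) {u : Fin d → ℝ}
    (hu : u ∈ interior (𝒢.cone a)) : 𝒢.excess a b u < 0 := by
  have hle := (interior_subset hu).2 b
  refine lt_of_le_of_ne hle fun h0 => ?_
  obtain ⟨v, hv⟩ : ∃ v, 0 < 𝒢.excess a b v := by
    by_contra! hcon
    refine 𝒢.ker_excess_ne_top hab (eq_top_iff.2 fun v _ => ?_)
    have h1 := hcon v
    have h2 := hcon (-v)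
    rw [map_neg] at h2
    exact le_antisymm h1 (by linarith)
  have hcont : Continuous fun t : ℝ => u + t • v := by fun_prop
  have h1 : ∀ᶠ t in nhds (0 : ℝ), u + t • v ∈ interior (𝒢.cone a) :=
    hcont.continuousAt.eventually_mem (by simpa using isOpen_interior.mem_nhds hu)
  obtain ⟨t, ht, htp⟩ := ((h1.filter_mono nhdsWithin_le_nhds).and
      (self_mem_nhdsWithin : Set.Ioi (0 : ℝ) ∈ nhdsWithin 0 (Set.Ioi 0))).exists
  have htp : (0 : ℝ) < t := htp
  have := (interior_subset ht).2 b
  rw [map_add, map_smul, h0, smul_eq_mul, zero_add] at this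
  nlinarith [mul_pos htp hv]

/-- A Pareto optimal action that is not optimal at `ν` has a neighbor that is better at `ν`. -/
theorem exists_neighbor_excess_neg (hnd : 𝒢.NonDegenerate) (hdup : 𝒢.NoDuplicates) (hd : 0 < d)
    {ν : Fin d → ℝ} (hν : ∀ x, 0 ≤ ν x) {a : Fin k} (ha : 𝒢.IsPareto a)
    (hopt : ∃ b, 𝒢.excess b a ν < 0) :
    ∃ b, 𝒢.AreNeighbors a b ∧ 𝒢.excess b a ν < 0 := by
  classical
  -- The segment from `u` to `ν` must leave the cone of `a` through a facet. The choice of `u`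
  -- guarantees this: a face with linear span of rank at most `d - 2`, together with `ν`, spans a
  -- proper subspace, and `u` avoids all of these.
  obtain ⟨u, hu, hgen⟩ := exists_mem_open_forall_notMem_submodule isOpen_interior
    (𝒢.interior_cone_nonempty hd ha)
    (fun b : {b : Fin k // Module.finrank ℝ (Submodule.span ℝ (𝒢.cell a ∩ 𝒢.cell b)) + 2 ≤ d} =>
      Submodule.span ℝ (𝒢.cell a ∩ 𝒢.cell b) ⊔ Submodule.span ℝ {ν})
    (fun b h => by
      have h1 := Submodule.finrank_add_le_finrank_add_finrank
        (Submodule.span ℝ (𝒢.cell a ∩ 𝒢.cell b)) (Submodule.span ℝ {ν})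
      have h2 : Module.finrank ℝ (Submodule.span ℝ {ν}) ≤ 1 := (finrank_span_le_card {ν}).trans (by simp)
      rw [h, finrank_top] at h1
      have h3 : Module.finrank ℝ (Fin d → ℝ) = d := by simp
      have := b.2
      omega)
  have hucone := interior_subset hu
  have hneg : ∀ b, b ≠ a → 0 < 𝒢.excess b a u := fun b hb => by
    have := 𝒢.excess_neg_of_mem_interior (hdup a b (Ne.symm hb)) hu
    rw [excess_eq_sub] at this ⊢
    linarith
  let S : Finset (Fin k) := Finset.univ.filter fun b => 𝒢.excess b a ν < 0
  have hSne : S.Nonempty := by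
    obtain ⟨b, hb⟩ := hopt
    exact ⟨b, by simp [S, hb]⟩
  have hSa : ∀ b ∈ S, b ≠ a := by
    rintro b hb rfl
    simp [S, excess_apply] at hb
  -- `τ b` is the time at which `b` catches up with `a` on the segment from `u` to `ν`. The first
  -- action to do so shares the exit point with `a`.
  let τ : Fin k → ℝ := fun b => 𝒢.excess b a u / (𝒢.excess b a u - 𝒢.excess b a ν)
  obtain ⟨b, hbS, hmin⟩ := S.exists_min_image τ hSne
  have hbν : 𝒢.excess b a ν < 0 := by simpa [S] using hbS
  have hbu := hneg b (hSa b hbS)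
  set t := τ b with ht
  have ht0 : 0 < t := div_pos hbu (by linarith)
  have ht1 : t < 1 := (div_lt_one (by linarith)).2 (by linarith)
  set v : Fin d → ℝ := (1 - t) • u + t • ν with hv
  have hvx : ∀ c, 𝒢.excess c a v = (1 - t) * 𝒢.excess c a u + t * 𝒢.excess c a ν := fun c => by
    rw [hv, map_add, map_smul, map_smul, smul_eq_mul, smul_eq_mul]
  have hvb : 𝒢.excess b a v = 0 := by
    have hden : 𝒢.excess b a u - 𝒢.excess b a ν ≠ 0 := by linarith
    have : t * (𝒢.excess b a u - 𝒢.excess b a ν) = 𝒢.excess b a u := div_mul_cancel₀ _ hden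
    rw [hvx]; linarith
  have hvc : ∀ c, 0 ≤ 𝒢.excess c a v := fun c => by
    rw [hvx]
    by_cases hc : c ∈ S
    · have hcν : 𝒢.excess c a ν < 0 := by simpa [S] using hc
      have hcu := hneg c (hSa c hc)
      have := (le_div_iff₀ (show 0 < 𝒢.excess c a u - 𝒢.excess c a ν by linarith)).1 (hmin c hc)
      linarith
    · have hcν : 0 ≤ 𝒢.excess c a ν := by simpa [S] using hc
      have hcu : 0 ≤ 𝒢.excess c a u := by
        have := hucone.2 c
        rw [excess_eq_sub] at this ⊢
        linarith
      have := mul_nonneg (sub_nonneg.2 ht1.le) hcu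
      have := mul_nonneg ht0.le hcν
      linarith
  have hvnn : ∀ x, 0 ≤ v x := fun x =>
    add_nonneg (mul_nonneg (sub_nonneg.2 ht1.le) (hucone.1 x)) (mul_nonneg ht0.le (hν x))
  have hva : v ∈ 𝒢.cone a := ⟨hvnn, fun c => by
    have := hvc c
    rw [excess_eq_sub] at this ⊢
    linarith⟩
  have hvb' : v ∈ 𝒢.cone b := ⟨hvnn, fun c => by
    have h1 := hvc c
    have h2 := hvb
    rw [excess_eq_sub] at h1 h2 ⊢
    linarith⟩
  have hv0 : v ≠ 0 := by
    intro h0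
    have hu0 : u ≠ 0 := by rintro rfl; simp at hbu
    obtain ⟨hs, -⟩ := exists_smul_mem_simplex hucone.1 hu0
    have : 0 < ∑ x, v x := by
      simp only [hv, Pi.add_apply, Pi.smul_apply, smul_eq_mul, Finset.sum_add_distrib,
        ← Finset.mul_sum]
      have := mul_pos (sub_pos.2 ht1) hs
      have := mul_nonneg ht0.le (Finset.sum_nonneg fun x (_ : x ∈ Finset.univ) => hν x)
      linarith
    simp [h0] at this
  have hs := (exists_smul_mem_simplex hvnn hv0).1
  have hmem : (∑ x, v x)⁻¹ • v ∈ 𝒢.cell a ∩ 𝒢.cell b :=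
    ⟨𝒢.smul_mem_cell hva hv0, 𝒢.smul_mem_cell hvb' hv0⟩
  have hvspan := mem_span_of_smul_mem (inv_ne_zero hs.ne') hmem
  have hrank := finrank_span_eq_affDim_add_one ⟨_, hmem⟩ fun u hu => hu.1.1.2
  -- If the exit point lay in a small face, then `u`, being a combination of it and `ν`, would lie
  -- in one of the excluded subspaces.
  have hlow : ¬ Module.finrank ℝ (Submodule.span ℝ (𝒢.cell a ∩ 𝒢.cell b)) + 2 ≤ d := by
    intro hle
    refine hgen ⟨b, hle⟩ ?_
    have : u = (1 - t)⁻¹ • v + (-(1 - t)⁻¹ * t) • ν := by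
      have h1 : (1 - t) ≠ 0 := by linarith
      rw [hv]
      ext x
      simp only [Pi.add_apply, Pi.smul_apply, smul_eq_mul]
      field_simp
      ring
    rw [this]
    exact Submodule.add_mem_sup (Submodule.smul_mem _ _ hvspan)
      (Submodule.smul_mem _ _ (Submodule.mem_span_singleton_self ν))
  -- On both cells the two losses agree, so the intersection lies in a hyperplane. With `hlow` its
  -- linear rank is exactly `d - 1`, which is affine dimension `d - 2`.
  have hhigh : Module.finrank ℝ (Submodule.span ℝ (𝒢.cell a ∩ 𝒢.cell b)) < d := by
    have hle : Submodule.span ℝ (𝒢.cell a ∩ 𝒢.cell b) ≤ LinearMap.ker (𝒢.excess a b) := by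
      rw [Submodule.span_le]
      rintro w ⟨hwa, hwb⟩
      have h1 := (𝒢.cell_subset_cone a hwa).2 b
      have h2 := (𝒢.cell_subset_cone b hwb).2 a
      rw [SetLike.mem_coe, LinearMap.mem_ker]
      rw [excess_eq_sub] at h1 h2 ⊢
      linarith
    have h1 := Submodule.finrank_mono hle
    have h2 := Submodule.finrank_lt (𝒢.ker_excess_ne_top (hdup a b (hSa b hbS).symm))
    simp at h2
    omega
  exact ⟨b, ⟨ha, 𝒢.isPareto_of_nonempty hnd ⟨_, hmem.2⟩, ⟨_, hmem⟩, by omega⟩, hbν⟩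

end Game

/-! ### Bounded estimators of loss differences -/

namespace Game

variable {k d : ℕ} {Sym : Type*} (𝒢 : Game k d Sym)

theorem ncard_range_feedback_le (a : Fin k) : (Set.range (𝒢.feedback a)).ncard ≤ 𝒢.numSym :=
  Finset.le_sup (f := fun a => (Set.range (𝒢.feedback a)).ncard) (Finset.mem_univ a)

theorem one_le_numSym (hk : 0 < k) (hd : 0 < d) : 1 ≤ 𝒢.numSym := by
  refine le_trans ?_ (𝒢.ncard_range_feedback_le ⟨0, hk⟩)
  exact (Set.ncard_pos (Set.finite_range _)).2 ⟨_, ⟨0, hd⟩, rfl⟩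

theorem abs_loss_sub_le (a b : Fin k) (x : Fin d) : |𝒢.loss a x - 𝒢.loss b x| ≤ 1 := by
  have h1 := 𝒢.loss_mem a x
  have h2 := 𝒢.loss_mem b x
  rw [abs_le]
  constructor <;> linarith [h1.1, h1.2, h2.1, h2.2]

/-- The symbols of action `a`, linked when they are compatible with a common symbol of `b`. -/
def symbolGraph (a b : Fin k) : SimpleGraph (Set.range (𝒢.feedback a)) :=
  SimpleGraph.fromRel fun σ τ =>
    ∃ x y, 𝒢.feedback a x = σ ∧ 𝒢.feedback a y = τ ∧ 𝒢.feedback b x = 𝒢.feedback b y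

theorem reachable_symbolGraph {a b : Fin k} {x y : Fin d}
    (h : 𝒢.feedback b x = 𝒢.feedback b y) :
    (𝒢.symbolGraph a b).Reachable ⟨𝒢.feedback a x, x, rfl⟩ ⟨𝒢.feedback a y, y, rfl⟩ := by
  by_cases hxy : 𝒢.feedback a x = 𝒢.feedback a y
  · have : (⟨𝒢.feedback a x, x, rfl⟩ : Set.range (𝒢.feedback a)) = ⟨𝒢.feedback a y, y, rfl⟩ :=
      Subtype.ext hxy
    rw [this]
  · refine SimpleGraph.Adj.reachable ?_
    rw [symbolGraph, SimpleGraph.fromRel_adj]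
    exact ⟨fun he => hxy (congrArg Subtype.val he), Or.inl ⟨x, y, rfl, rfl, h⟩⟩

/-- Across an edge the two outcomes give the same symbol of `b`, so `g` cancels and `f` changes by
the difference of two loss differences, each in `[-1, 1]`. -/
theorem abs_sub_le_of_walk {a b : Fin k} {f g : Sym → ℝ}
    (hfg : ∀ x, f (𝒢.feedback a x) + g (𝒢.feedback b x) = 𝒢.loss a x - 𝒢.loss b x)
    {σ τ : Set.range (𝒢.feedback a)} (p : (𝒢.symbolGraph a b).Walk σ τ) :
    |f σ - f τ| ≤ 2 * p.length := by
  induction p with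
  | nil => simp
  | @cons u v w hadj p ih =>
    have key : ∀ x y, 𝒢.feedback b x = 𝒢.feedback b y →
        |f (𝒢.feedback a x) - f (𝒢.feedback a y)| ≤ 2 := fun x y hxy => by
      have h1 := hfg x
      have h2 := hfg y
      rw [hxy] at h1
      have h3 := abs_le.1 (𝒢.abs_loss_sub_le a b x)
      have h4 := abs_le.1 (𝒢.abs_loss_sub_le a b y)
      rw [abs_le]
      constructor <;> linarith [h3.1, h3.2, h4.1, h4.2]
    have hstep : |f u - f v| ≤ 2 := by
      rw [symbolGraph, SimpleGraph.fromRel_adj] at hadj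
      rcases hadj.2 with ⟨x, y, hx, hy, hxy⟩ | ⟨x, y, hx, hy, hxy⟩
      · rw [← hx, ← hy]; exact key x y hxy
      · rw [← hx, ← hy, abs_sub_comm]; exact key x y hxy
    have := abs_sub_le (f u) (f v) (f w)
    rw [SimpleGraph.Walk.length_cons]
    push_cast
    linarith

/-- A path visits each symbol at most once, so it has at most `numSym - 1` edges. -/
theorem abs_sub_le_of_reachable {a b : Fin k} {f g : Sym → ℝ}
    (hfg : ∀ x, f (𝒢.feedback a x) + g (𝒢.feedback b x) = 𝒢.loss a x - 𝒢.loss b x)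
    {σ τ : Set.range (𝒢.feedback a)} (h : (𝒢.symbolGraph a b).Reachable σ τ) :
    |f σ - f τ| ≤ 2 * 𝒢.numSym - 2 := by
  classical
  obtain ⟨p, hp⟩ := h.exists_isPath
  have : Fintype (Set.range (𝒢.feedback a)) := (Set.finite_range _).fintype
  have h1 := hp.length_lt
  rw [← Nat.card_eq_fintype_card] at h1
  have h2 : p.length + 1 ≤ 𝒢.numSym := h1.trans_le (𝒢.ncard_range_feedback_le a)
  have h3 : (p.length : ℝ) + 1 ≤ 𝒢.numSym := by exact_mod_cast h2
  have := 𝒢.abs_sub_le_of_walk hfg p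
  linarith

/-- In locally observable games, loss differences of neighbors have estimators bounded by
twice the number of symbols. -/
theorem exists_bounded_estimator (hloc : 𝒢.LocallyObservable) {a b : Fin k}
    (hab : 𝒢.AreNeighbors a b) :
    ∃ w : Fin k → Sym → ℝ, (∀ c, c ≠ a → c ≠ b → ∀ σ, w c σ = 0) ∧
      (∀ c σ, |w c σ| ≤ 2 * 𝒢.numSym) ∧
      ∀ x, ∑ c, w c (𝒢.feedback c x) = 𝒢.loss a x - 𝒢.loss b x := by
  classical
  have hne : a ≠ b := by
    rintro rfl
    obtain ⟨h1, -, -, h2⟩ := hab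
    have := h1.2
    rw [Set.inter_self] at h2
    omega
  have hd : 0 < d := by have := hab.1.2; omega
  have hm : (1 : ℝ) ≤ 𝒢.numSym := by exact_mod_cast 𝒢.one_le_numSym (Fin.pos a) hd
  have hsum : ∀ (w : Fin k → Sym → ℝ), (∀ c, c ≠ a → c ≠ b → ∀ σ, w c σ = 0) → ∀ x,
      ∑ c, w c (𝒢.feedback c x) = w a (𝒢.feedback a x) + w b (𝒢.feedback b x) := fun w hw x =>
    Fintype.sum_eq_add a b hne fun c hc => hw c hc.1 hc.2 _
  obtain ⟨w, hw0, hw⟩ := hloc a b hab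
  have hfg : ∀ x, w a (𝒢.feedback a x) + w b (𝒢.feedback b x) = 𝒢.loss a x - 𝒢.loss b x :=
    fun x => by rw [← hsum w hw0, hw]
  -- On each connected component the estimator of `a` can be shifted by a constant, with the
  -- opposite shift for `b`. It is normalized to vanish at one chosen symbol per component.
  let rep : Set.range (𝒢.feedback a) → Set.range (𝒢.feedback a) := fun σ =>
    ((𝒢.symbolGraph a b).connectedComponentMk σ).out
  have hrep : ∀ σ, (𝒢.symbolGraph a b).Reachable σ (rep σ) := fun σ =>
    SimpleGraph.ConnectedComponent.exact (Quot.out_eq _).symm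
  let wa : Sym → ℝ := fun σ =>
    if h : σ ∈ Set.range (𝒢.feedback a) then w a σ - w a (rep ⟨σ, h⟩) else 0
  have hwa : ∀ x, wa (𝒢.feedback a x) =
      w a (𝒢.feedback a x) - w a (rep ⟨𝒢.feedback a x, x, rfl⟩) := fun x => by
    simp only [wa]; rw [dif_pos ⟨x, rfl⟩]
  have hwa_bound : ∀ σ, |wa σ| ≤ 2 * 𝒢.numSym - 2 := fun σ => by
    by_cases h : σ ∈ Set.range (𝒢.feedback a)
    · simp only [wa, dif_pos h]
      exact 𝒢.abs_sub_le_of_reachable hfg (hrep ⟨σ, h⟩)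
    · simp only [wa, dif_neg h, abs_zero]; linarith
  -- The estimator of `b` is forced by the equation at any one outcome with the given symbol. Two
  -- such outcomes lie over the same component, so the choice does not matter.
  let wb : Sym → ℝ := fun τ =>
    if h : ∃ x, 𝒢.feedback b x = τ then
      𝒢.loss a h.choose - 𝒢.loss b h.choose - wa (𝒢.feedback a h.choose) else 0
  have hwb_bound : ∀ τ, |wb τ| ≤ 2 * 𝒢.numSym := fun τ => by
    by_cases h : ∃ x, 𝒢.feedback b x = τ
    · simp only [wb, dif_pos h]
      refine (abs_sub _ _).trans ?_
      have := 𝒢.abs_loss_sub_le a b h.choose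
      have := hwa_bound (𝒢.feedback a h.choose)
      linarith
    · simp only [wb, dif_neg h, abs_zero]; linarith
  have hwab : ∀ x, wa (𝒢.feedback a x) + wb (𝒢.feedback b x) = 𝒢.loss a x - 𝒢.loss b x := by
    intro x
    have h : ∃ y, 𝒢.feedback b y = 𝒢.feedback b x := ⟨x, rfl⟩
    simp only [wb, dif_pos h, hwa]
    have hy := h.choose_spec
    set y := h.choose
    have hreach := 𝒢.reachable_symbolGraph (a := a) hy
    have hrepeq : rep ⟨𝒢.feedback a y, y, rfl⟩ = rep ⟨𝒢.feedback a x, x, rfl⟩ := by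
      simp only [rep]
      rw [SimpleGraph.ConnectedComponent.sound hreach]
    rw [hrepeq]
    have h1 := hfg x
    have h2 := hfg y
    rw [hy] at h2
    linarith
  let w' : Fin k → Sym → ℝ := fun c => if c = a then wa else if c = b then wb else 0
  have hw'0 : ∀ c, c ≠ a → c ≠ b → ∀ σ, w' c σ = 0 := fun c h1 h2 σ => by simp [w', h1, h2]
  refine ⟨w', hw'0, fun c σ => ?_, fun x => ?_⟩
  · simp only [w']
    split_ifs
    · linarith [hwa_bound σ]
    · exact hwb_bound σ
    · simp
  · rw [hsum w' hw'0, ← hwab x]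
    simp [w', hne.symm]

/-- Estimators of `ℓ_b - ℓ_ρ`, supported on a chain of actions from `b` to `ρ` with decreasing
loss at `ν`. -/
theorem exists_chain_estimator (hG : 𝒢.IsModel .PMlocal) (hd : 0 < d) {ν : Fin d → ℝ}
    (hν : ∀ x, 0 ≤ ν x) {ρ : Fin k} (hρ : ∀ b, b ≠ ρ → 0 < 𝒢.excess b ρ ν) (b : Fin k)
    (hb : 𝒢.IsPareto b) :
    ∃ (P : Finset (Fin k)) (g : Fin k → Sym → ℝ), b ∈ P ∧ (∀ c ∈ P, 𝒢.excess c b ν ≤ 0) ∧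
      (∀ c, c ∉ P → ∀ σ, g c σ = 0) ∧ (∀ c σ, |g c σ| ≤ 4 * 𝒢.numSym) ∧
      (∀ σ, |g b σ| ≤ 2 * 𝒢.numSym) ∧
      ∀ x, ∑ c, g c (𝒢.feedback c x) = 𝒢.loss b x - 𝒢.loss ρ x := by
  classical
  obtain ⟨hnd, hdup, hloc⟩ := hG
  -- Induction on the loss at `ν`: a non-optimal action is joined to a strictly better neighbor,
  -- whose chain is already available.
  have hwf : WellFounded fun c b : Fin k => 𝒢.excess c b ν < 0 := by
    have : (fun c b : Fin k => 𝒢.excess c b ν < 0) =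
        fun c b => (∑ x, 𝒢.loss c x * ν x) < ∑ x, 𝒢.loss b x * ν x := by
      funext c b; rw [excess_eq_sub, sub_neg]
    rw [this]
    have : Std.Irrefl fun c b : Fin k => (∑ x, 𝒢.loss c x * ν x) < ∑ x, 𝒢.loss b x * ν x :=
      ⟨fun c => lt_irrefl _⟩
    have : IsTrans (Fin k) fun c b => (∑ x, 𝒢.loss c x * ν x) < ∑ x, 𝒢.loss b x * ν x :=
      ⟨fun _ _ _ => lt_trans⟩
    exact Finite.wellFounded_of_trans_of_irrefl _
  induction b using hwf.induction with
  | _ b ih =>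
  by_cases hbρ : b = ρ
  · subst hbρ
    refine ⟨{b}, 0, by simp, ?_, by simp, by simp, by simp, by simp⟩
    intro c hc
    rw [Finset.mem_singleton.1 hc, excess_eq_sub, sub_self]
  · obtain ⟨e, hbe, hlt⟩ := 𝒢.exists_neighbor_excess_neg hnd hdup hd hν hb ⟨ρ, by
      have := hρ b hbρ
      rw [excess_eq_sub] at this ⊢
      linarith⟩
    obtain ⟨P, g, heP, hP, hg0, hgb, hge, hg⟩ := ih e hlt hbe.2.1
    obtain ⟨w, hw0, hwb, hw⟩ := 𝒢.exists_bounded_estimator hloc hbe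
    -- All actions on the chain of `e` are at least as good as `e` at `ν`, hence strictly better
    -- than `b`.
    have hbP : b ∉ P := fun h => by
      have := hP b h
      rw [excess_eq_sub] at this hlt
      linarith
    refine ⟨insert b P, fun c σ => w c σ + g c σ, Finset.mem_insert_self _ _, ?_, ?_, ?_, ?_, ?_⟩
    · intro c hc
      rcases Finset.mem_insert.1 hc with rfl | hc
      · rw [excess_eq_sub, sub_self]
      · have := hP c hc
        rw [excess_eq_sub] at this hlt ⊢
        linarith
    · intro c hc σ
      rw [Finset.mem_insert, not_or] at hc
      beta_reduce
      rw [hg0 c hc.2, hw0 c hc.1 (fun h => hc.2 (h ▸ heP)), add_zero]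
    · intro c σ
      beta_reduce
      have hn : (0 : ℝ) ≤ 𝒢.numSym := Nat.cast_nonneg _
      by_cases hcb : c = b
      · subst hcb
        rw [hg0 c hbP, add_zero]
        linarith [hwb c σ]
      -- Only at `e` do the new edge and the old chain overlap. The induction keeps the sharper
      -- bound `2 * numSym` at the head of the chain, so the two contributions add to `4 * numSym`,
      -- whatever the length of the chain.
      · by_cases hce : c = e
        · subst hce
          refine (abs_add_le _ _).trans ?_
          linarith [hwb c σ, hge σ]
        · rw [hw0 c hcb hce, zero_add]
          exact hgb c σ
    · intro σ
      beta_reduce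
      rw [hg0 b hbP, add_zero]
      exact hwb b σ
    · intro x
      rw [Finset.sum_add_distrib, hw, hg]
      ring

/-- The chain estimators for a `ν` with possible ties. -/
theorem exists_root_chain_estimators (hG : 𝒢.IsModel .PMlocal) (hk : 0 < k) (hd : 0 < d)
    {ν : Fin d → ℝ} (hν : ∀ x, 0 ≤ ν x) :
    ∃ ρ : Fin k, ∀ b, 𝒢.IsPareto b →
      ∃ (P : Finset (Fin k)) (g : Fin k → Sym → ℝ), b ∈ P ∧ (∀ c ∈ P, 𝒢.excess c b ν ≤ 0) ∧
      (∀ c, c ∉ P → ∀ σ, g c σ = 0) ∧ (∀ c σ, |g c σ| ≤ 4 * 𝒢.numSym) ∧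
      ∀ x, ∑ c, g c (𝒢.feedback c x) = 𝒢.loss b x - 𝒢.loss ρ x := by
  have hswap : ∀ a b v, 𝒢.excess a b v = - 𝒢.excess b a v := fun a b v => by
    rw [excess_eq_sub, excess_eq_sub]; ring
  -- `ν` is perturbed to a `v` that breaks all ties and keeps every strict comparison. An action
  -- that is no worse than `b` at `v` is then no worse than `b` at `ν`.
  let O : Set (Fin d → ℝ) := {v | ∀ a b, 𝒢.excess a b ν < 0 → 𝒢.excess a b v < 0}
  have hO : IsOpen O := by
    have : O = ⋂ a, ⋂ b, ⋂ (_ : 𝒢.excess a b ν < 0), {v | 𝒢.excess a b v < 0} := by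
      ext v; simp [O]
    rw [this]
    exact isOpen_iInter_of_finite fun a => isOpen_iInter_of_finite fun b =>
      isOpen_iInter_of_finite fun _ => isOpen_lt (𝒢.continuous_excess _ _) continuous_const
  obtain ⟨v, ⟨hvO, hvP⟩, hv⟩ := exists_mem_open_forall_notMem_submodule
    (hO.inter isOpen_setOf_forall_pos)
    (inter_setOf_forall_pos_nonempty hO (fun _ _ h => h : ν ∈ O) hν)
    (fun e : {e : Fin k × Fin k // e.1 ≠ e.2} => LinearMap.ker (𝒢.excess e.1.1 e.1.2))
    (fun e => 𝒢.ker_excess_ne_top (hG.2.1 _ _ e.2))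
  have : Nonempty (Fin k) := ⟨⟨0, hk⟩⟩
  obtain ⟨ρ, hρ⟩ := Finite.exists_min fun a => ∑ x, 𝒢.loss a x * v x
  refine ⟨ρ, fun b hb => ?_⟩
  obtain ⟨P, g, h1, h2, h3, h4, -, h5⟩ := 𝒢.exists_chain_estimator hG hd (fun x => (hvP x).le)
    (ρ := ρ) (fun b hb => by
      refine lt_of_le_of_ne ?_ fun h => hv ⟨(b, ρ), hb⟩ h.symm
      rw [excess_eq_sub]
      linarith [hρ b]) b hb
  refine ⟨P, g, h1, fun c hc => ?_, h3, h4, h5⟩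
  by_contra! hcon
  have h6 := hvO b c (by rw [hswap]; linarith)
  have h7 := h2 c hc
  rw [hswap] at h7
  linarith

end Game

/-! ### A minimax theorem and the value of the restricted problem -/

/-- If every mixture of finitely many convex functions can be made at most `V`, then all of them
can simultaneously be made at most any `V' > V`. -/
theorem exists_forall_le_of_forall_mixture_le {E : Type*} [AddCommGroup E] [Module ℝ E] {d : ℕ}
    (hd : 0 < d) {X : Set E} {f : Fin d → E → ℝ} (hf : ∀ i, ConvexOn ℝ X (f i)) {V V' : ℝ}
    (hV : V < V') (h : ∀ ν ∈ stdSimplex ℝ (Fin d), ∃ x ∈ X, ∑ i, ν i * f i x ≤ V) :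
    ∃ x ∈ X, ∀ i, f i x ≤ V' := by
  classical
  by_contra! hcon
  -- The upward closure of the attainable value vectors is convex. If the claim fails, it is
  -- disjoint from the open orthant below `V'`, and a separating functional, normalized, is a
  -- mixture contradicting `h`.
  let S : Set (Fin d → ℝ) := {v | ∃ x ∈ X, ∀ i, f i x ≤ v i}
  let U : Set (Fin d → ℝ) := {v | ∀ i, v i < V'}
  have hU : IsOpen U := by
    have : U = ⋂ i, {v : Fin d → ℝ | v i < V'} := by ext v; simp [U]
    rw [this]
    exact isOpen_iInter_of_finite fun i => isOpen_lt (continuous_apply i) continuous_const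
  have hUc : Convex ℝ U := by
    have : U = ⋂ i, {v : Fin d → ℝ | v i < V'} := by ext v; simp [U]
    rw [this]
    exact convex_iInter fun i => convex_halfSpace_lt (LinearMap.proj i : (Fin d → ℝ) →ₗ[ℝ] ℝ).isLinear _
  have hS : Convex ℝ S := by
    rintro v ⟨x, hx, hxv⟩ w ⟨y, hy, hyw⟩ s t hs ht hst
    refine ⟨s • x + t • y, (hf ⟨0, hd⟩).1 hx hy hs ht hst, fun i => ?_⟩
    refine ((hf i).2 hx hy hs ht hst).trans ?_
    exact add_le_add (mul_le_mul_of_nonneg_left (hxv i) hs) (mul_le_mul_of_nonneg_left (hyw i) ht)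
  have hdisj : Disjoint U S := by
    rw [Set.disjoint_left]
    rintro v hvU ⟨x, hx, hxv⟩
    obtain ⟨i, hi⟩ := hcon x hx
    exact absurd (hi.trans_le (hxv i)) (not_lt.2 (hvU i).le)
  obtain ⟨φ, u, hφU, hφS⟩ := geometric_hahn_banach_open hUc hU hS hdisj
  set l : Fin d → ℝ := fun i => φ (Pi.single i 1) with hl
  have hφ : ∀ v, φ v = ∑ i, v i * l i := fun v => by
    conv_lhs => rw [← Finset.univ_sum_single v, map_sum]
    refine Finset.sum_congr rfl fun i _ => ?_
    have : (Pi.single i (v i) : Fin d → ℝ) = v i • Pi.single i 1 := by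
      rw [← Pi.single_smul]; simp
    rw [this, map_smul, smul_eq_mul]
  obtain ⟨x₀, hx₀, -⟩ := h (Pi.single ⟨0, hd⟩ 1) (single_mem_stdSimplex ℝ _)
  have hl0 : ∀ i, 0 ≤ l i := fun i => by
    by_contra! hneg
    set A := φ (fun j => f j x₀) with hA
    have hAu : u ≤ A := hφS _ ⟨x₀, hx₀, fun j => le_rfl⟩
    -- `S` is closed upward. A negative coefficient would let `φ` fall to `u - 1` on `S` by this
    -- shift.
    set t := (A - u + 1) / (- l i) with ht
    have ht0 : 0 < t := div_pos (by linarith) (by linarith)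
    have hmem : (fun j => f j x₀) + t • (Pi.single i 1 : Fin d → ℝ) ∈ S := by
      refine ⟨x₀, hx₀, fun j => ?_⟩
      have : 0 ≤ (Pi.single i 1 : Fin d → ℝ) j := by
        rw [Pi.single_apply]; split_ifs <;> norm_num
      simp only [Pi.add_apply, Pi.smul_apply, smul_eq_mul]
      nlinarith [mul_nonneg ht0.le this]
    have h1 := hφS _ hmem
    rw [map_add, map_smul, smul_eq_mul, ← hA] at h1
    have h2 : t * (- l i) = A - u + 1 := div_mul_cancel₀ _ (by linarith)
    have h3 : t * φ (Pi.single i 1) = - (A - u + 1) := by rw [← h2]; simp [hl]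
    linarith
  have hVU : (fun _ : Fin d => V) ∈ U := fun _ => hV
  have hVu := hφU _ hVU
  rw [hφ, ← Finset.mul_sum] at hVu
  have hL : 0 < ∑ i, l i := by
    refine lt_of_le_of_ne (Finset.sum_nonneg fun i _ => hl0 i) fun h0 => ?_
    have hall : ∀ i, l i = 0 := fun i =>
      (Finset.sum_eq_zero_iff_of_nonneg fun i _ => hl0 i).1 h0.symm i (Finset.mem_univ i)
    have h1 := hφS _ ⟨x₀, hx₀, fun j => le_rfl⟩
    rw [hφ] at h1
    simp only [hall, mul_zero, Finset.sum_const_zero] at h1 hVu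
    linarith
  obtain ⟨x, hx, hxV⟩ := h (fun i => l i / ∑ i, l i)
    ⟨fun i => div_nonneg (hl0 i) hL.le, by rw [← Finset.sum_div, div_self hL.ne']⟩
  have h1 := hφS _ ⟨x, hx, fun j => le_rfl⟩
  rw [hφ] at h1
  have h2 : ∑ i, l i / (∑ i, l i) * f i x = (∑ i, f i x * l i) / ∑ i, l i := by
    rw [Finset.sum_div]
    exact Finset.sum_congr rfl fun i _ => by ring
  rw [h2, div_le_iff₀ hL] at hxV
  linarith

/-- Joint convexity of `(p, g) ↦ p exp (-η g / p)`. -/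
theorem perspective_exp_le {p₁ p₂ g₁ g₂ s t η : ℝ} (hp₁ : 0 < p₁) (hp₂ : 0 < p₂) (hs : 0 ≤ s)
    (ht : 0 ≤ t) (hst : s + t = 1) :
    (s * p₁ + t * p₂) * Real.exp (-(η * (s * g₁ + t * g₂) / (s * p₁ + t * p₂))) ≤
      s * (p₁ * Real.exp (-(η * g₁ / p₁))) + t * (p₂ * Real.exp (-(η * g₂ / p₂))) := by
  have hp : 0 < s * p₁ + t * p₂ := by
    rcases hs.eq_or_lt with rfl | hs'
    · have : t = 1 := by linarith
      subst this; linarith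
    · have := mul_pos hs' hp₁
      have := mul_nonneg ht hp₂.le
      linarith
  have h := convexOn_exp.2 (Set.mem_univ (-(η * g₁ / p₁))) (Set.mem_univ (-(η * g₂ / p₂)))
    (div_nonneg (mul_nonneg hs hp₁.le) hp.le) (div_nonneg (mul_nonneg ht hp₂.le) hp.le)
    (by rw [← add_div, div_self hp.ne'])
  simp only [smul_eq_mul] at h
  have harg : s * p₁ / (s * p₁ + t * p₂) * -(η * g₁ / p₁) +
      t * p₂ / (s * p₁ + t * p₂) * -(η * g₂ / p₂) =
      -(η * (s * g₁ + t * g₂) / (s * p₁ + t * p₂)) := by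
    field_simp
    ring
  rw [harg] at h
  calc _ ≤ (s * p₁ + t * p₂) * (s * p₁ / (s * p₁ + t * p₂) * Real.exp (-(η * g₁ / p₁)) +
      t * p₂ / (s * p₁ + t * p₂) * Real.exp (-(η * g₂ / p₂))) :=
        mul_le_mul_of_nonneg_left h hp.le
    _ = _ := by field_simp

/-- The standard estimate holds for arguments of absolute value at most 1, so it is applied at
`-z/2` and squared. The remaining slack is `z² (2 + z)(6 - z) / 16`. -/
theorem exp_neg_le_quadratic {z : ℝ} (hz : |z| ≤ 2) :
    Real.exp (-z) ≤ 1 - z + 3 / 2 * z ^ 2 := by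
  have h := Real.abs_exp_sub_one_sub_id_le (x := -z / 2) (by
    rw [abs_le] at hz ⊢; constructor <;> linarith [hz.1, hz.2])
  have h1 : Real.exp (-z / 2) ≤ 1 - z / 2 + z ^ 2 / 4 := by
    have := (abs_le.1 h).2
    nlinarith
  have h2 : Real.exp (-z) = Real.exp (-z / 2) ^ 2 := by
    rw [← Real.exp_nat_mul]; congr 1; push_cast; ring
  have h3 : Real.exp (-z / 2) ^ 2 ≤ (1 - z / 2 + z ^ 2 / 4) ^ 2 :=
    pow_le_pow_left₀ (Real.exp_pos _).le h1 2
  rw [abs_le] at hz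
  rw [h2]
  refine h3.trans ?_
  have hz2 : 0 ≤ z ^ 2 := sq_nonneg z
  have : 0 ≤ z ^ 2 * ((2 + z) * (6 - z)) :=
    mul_nonneg hz2 (mul_nonneg (by linarith) (by linarith))
  nlinarith

/-- From `exp z ≥ 1 + z + z²/2` and `(1 - z + z²/2)(1 + z + z²/2) = 1 + z⁴/4 ≥ 1`. -/
theorem exp_neg_add_sub_one_le {z : ℝ} (hz : 0 ≤ z) : Real.exp (-z) + z - 1 ≤ z ^ 2 / 2 := by
  have h1 := Real.quadratic_le_exp_of_nonneg hz
  have h2 : Real.exp (-z) * Real.exp z = 1 := by rw [← Real.exp_add]; simp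
  have h3 : 0 < 1 + z + z ^ 2 / 2 := by positivity
  have h4 : Real.exp (-z) * (1 + z + z ^ 2 / 2) ≤ 1 :=
    (mul_le_mul_of_nonneg_left h1 (Real.exp_pos _).le).trans h2.le
  have h5 : 1 ≤ (1 - z + z ^ 2 / 2) * (1 + z + z ^ 2 / 2) := by nlinarith [sq_nonneg (z ^ 2)]
  have := le_of_mul_le_mul_right (h4.trans h5) h3
  linarith

/-! ### Values of full information and bandit games, and the convex surrogate -/

namespace Game

variable {k d : ℕ} {Sym : Type*} (𝒢 : Game k d Sym)

/-- `0 ≤ V` covers the default value 0 of `sInf` on sets unbounded below, so boundedness of the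
objective never has to be shown. -/
theorem sInf_le_of_mem_of_le {S : Set ℝ} {v V : ℝ} (hv : v ∈ S) (hvV : v ≤ V) (hV : 0 ≤ V) :
    sInf S ≤ V := by
  by_cases h : BddBelow S
  · exact (csInf_le h hv).trans hvV
  · rwa [Real.sInf_of_not_bddBelow h]

theorem optTrunc_le {M : Model} {q p : Fin k → ℝ} {G : Fin k → Sym → Fin k → ℝ} {η V : ℝ}
    (hp : p ∈ M.feasible q) (hV : 0 ≤ V)
    (h : ∀ x, (∑ a, (p a - q a) * 𝒢.loss a x) / η + 𝒢.bias q G x / η +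
      1 / η ^ 2 * ∑ a, p a * psi q (fun b => η * G a (𝒢.feedback a x) b / p a) ≤ V) :
    𝒢.optTrunc M q η ≤ V :=
  max_le hV (sInf_le_of_mem_of_le ⟨p, hp, G, rfl⟩ (Real.iSup_le h hV) hV)

theorem bias_eq_zero {q : Fin k → ℝ} {G : Fin k → Sym → Fin k → ℝ} {x : Fin d}
    (h : ∀ b, ∑ a, G a (𝒢.feedback a x) b = 𝒢.loss b x) : 𝒢.bias q G x = 0 := by
  simp [bias, h]

/-- An unbiased estimator with `p = q` has no transformation cost. -/
theorem optTrunc_le_of_unbiased {M : Model} {q : Fin k → ℝ} {G : Fin k → Sym → Fin k → ℝ}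
    {η V : ℝ} (hη : 0 < η) (hq : q ∈ M.feasible q) (hV : 0 ≤ V)
    (hG : ∀ x b, ∑ a, G a (𝒢.feedback a x) b = 𝒢.loss b x)
    (h : ∀ x, ∑ a, q a * psi q (fun b => η * G a (𝒢.feedback a x) b / q a) ≤ η ^ 2 * V) :
    𝒢.optTrunc M q η ≤ V := by
  refine 𝒢.optTrunc_le (G := G) hq hV fun x => ?_
  rw [𝒢.bias_eq_zero (hG x)]
  simp only [sub_self, zero_mul, Finset.sum_const_zero, zero_div, zero_add]
  rw [one_div, inv_mul_le_iff₀ (by positivity)]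
  exact h x

/-- Each symbol reveals all losses, so `G` can be `q a` times the loss vector. After division by `p
a = q a` the estimate is the exact loss, and each exponent is at most `η`. -/
theorem optTrunc_le_FI (hG : 𝒢.IsModel .FI) {q : Fin k → ℝ} (hq : q ∈ stdSimplex ℝ (Fin k))
    (hq0 : ∀ a, 0 < q a) {η : ℝ} (hη : 0 < η) : 𝒢.optTrunc .FI q η ≤ 1 / 2 := by
  classical
  let G : Fin k → Sym → Fin k → ℝ := fun a σ b =>
    if h : ∃ x, 𝒢.feedback a x = σ then q a * 𝒢.loss b h.choose else 0
  have hGx : ∀ a x b, G a (𝒢.feedback a x) b = q a * 𝒢.loss b x := fun a x b => by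
    have h : ∃ y, 𝒢.feedback a y = 𝒢.feedback a x := ⟨x, rfl⟩
    simp only [G, dif_pos h]
    rw [hG a _ x h.choose_spec b]
  refine 𝒢.optTrunc_le_of_unbiased (G := G) hη ⟨hq, rfl⟩ (by norm_num) (fun x b => ?_) fun x => ?_
  · simp only [hGx, ← Finset.sum_mul, hq.2, one_mul]
  · have key : ∀ a, psi q (fun b => η * G a (𝒢.feedback a x) b / q a) ≤ η ^ 2 * (1 / 2) := by
      intro a
      have hb : ∀ b, q b * (Real.exp (-(η * G a (𝒢.feedback a x) b / q a)) +
          η * G a (𝒢.feedback a x) b / q a - 1) ≤ q b * (η ^ 2 * (1 / 2)) := by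
        intro b
        refine mul_le_mul_of_nonneg_left ?_ (hq0 b).le
        have hz : η * G a (𝒢.feedback a x) b / q a = η * 𝒢.loss b x := by
          rw [hGx]; field_simp [(hq0 a).ne']
        rw [hz]
        have hl := 𝒢.loss_mem b x
        refine (exp_neg_add_sub_one_le (mul_nonneg hη.le hl.1)).trans ?_
        have : (η * 𝒢.loss b x) ^ 2 ≤ η ^ 2 :=
          pow_le_pow_left₀ (mul_nonneg hη.le hl.1) (mul_le_of_le_one_right hη.le hl.2) 2
        linarith
      refine (Finset.sum_le_sum fun b _ => hb b).trans ?_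
      rw [← Finset.sum_mul, hq.2, one_mul]
    refine (Finset.sum_le_sum fun a _ => mul_le_mul_of_nonneg_left (key a) (hq0 a).le).trans ?_
    rw [← Finset.sum_mul, hq.2, one_mul]

/-- Importance weighting: only coordinate `a` is estimated when `a` is played. The sampling
probability and the weight in `psi` cancel the `1 / q a ^ 2` of the squared estimate, so each action
costs at most `η ^ 2 / 2`. -/
theorem optTrunc_le_MAB (hG : 𝒢.IsModel .MAB) {q : Fin k → ℝ} (hq : q ∈ stdSimplex ℝ (Fin k))
    (hq0 : ∀ a, 0 < q a) {η : ℝ} (hη : 0 < η) : 𝒢.optTrunc .MAB q η ≤ (k : ℝ) / 2 := by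
  classical
  let G : Fin k → Sym → Fin k → ℝ := fun a σ b =>
    if h : ∃ x, 𝒢.feedback a x = σ then if b = a then 𝒢.loss a h.choose else 0 else 0
  have hGx : ∀ a x b, G a (𝒢.feedback a x) b = if b = a then 𝒢.loss a x else 0 := fun a x b => by
    have h : ∃ y, 𝒢.feedback a y = 𝒢.feedback a x := ⟨x, rfl⟩
    simp only [G, dif_pos h]
    rw [(hG a _ x).1 h.choose_spec]
  refine 𝒢.optTrunc_le_of_unbiased (G := G) hη ⟨hq, rfl⟩ (by positivity) (fun x b => ?_)
    fun x => ?_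
  · simp [hGx]
  · have key : ∀ a, q a * psi q (fun b => η * G a (𝒢.feedback a x) b / q a) ≤
        η ^ 2 * (1 / 2) := by
      intro a
      have hpsi : psi q (fun b => η * G a (𝒢.feedback a x) b / q a) =
          q a * (Real.exp (-(η * 𝒢.loss a x / q a)) + η * 𝒢.loss a x / q a - 1) := by
        unfold psi
        rw [Finset.sum_eq_single a]
        · simp [hGx]
        · intro b _ hb
          simp [hGx, hb]
        · simp
      rw [hpsi]
      have hl := 𝒢.loss_mem a x
      have hz : 0 ≤ η * 𝒢.loss a x / q a := div_nonneg (mul_nonneg hη.le hl.1) (hq0 a).le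
      have h1 := mul_le_mul_of_nonneg_left (exp_neg_add_sub_one_le hz)
        (mul_nonneg (hq0 a).le (hq0 a).le)
      have h2 : q a * q a * ((η * 𝒢.loss a x / q a) ^ 2 / 2) = (η * 𝒢.loss a x) ^ 2 / 2 := by
        field_simp [(hq0 a).ne']
      have : (η * 𝒢.loss a x) ^ 2 ≤ η ^ 2 :=
        pow_le_pow_left₀ (mul_nonneg hη.le hl.1) (mul_le_of_le_one_right hη.le hl.2) 2
      rw [← mul_assoc]
      linarith
    refine (Finset.sum_le_sum fun a _ => key a).trans ?_
    rw [Finset.sum_const, Finset.card_univ, Fintype.card_fin, nsmul_eq_mul]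
    linarith

/-- `η` times the objective at `x`, with an upper bound `s x` for the maximum in the bias. -/
def surrogate (q : Fin k → ℝ) (η : ℝ) (x : Fin d)
    (y : (Fin k → ℝ) × (Fin k → Sym → Fin k → ℝ) × (Fin d → ℝ)) : ℝ :=
  ∑ a, y.1 a * 𝒢.loss a x + y.2.2 x +
    (1 / η) * (∑ a, ∑ b, q b *
      (y.1 a * Real.exp (-(η * y.2.1 a (𝒢.feedback a x) b / y.1 a))) - 1)

/-- The domain of `surrogate`. -/
def surrogateDomain (q : Fin k → ℝ) :
    Set ((Fin k → ℝ) × (Fin k → Sym → Fin k → ℝ) × (Fin d → ℝ)) :=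
  {y | y.1 ∈ Model.feasible .PMlocal q ∧
    ∀ c, 𝒢.IsPareto c → ∀ x, ∑ a, y.2.1 a (𝒢.feedback a x) c - 𝒢.loss c x ≤ y.2.2 x}

theorem feasible_pos {M : Model} {q p : Fin k → ℝ} (hq0 : ∀ a, 0 < q a) (hp : p ∈ M.feasible q)
    (a : Fin k) : 0 < p a := by
  have hk : (0 : ℝ) < k := by exact_mod_cast Fin.pos a
  cases M with
  | FI => have h : p = q := hp.2; rw [h]; exact hq0 a
  | MAB => have h : p = q := hp.2; rw [h]; exact hq0 a
  | PMlocal => exact (div_pos (hq0 a) (by positivity)).trans_le (hp.2 a)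

/-- The exponential part is a perspective function of `(p, G)`. The slack variable replaces the
maximum over comparators, leaving only linear terms and linear constraints. -/
theorem convexOn_surrogate {q : Fin k → ℝ} (hq0 : ∀ a, 0 < q a) {η : ℝ} (hη : 0 < η)
    (x : Fin d) : ConvexOn ℝ (𝒢.surrogateDomain q) (𝒢.surrogate q η x) := by
  refine ⟨?_, ?_⟩
  · rintro y ⟨⟨hy1, hy2⟩, hy3⟩ z ⟨⟨hz1, hz2⟩, hz3⟩ s t hs ht hst
    refine ⟨⟨convex_stdSimplex ℝ _ hy1 hz1 hs ht hst, fun a => ?_⟩, fun c hc x => ?_⟩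
    · have h1 := mul_le_mul_of_nonneg_left (hy2 a) hs
      have h2 := mul_le_mul_of_nonneg_left (hz2 a) ht
      calc q a / (2 * k) = s * (q a / (2 * k)) + t * (q a / (2 * k)) := by
            rw [← add_mul, hst, one_mul]
        _ ≤ _ := add_le_add h1 h2
    · have h1 := mul_le_mul_of_nonneg_left (hy3 c hc x) hs
      have h2 := mul_le_mul_of_nonneg_left (hz3 c hc x) ht
      have h3 : ∑ a, (s • y + t • z).2.1 a (𝒢.feedback a x) c =
          s * ∑ a, y.2.1 a (𝒢.feedback a x) c + t * ∑ a, z.2.1 a (𝒢.feedback a x) c := by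
        simp [Finset.sum_add_distrib, Finset.mul_sum]
      have h4 : (s • y + t • z).2.2 x = s * y.2.2 x + t * z.2.2 x := by simp
      have h5 : 𝒢.loss c x = s * 𝒢.loss c x + t * 𝒢.loss c x := by
        rw [← add_mul, hst, one_mul]
      rw [h3, h4]
      linarith
  · intro y hy z hz s t hs ht hst
    have hexp : ∑ a, ∑ b, q b * ((s • y + t • z).1 a *
        Real.exp (-(η * (s • y + t • z).2.1 a (𝒢.feedback a x) b / (s • y + t • z).1 a))) ≤
        s * ∑ a, ∑ b, q b *
          (y.1 a * Real.exp (-(η * y.2.1 a (𝒢.feedback a x) b / y.1 a))) +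
        t * ∑ a, ∑ b, q b *
          (z.1 a * Real.exp (-(η * z.2.1 a (𝒢.feedback a x) b / z.1 a))) := by
      rw [Finset.mul_sum, Finset.mul_sum, ← Finset.sum_add_distrib]
      refine Finset.sum_le_sum fun a _ => ?_
      rw [Finset.mul_sum, Finset.mul_sum, ← Finset.sum_add_distrib]
      refine Finset.sum_le_sum fun b _ => ?_
      have := mul_le_mul_of_nonneg_left (perspective_exp_le (η := η)
        (g₁ := y.2.1 a (𝒢.feedback a x) b) (g₂ := z.2.1 a (𝒢.feedback a x) b)
        (feasible_pos hq0 hy.1 a) (feasible_pos hq0 hz.1 a) hs ht hst) (hq0 b).le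
      refine le_trans (le_of_eq ?_) (this.trans (le_of_eq (by ring)))
      simp
    have hlin : ∑ a, (s • y + t • z).1 a * 𝒢.loss a x =
        s * ∑ a, y.1 a * 𝒢.loss a x + t * ∑ a, z.1 a * 𝒢.loss a x := by
      rw [Finset.mul_sum, Finset.mul_sum, ← Finset.sum_add_distrib]
      exact Finset.sum_congr rfl fun a _ => by simp; ring
    have h4 : (s • y + t • z).2.2 x = s * y.2.2 x + t * z.2.2 x := by simp
    have h6 := mul_le_mul_of_nonneg_left hexp (show 0 ≤ 1 / η by positivity)
    simp only [surrogate, smul_eq_mul]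
    rw [hlin, h4]
    have h7 : (1 / η) * (1 : ℝ) = s * (1 / η) + t * (1 / η) := by rw [← add_mul, hst]; ring
    linarith

end Game

/-! ### The value of locally observable games -/

namespace Game

variable {k d : ℕ} {Sym : Type*} (𝒢 : Game k d Sym)

/-- The term `⟨q, ∑ G⟩` cancels between the bias and `psi`, and `⟨q, loss⟩` cancels between the bias
and the cost of replacing `q` by `p`. What remains is the surrogate. -/
theorem objective_le_of_surrogate_le (hk : 0 < k) (hd : 0 < d) {q : Fin k → ℝ}
    (hq : q ∈ stdSimplex ℝ (Fin k)) (hq0 : ∀ a, 0 < q a) {η : ℝ} (hη : 0 < η) {V : ℝ}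
    {y : (Fin k → ℝ) × (Fin k → Sym → Fin k → ℝ) × (Fin d → ℝ)} (hy : y ∈ 𝒢.surrogateDomain q)
    {x : Fin d} (h : 𝒢.surrogate q η x y ≤ η * V) :
    (∑ a, (y.1 a - q a) * 𝒢.loss a x) / η + 𝒢.bias q y.2.1 x / η +
      1 / η ^ 2 * ∑ a, y.1 a * psi q (fun b => η * y.2.1 a (𝒢.feedback a x) b / y.1 a) ≤ V := by
  obtain ⟨p, G, s⟩ := y
  have hp0 := feasible_pos hq0 hy.1
  have hp1 := hy.1.1.2
  have hs := hy.2
  simp only [surrogate] at h hp0 hp1 hs ⊢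
  obtain ⟨c₀, hc₀, -⟩ := 𝒢.exists_isPareto_optimal hk hd (u := 0) (by simp)
  have : Nonempty {c : Fin k // 𝒢.IsPareto c} := ⟨⟨c₀, hc₀⟩⟩
  have hsup : ⨆ c : {c : Fin k // 𝒢.IsPareto c},
      (∑ a, G a (𝒢.feedback a x) c - 𝒢.loss c x) ≤ s x := ciSup_le fun c => hs c c.2 x
  have hpsi : ∑ a, p a * psi q (fun b => η * G a (𝒢.feedback a x) b / p a) =
      ∑ a, ∑ b, q b * (p a * Real.exp (-(η * G a (𝒢.feedback a x) b / p a))) +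
        η * ∑ b, q b * ∑ a, G a (𝒢.feedback a x) b - 1 := by
    have h1 : ∀ a, p a * psi q (fun b => η * G a (𝒢.feedback a x) b / p a) =
        ∑ b, q b * (p a * Real.exp (-(η * G a (𝒢.feedback a x) b / p a))) +
          η * ∑ b, q b * G a (𝒢.feedback a x) b - p a * ∑ b, q b := fun a => by
      unfold psi
      rw [Finset.mul_sum, Finset.mul_sum, Finset.mul_sum, ← Finset.sum_add_distrib,
        ← Finset.sum_sub_distrib]
      refine Finset.sum_congr rfl fun b _ => ?_
      have := (hp0 a).ne'
      field_simp
    have h2 : ∑ b, q b * ∑ a, G a (𝒢.feedback a x) b =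
        ∑ a, ∑ b, q b * G a (𝒢.feedback a x) b := by
      simp only [Finset.mul_sum]
      exact Finset.sum_comm
    simp only [h1, hq.2, mul_one, Finset.sum_add_distrib, Finset.sum_sub_distrib, hp1]
    rw [h2, Finset.mul_sum]
  have hbias : 𝒢.bias q G x ≤ ∑ b, q b * 𝒢.loss b x - ∑ b, q b * ∑ a, G a (𝒢.feedback a x) b +
      s x := by
    unfold bias
    simp only [mul_sub, Finset.sum_sub_distrib]
    linarith
  have hlin : ∑ a, (p a - q a) * 𝒢.loss a x =
      ∑ a, p a * 𝒢.loss a x - ∑ a, q a * 𝒢.loss a x := by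
    simp only [sub_mul, Finset.sum_sub_distrib]
  rw [hpsi, hlin]
  set E := ∑ a, ∑ b, q b * (p a * Real.exp (-(η * G a (𝒢.feedback a x) b / p a)))
  set g := ∑ b, q b * ∑ a, G a (𝒢.feedback a x) b
  set A := ∑ a, p a * 𝒢.loss a x
  set D := ∑ a, q a * 𝒢.loss a x
  have hrw : (A - D) / η + 𝒢.bias q G x / η + 1 / η ^ 2 * (E + η * g - 1) =
      (A - D + 𝒢.bias q G x + g + 1 / η * (E - 1)) / η := by
    field_simp
    ring
  rw [hrw, div_le_iff₀ hη]
  linarith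

/-- Mixtures of the surrogate objectives have a small value. -/
theorem exists_surrogate_mixture_le (hG : 𝒢.IsModel .PMlocal) (hk : 2 ≤ k) (hd : 0 < d)
    {q : Fin k → ℝ} (hq : q ∈ stdSimplex ℝ (Fin k)) (hq0 : ∀ a, 0 < q a) {η : ℝ} (hη : 0 < η)
    (hηB : η * (2 * 𝒢.numSym * (k : ℝ) ^ 2) ≤ 1) {ν : Fin d → ℝ}
    (hν : ν ∈ stdSimplex ℝ (Fin d)) :
    ∃ y ∈ 𝒢.surrogateDomain q,
      ∑ x, ν x * 𝒢.surrogate q η x y ≤ η * (49 * (𝒢.numSym : ℝ) ^ 2 * (k : ℝ) ^ 2) := by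
  classical
  have hk0 : 0 < k := by omega
  have hkR : (2 : ℝ) ≤ k := by exact_mod_cast hk
  set m : ℝ := (𝒢.numSym : ℝ) with hm_def
  have hm : 1 ≤ m := by rw [hm_def]; exact_mod_cast 𝒢.one_le_numSym hk0 hd
  obtain ⟨ρ, hρ⟩ := 𝒢.exists_root_chain_estimators hG hk0 hd hν.1
  choose! P g hbP hPν hg0 hgb hg using hρ
  -- Actions that are not Pareto optimal have no chain; they keep their own weight.
  let Q : Fin k → Finset (Fin k) := fun b => if 𝒢.IsPareto b then P b else {b}
  have hQ1 : ∀ b, 𝒢.IsPareto b → Q b = P b := fun b h => if_pos h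
  have hQ2 : ∀ b, ¬ 𝒢.IsPareto b → Q b = {b} := fun b h => if_neg h
  have hbQ : ∀ b, b ∈ Q b := fun b => by
    by_cases h : 𝒢.IsPareto b
    · rw [hQ1 b h]; exact hbP b h
    · rw [hQ2 b h]; exact Finset.mem_singleton_self b
  set ℓ : Fin k → ℝ := fun a => ∑ x, 𝒢.loss a x * ν x with hℓ
  have hQν : ∀ b, ∀ c ∈ Q b, ℓ c ≤ ℓ b := fun b c hc => by
    by_cases h : 𝒢.IsPareto b
    · rw [hQ1 b h] at hc
      have := hPν b h c hc
      rw [excess_eq_sub] at this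
      linarith
    · rw [hQ2 b h, Finset.mem_singleton] at hc
      rw [hc]
  have hℓ0 : ∀ a, 0 ≤ ℓ a := fun a =>
    Finset.sum_nonneg fun x _ => mul_nonneg (𝒢.loss_mem a x).1 (hν.1 x)
  have hℓ1 : ∀ a, ℓ a ≤ 1 := fun a => by
    rw [← hν.2]
    exact Finset.sum_le_sum fun x _ => mul_le_of_le_one_left (hν.1 x) (𝒢.loss_mem a x).2
  have hcard : ∀ b, (0 : ℝ) < (Q b).card := fun b => by
    exact_mod_cast Finset.card_pos.2 ⟨b, hbQ b⟩
  have hcardk : ∀ b, ((Q b).card : ℝ) ≤ k := fun b => by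
    have := Finset.card_le_univ (Q b)
    rw [Fintype.card_fin] at this
    exact_mod_cast this
  -- The weight of each `b` is spread evenly over its chain. The loss at `ν` does not increase
  -- (`huℓ`), and every action receives at least a `1/k` share of the weight of all `b` whose chain
  -- uses it (`hmass`).
  let u : Fin k → ℝ := fun a => ∑ b, if a ∈ Q b then q b / (Q b).card else 0
  have hu_sum : ∀ f : Fin k → ℝ, ∑ a, u a * f a = ∑ b, q b / (Q b).card * ∑ a ∈ Q b, f a := by
    intro f
    simp only [u, Finset.sum_mul]
    rw [Finset.sum_comm]
    refine Finset.sum_congr rfl fun b _ => ?_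
    simp only [ite_mul, zero_mul]
    rw [← Finset.sum_filter, Finset.mul_sum]
    congr 1
    ext a; simp
  have hu1 : ∑ a, u a = 1 := by
    have := hu_sum fun _ => 1
    simp only [mul_one, Finset.sum_const, nsmul_eq_mul] at this
    rw [this, ← hq.2]
    exact Finset.sum_congr rfl fun b _ => div_mul_cancel₀ _ (hcard b).ne'
  have huℓ : ∑ a, u a * ℓ a ≤ ∑ a, q a * ℓ a := by
    rw [hu_sum]
    refine Finset.sum_le_sum fun b _ => ?_
    have h1 : ∑ a ∈ Q b, ℓ a ≤ (Q b).card * ℓ b := by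
      rw [← nsmul_eq_mul]
      exact Finset.sum_le_card_nsmul _ _ _ (hQν b)
    calc _ ≤ q b / (Q b).card * ((Q b).card * ℓ b) :=
          mul_le_mul_of_nonneg_left h1 (div_nonneg (hq0 b).le (hcard b).le)
      _ = q b * ℓ b := by field_simp [(hcard b).ne']
  have hu0 : ∀ a, 0 ≤ u a := fun a => Finset.sum_nonneg fun b _ => by
    split_ifs
    · exact div_nonneg (hq0 b).le (hcard b).le
    · exact le_rfl
  have hmass : ∀ a, (∑ b, if a ∈ Q b then q b else 0) ≤ k * u a := fun a => by
    rw [Finset.mul_sum]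
    refine Finset.sum_le_sum fun b _ => ?_
    split_ifs
    · rw [mul_div_assoc', le_div_iff₀ (hcard b), mul_comm]
      exact mul_le_mul_of_nonneg_right (hcardk b) (hq0 b).le
    · simp
  have hqu : ∀ a, q a ≤ k * u a := fun a => by
    refine le_trans ?_ (hmass a)
    have := Finset.single_le_sum (f := fun b => if a ∈ Q b then q b else 0)
      (fun b _ => by
        split_ifs
        exacts [(hq0 b).le, le_rfl]) (Finset.mem_univ a)
    simpa [hbQ a] using this
  -- Uniform exploration of total weight `γ` gives `p a ≥ η m k`, so estimates bounded by `4m` have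
  -- exponents at most `4/k ≤ 2`. The hypothesis on `η` gives `γ ≤ 1/2`, whence `u ≤ 2p`.
  set γ : ℝ := η * m * (k : ℝ) ^ 2 with hγ
  have hγ0 : 0 < γ := by positivity
  have hγ1 : γ ≤ 1 / 2 := by linarith
  have hη8 : η ≤ 1 / 8 := by
    have h4 : (4 : ℝ) ≤ (k : ℝ) ^ 2 := by nlinarith
    have h5 : (4 : ℝ) ≤ m * (k : ℝ) ^ 2 := by nlinarith
    have : η * 4 ≤ η * (m * (k : ℝ) ^ 2) := mul_le_mul_of_nonneg_left h5 hη.le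
    linarith
  let p : Fin k → ℝ := fun a => (1 - γ) * u a + γ / k
  have hpγ : ∀ a, γ / k ≤ p a := fun a => by
    have := mul_nonneg (show 0 ≤ 1 - γ by linarith) (hu0 a)
    simp only [p]; linarith
  have hpu : ∀ a, u a ≤ 2 * p a := fun a => by
    have h1 := mul_nonneg (show 0 ≤ 1 / 2 - γ by linarith) (hu0 a)
    have h2 : 0 < γ / k := by positivity
    simp only [p]; linarith
  have hp0 : ∀ a, 0 < p a := fun a => (show 0 < γ / k by positivity).trans_le (hpγ a)
  have hp_sum : ∀ f : Fin k → ℝ,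
      ∑ a, p a * f a = (1 - γ) * ∑ a, u a * f a + γ / k * ∑ a, f a := fun f => by
    rw [Finset.mul_sum, Finset.mul_sum, ← Finset.sum_add_distrib]
    exact Finset.sum_congr rfl fun a _ => by simp only [p]; ring
  have hp1 : ∑ a, p a = 1 := by
    have := hp_sum fun _ => 1
    simp only [mul_one, hu1, Finset.sum_const, Finset.card_univ, Fintype.card_fin,
      nsmul_eq_mul] at this
    rw [this, div_mul_cancel₀ _ (by positivity)]
    ring
  have hpℓ : ∑ a, p a * ℓ a ≤ ∑ a, q a * ℓ a + γ := by
    rw [hp_sum]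
    have h1 : ∑ a, ℓ a ≤ k := by
      have := Finset.sum_le_card_nsmul Finset.univ ℓ 1 fun a _ => hℓ1 a
      simpa using this
    have h2 : γ / k * ∑ a, ℓ a ≤ γ := by
      calc _ ≤ γ / k * k := mul_le_mul_of_nonneg_left h1 (by positivity)
        _ = γ := div_mul_cancel₀ _ (by positivity)
    have h3 : 0 ≤ ∑ a, u a * ℓ a := Finset.sum_nonneg fun a _ => mul_nonneg (hu0 a) (hℓ0 a)
    nlinarith [mul_nonneg hγ0.le h3]
  -- Non-Pareto coordinates are not constrained by the bias. The choice `2 * p a` makes their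
  -- exponential equal to `exp (-2η)`, small enough to absorb any loss difference when `η ≤ 1/8`.
  let G : Fin k → Sym → Fin k → ℝ := fun a σ b => if 𝒢.IsPareto b then g b a σ else 2 * p a
  have hdom : (p, G, fun x => - 𝒢.loss ρ x) ∈ 𝒢.surrogateDomain q := by
    refine ⟨⟨⟨fun a => (hp0 a).le, hp1⟩, fun a => ?_⟩, fun c hc x => ?_⟩
    · have h1 := hqu a
      have h2 := hpu a
      have : (k : ℝ) * u a ≤ k * (2 * p a) := mul_le_mul_of_nonneg_left h2 (by positivity)
      rw [div_le_iff₀ (by positivity)]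
      linarith
    · simp only [G, if_pos hc, hg c hc x]
      linarith
  refine ⟨_, hdom, ?_⟩
  -- The linear term is the estimated loss difference. The constant 24 is `3/2` from the exponential
  -- bound times `4²` from the size of the estimator.
  have hb : ∀ x b, ∑ a, p a * Real.exp (-(η * G a (𝒢.feedback a x) b / p a)) ≤
      1 - η * (𝒢.loss b x - 𝒢.loss ρ x) +
        24 * η ^ 2 * m ^ 2 * ∑ a, (if a ∈ Q b then 1 else 0) / p a := by
    intro x b
    by_cases hbp : 𝒢.IsPareto b
    · have hterm : ∀ a, p a * Real.exp (-(η * G a (𝒢.feedback a x) b / p a)) ≤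
          p a - η * g b a (𝒢.feedback a x) +
            24 * η ^ 2 * m ^ 2 * ((if a ∈ Q b then 1 else 0) / p a) := by
        intro a
        have hGg : G a (𝒢.feedback a x) b = g b a (𝒢.feedback a x) := if_pos hbp
        rw [hGg]
        set w := g b a (𝒢.feedback a x) with hw
        have hwb : |w| ≤ 4 * m := hgb b hbp a _
        have hz : |η * w / p a| ≤ 2 := by
          rw [abs_div, abs_mul, abs_of_pos hη, abs_of_pos (hp0 a), div_le_iff₀ (hp0 a)]
          have h1 : η * |w| ≤ η * (4 * m) := mul_le_mul_of_nonneg_left hwb hη.le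
          have h2 : η * (4 * m) ≤ 2 * (γ / k) := by
            have : γ / k = η * m * k := by rw [hγ]; field_simp
            rw [this]
            nlinarith [mul_nonneg (mul_pos hη (lt_of_lt_of_le one_pos hm)).le
              (sub_nonneg.2 hkR)]
          linarith [hpγ a]
        have h1 := mul_le_mul_of_nonneg_left (exp_neg_le_quadratic hz) (hp0 a).le
        have h2 : p a * (1 - η * w / p a + 3 / 2 * (η * w / p a) ^ 2) =
            p a - η * w + 3 / 2 * η ^ 2 * (w ^ 2 / p a) := by
          field_simp [(hp0 a).ne']
        have h3 : w ^ 2 / p a ≤ 16 * m ^ 2 * ((if a ∈ Q b then 1 else 0) / p a) := by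
          rw [mul_div_assoc']
          refine div_le_div_of_nonneg_right ?_ (hp0 a).le
          split_ifs with ha
          · have := pow_le_pow_left₀ (abs_nonneg w) hwb 2
            rw [sq_abs] at this
            nlinarith
          · rw [hQ1 b hbp] at ha
            rw [hw, hg0 b hbp a ha]
            simp
        have h4 := mul_le_mul_of_nonneg_left h3 (show 0 ≤ 3 / 2 * η ^ 2 by positivity)
        rw [h2] at h1
        linarith
      refine (Finset.sum_le_sum fun a _ => hterm a).trans ?_
      rw [Finset.sum_add_distrib, Finset.sum_sub_distrib, hp1, ← Finset.mul_sum, ← Finset.mul_sum,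
        hg b hbp x]
    · have hterm : ∀ a, p a * Real.exp (-(η * G a (𝒢.feedback a x) b / p a)) =
          p a * Real.exp (-(2 * η)) := by
        intro a
        have hGg : G a (𝒢.feedback a x) b = 2 * p a := if_neg hbp
        rw [hGg]
        congr 3
        field_simp [(hp0 a).ne']
      simp only [hterm]
      rw [← Finset.sum_mul, hp1, one_mul]
      have h1 := exp_neg_le_quadratic (z := 2 * η) (by
        rw [abs_of_pos (by positivity)]; linarith)
      have h2 : 0 ≤ 24 * η ^ 2 * m ^ 2 * ∑ a, (if a ∈ Q b then 1 else 0) / p a := by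
        refine mul_nonneg (by positivity) (Finset.sum_nonneg fun a _ => div_nonneg ?_ (hp0 a).le)
        split_ifs <;> norm_num
      have h3 := (abs_le.1 (𝒢.abs_loss_sub_le b ρ x)).2
      have h4 : η * (𝒢.loss b x - 𝒢.loss ρ x) ≤ η * 1 := mul_le_mul_of_nonneg_left h3 hη.le
      nlinarith
  -- Exchanging the sums, the weight of all chains through `a` is at most `k * u a ≤ 2k * p a`. This
  -- cancels `1 / p a`.
  have hquad : ∑ b, q b * ∑ a, (if a ∈ Q b then 1 else 0) / p a ≤ 2 * (k : ℝ) ^ 2 := by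
    have h1 : ∑ b, q b * ∑ a, (if a ∈ Q b then 1 else 0) / p a =
        ∑ a, (∑ b, if a ∈ Q b then q b else 0) / p a := by
      simp only [Finset.mul_sum, Finset.sum_div]
      rw [Finset.sum_comm]
      refine Finset.sum_congr rfl fun a _ => Finset.sum_congr rfl fun b _ => ?_
      split_ifs <;> ring
    rw [h1]
    have h2 : ∀ a, (∑ b, if a ∈ Q b then q b else 0) / p a ≤ 2 * k := fun a => by
      rw [div_le_iff₀ (hp0 a)]
      have := mul_le_mul_of_nonneg_left (hpu a) (show (0 : ℝ) ≤ k by positivity)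
      linarith [hmass a]
    have := Finset.sum_le_card_nsmul Finset.univ _ _ fun a _ => h2 a
    simp only [Finset.card_univ, Fintype.card_fin, nsmul_eq_mul] at this
    linarith
  -- The slack `-loss ρ x` cancels the reference loss of the chain estimators, leaving `p` against
  -- `q`. After averaging over `ν` this difference is at most `γ ≤ η m² k²`, which raises 48 to 49.
  have hx : ∀ x, 𝒢.surrogate q η x (p, G, fun x => - 𝒢.loss ρ x) ≤
      ∑ a, p a * 𝒢.loss a x - ∑ b, q b * 𝒢.loss b x + η * (48 * m ^ 2 * (k : ℝ) ^ 2) := by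
    intro x
    simp only [surrogate]
    have h1 : ∑ a, ∑ b, q b * (p a * Real.exp (-(η * G a (𝒢.feedback a x) b / p a))) =
        ∑ b, q b * ∑ a, p a * Real.exp (-(η * G a (𝒢.feedback a x) b / p a)) := by
      rw [Finset.sum_comm]
      simp only [Finset.mul_sum]
    have h2 : ∑ b, q b * ∑ a, p a * Real.exp (-(η * G a (𝒢.feedback a x) b / p a)) ≤
        1 - η * (∑ b, q b * 𝒢.loss b x - 𝒢.loss ρ x) + η * (η * (48 * m ^ 2 * (k : ℝ) ^ 2)) := by
      refine (Finset.sum_le_sum fun b _ => mul_le_mul_of_nonneg_left (hb x b) (hq0 b).le).trans ?_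
      have h3 : ∑ b, q b * (1 - η * (𝒢.loss b x - 𝒢.loss ρ x) +
          24 * η ^ 2 * m ^ 2 * ∑ a, (if a ∈ Q b then 1 else 0) / p a) =
          (∑ b, q b) - η * (∑ b, q b * 𝒢.loss b x - (∑ b, q b) * 𝒢.loss ρ x) +
          24 * η ^ 2 * m ^ 2 * ∑ b, q b * ∑ a, (if a ∈ Q b then 1 else 0) / p a := by
        rw [Finset.sum_mul, ← Finset.sum_sub_distrib, Finset.mul_sum, Finset.mul_sum,
          ← Finset.sum_sub_distrib, ← Finset.sum_add_distrib]
        exact Finset.sum_congr rfl fun b _ => by ring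
      rw [h3, hq.2, one_mul]
      have := mul_le_mul_of_nonneg_left hquad (show 0 ≤ 24 * η ^ 2 * m ^ 2 by positivity)
      linarith
    rw [h1]
    have h4 := mul_le_mul_of_nonneg_left (sub_le_sub_right h2 1) (show 0 ≤ 1 / η by positivity)
    have h5 : 1 / η * (1 - η * (∑ b, q b * 𝒢.loss b x - 𝒢.loss ρ x) +
        η * (η * (48 * m ^ 2 * (k : ℝ) ^ 2)) - 1) =
        - (∑ b, q b * 𝒢.loss b x - 𝒢.loss ρ x) + η * (48 * m ^ 2 * (k : ℝ) ^ 2) := by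
      field_simp
      ring
    rw [h5] at h4
    linarith
  have hswap : ∀ f : Fin k → ℝ, ∑ x, ν x * ∑ a, f a * 𝒢.loss a x = ∑ a, f a * ℓ a := fun f => by
    simp only [hℓ, Finset.mul_sum]
    rw [Finset.sum_comm]
    exact Finset.sum_congr rfl fun a _ => Finset.sum_congr rfl fun x _ => by ring
  refine (Finset.sum_le_sum fun x _ => mul_le_mul_of_nonneg_left (hx x) (hν.1 x)).trans ?_
  simp only [mul_add, mul_sub, Finset.sum_add_distrib, Finset.sum_sub_distrib, hswap]
  rw [← Finset.sum_mul, hν.2, one_mul]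
  have : γ ≤ η * (m ^ 2 * (k : ℝ) ^ 2) := by
    rw [hγ, mul_assoc]
    refine mul_le_mul_of_nonneg_left (mul_le_mul_of_nonneg_right ?_ (by positivity)) hη.le
    nlinarith
  linarith

/-- The minimax theorem needs room strictly above the value of the mixtures, hence 50 instead of 49.
-/
theorem optTrunc_le_PMlocal (hG : 𝒢.IsModel .PMlocal) (hk : 2 ≤ k) (hd : 0 < d)
    {q : Fin k → ℝ} (hq : q ∈ stdSimplex ℝ (Fin k)) (hq0 : ∀ a, 0 < q a) {η : ℝ} (hη : 0 < η)
    (hηB : η * (2 * 𝒢.numSym * (k : ℝ) ^ 2) ≤ 1) :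
    𝒢.optTrunc .PMlocal q η ≤ 50 * (𝒢.numSym : ℝ) ^ 2 * (k : ℝ) ^ 2 := by
  have hk0 : 0 < k := by omega
  have hkR : (2 : ℝ) ≤ k := by exact_mod_cast hk
  have hm : (1 : ℝ) ≤ 𝒢.numSym := by exact_mod_cast 𝒢.one_le_numSym hk0 hd
  have hlt : η * (49 * (𝒢.numSym : ℝ) ^ 2 * (k : ℝ) ^ 2) <
      η * (50 * (𝒢.numSym : ℝ) ^ 2 * (k : ℝ) ^ 2) := by
    refine mul_lt_mul_of_pos_left ?_ hη
    have : 0 < (𝒢.numSym : ℝ) ^ 2 * (k : ℝ) ^ 2 := by positivity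
    linarith
  obtain ⟨y, hy, hyV⟩ := exists_forall_le_of_forall_mixture_le hd
    (fun x => 𝒢.convexOn_surrogate hq0 hη x) hlt
    (fun ν hν => 𝒢.exists_surrogate_mixture_le hG hk hd hq hq0 hη hηB hν)
  exact 𝒢.optTrunc_le (G := y.2.1) hy.1 (by positivity) fun x =>
    𝒢.objective_le_of_surrogate_le hk0 hd hq hq0 hη hy (hyV x)

/-- The truncated value of the restricted problem is of order `V̄`. -/
theorem optTrunc_le_Vbar {M : Model} (hG : 𝒢.IsModel M) (hk : 2 ≤ k) (hd : 0 < d)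
    {q : Fin k → ℝ} (hq : q ∈ stdSimplex ℝ (Fin k)) (hq0 : ∀ a, 0 < q a) {η : ℝ} (hη : 0 < η)
    (hηB : M = .PMlocal → η * M.B k 𝒢.numSym ≤ 1) :
    𝒢.optTrunc M q η ≤ 9 * M.Vbar k 𝒢.numSym := by
  have hkR : (2 : ℝ) ≤ k := by exact_mod_cast hk
  cases M with
  | FI =>
    have := 𝒢.optTrunc_le_FI hG hq hq0 hη
    simp only [Model.Vbar]; linarith
  | MAB =>
    have := 𝒢.optTrunc_le_MAB hG hq hq0 hη
    simp only [Model.Vbar]; linarith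
  | PMlocal =>
    have := 𝒢.optTrunc_le_PMlocal hG hk hd hq hq0 hη (hηB rfl)
    simp only [Model.Vbar]
    -- The factor 9 is enough because `27k ≥ 54 > 50`.
    have h1 : 0 ≤ (𝒢.numSym : ℝ) ^ 2 * (k : ℝ) ^ 2 := by positivity
    nlinarith [mul_nonneg h1 (sub_nonneg.2 hkR)]

end Game

/-! ### Existence of the algorithm -/

theorem sum_take_get_append {α : Type*} (φ : List α → α → ℝ) (h : List α) (o : α) :
    ∑ i : Fin (h ++ [o]).length, φ ((h ++ [o]).take i) ((h ++ [o]).get i) =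
      ∑ i : Fin h.length, φ (h.take i) (h.get i) + φ h o := by
  have hlen : h.length + 1 = (h ++ [o]).length := by simp
  rw [← Equiv.sum_comp (finCongr hlen), Fin.sum_univ_castSucc]
  congr 1
  · refine Finset.sum_congr rfl fun i _ => ?_
    have hi : (i : ℕ) < h.length := i.2
    simp [List.take_append_of_le_length hi.le, List.getElem_append_left hi]
  · simp

theorem exists_isMinOn_simplex {k : ℕ} (hk : 0 < k) (y : Fin k → ℝ) (β : ℝ) :
    ∃ q ∈ stdSimplex ℝ (Fin k), IsMinOn
      (fun u : Fin k → ℝ => ∑ b, y b * u b + β * ∑ b, u b * Real.log (u b))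
      (stdSimplex ℝ (Fin k)) q := by
  refine (isCompact_stdSimplex ℝ (Fin k)).exists_isMinOn
    ⟨_, single_mem_stdSimplex ℝ (⟨0, hk⟩ : Fin k)⟩ (Continuous.continuousOn ?_)
  have : ∀ b, Continuous fun u : Fin k → ℝ => u b * Real.log (u b) := fun b =>
    Real.continuous_mul_log.comp (continuous_apply b)
  fun_prop

theorem mem_feasible_self {k : ℕ} (hk : 0 < k) (M : Model) {q : Fin k → ℝ}
    (hq : q ∈ stdSimplex ℝ (Fin k)) : q ∈ M.feasible q := by
  have hkR : (1 : ℝ) ≤ k := by exact_mod_cast hk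
  cases M with
  | FI => exact ⟨hq, rfl⟩
  | MAB => exact ⟨hq, rfl⟩
  | PMlocal => exact ⟨hq, fun a => div_le_self (hq.1 a) (by linarith)⟩

/-- For a set unbounded below the default infimum is 0, and some element still lies below `ε`. -/
theorem exists_lt_sInf_add {S : Set ℝ} (hS : S.Nonempty) {ε : ℝ} (hε : 0 < ε) :
    ∃ v ∈ S, v < sInf S + ε := by
  by_cases h : BddBelow S
  · exact exists_lt_of_csInf_lt hS (by linarith)
  · rw [Real.sInf_of_not_bddBelow h, zero_add]
    rw [not_bddBelow_iff] at h
    exact h ε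

namespace Game

variable {k d : ℕ} {Sym : Type*} (𝒢 : Game k d Sym)

theorem exists_near_minimizer (hk : 0 < k) (M : Model) {T : ℕ} (hT : 0 < T) {q : Fin k → ℝ}
    (hq : q ∈ stdSimplex ℝ (Fin k)) (η : ℝ) :
    ∃ y : (Fin k → ℝ) × (Fin k → Sym → Fin k → ℝ), y.1 ∈ M.feasible q ∧
      𝒢.stabTrans y.1 y.2 q η ≤ 𝒢.optVal M q η + 1 / T := by
  have hT' : (0 : ℝ) < 1 / T := by positivity
  obtain ⟨v, ⟨p, hp, G, rfl⟩, hv⟩ := exists_lt_sInf_add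
    (S := {v | ∃ p ∈ M.feasible q, ∃ G : Fin k → Sym → Fin k → ℝ, v = 𝒢.stabTrans p G q η})
    ⟨_, q, mem_feasible_self hk M hq, 0, rfl⟩ hT'
  exact ⟨(p, G), hp, hv.le⟩

/-- The internal state of the algorithm: the cumulative loss estimate, `β_t`, and the accumulated
sum `∑ V'_s H(q_{s+1})`. -/
structure State (k : ℕ) where
  cum : Fin k → ℝ
  β : ℝ
  acc : ℝ

variable {𝒢}

/-- Algorithms exist: the quantities of each round can be computed recursively. -/
theorem nonempty_algorithm (hk : 0 < k) (M : Model) {T : ℕ} (hT : 0 < T) :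
    Nonempty (Algorithm 𝒢 M T) := by
  choose argmin hmem hmin using fun (y : Fin k → ℝ) (β : ℝ) => exists_isMinOn_simplex hk y β
  choose sol hfeas hnear using fun (s : State k) =>
    𝒢.exists_near_minimizer hk M hT (hmem s.cum s.β) (1 / s.β)
  let qs : State k → Fin k → ℝ := fun s => argmin s.cum s.β
  let Vs : State k → ℝ := fun s => 𝒢.optTrunc M (qs s) (1 / s.β)
  let s₀ : State k := ⟨0, M.B k 𝒢.numSym * √(Real.log (1 + T) / Real.log k), 0⟩
  let step : State k → Fin k × Sym → State k := fun s o =>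
    let cum' : Fin k → ℝ := fun b => s.cum b + (sol s).2 o.1 o.2 b / (sol s).1 o.1
    let β' : ℝ := s.β + √(Real.log (1 + T) / 2) * Vs s /
      √(M.Vbar k 𝒢.numSym * entropy (qs s₀) + s.acc)
    ⟨cum', β', s.acc + Vs s * entropy (argmin cum' β')⟩
  -- The recursion runs along the history. `hcum` and `hacc` identify the folded state with the sums
  -- over prefixes in the definition of the algorithm.
  let st : List (Fin k × Sym) → State k := fun h => h.foldl step s₀
  have hst : ∀ h o, st (h ++ [o]) = step (st h) o := fun h o => by simp [st]
  have hcum : ∀ h b, (st h).cum b = ∑ i : Fin h.length,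
      (sol (st (h.take i))).2 (h.get i).1 (h.get i).2 b / (sol (st (h.take i))).1 (h.get i).1 := by
    intro h b
    induction h using List.reverseRecOn with
    | nil => simp [st, s₀]
    | append_singleton h o ih =>
      rw [sum_take_get_append
        (fun h o => (sol (st h)).2 o.1 o.2 b / (sol (st h)).1 o.1) h o, ← ih, hst]
  have hacc : ∀ h, (st h).acc = ∑ s ∈ Finset.range h.length,
      Vs (st (h.take s)) * entropy (qs (st (h.take (s + 1)))) := by
    intro h
    induction h using List.reverseRecOn with
    | nil => simp [st, s₀]
    | append_singleton h o ih =>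
      rw [List.length_append, List.length_singleton, Finset.sum_range_succ]
      have h1 : (h ++ [o]).take h.length = h := by simp
      have h2 : (h ++ [o]).take (h.length + 1) = h ++ [o] := by
        rw [List.take_of_length_le]; simp
      have h3 : ∀ s ∈ Finset.range h.length,
          Vs (st ((h ++ [o]).take s)) * entropy (qs (st ((h ++ [o]).take (s + 1)))) =
          Vs (st (h.take s)) * entropy (qs (st (h.take (s + 1)))) := fun s hs => by
        have := Finset.mem_range.1 hs
        rw [List.take_append_of_le_length (by omega), List.take_append_of_le_length (by omega)]
      rw [Finset.sum_congr rfl h3, ← ih, h1, h2, hst]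
  exact ⟨{
    q := fun h => qs (st h)
    β := fun h => (st h).β
    p := fun h => (sol (st h)).1
    G := fun h => (sol (st h)).2
    q_mem := fun h => hmem _ _
    q_min := fun h => by
      have := hmin (st h).cum (st h).β
      simp only [hcum] at this
      simpa only [qs, hcum] using this
    β_one := rfl
    β_succ := fun h o => by
      rw [hst]
      simp only [step]
      rw [hacc]
      rfl
    p_mem := fun h => hfeas (st h)
    near_min := fun h => hnear (st h) }⟩

end Game

/-! ### Follow the regularized leader -/

/-- A summand of the relative entropy between unnormalized measures. Its sum gives the Gibbs
distribution, the step of follow the regularized leader and both entropy bounds. -/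
theorem mul_log_sub_nonneg {u g : ℝ} (hu : 0 ≤ u) (hg : 0 < g) :
    0 ≤ u * Real.log u - u * Real.log g - u + g := by
  rcases hu.eq_or_lt with rfl | hu
  · simp [hg.le]
  · have h := Real.log_le_sub_one_of_pos (div_pos hg hu)
    rw [Real.log_div hg.ne' hu.ne'] at h
    have := mul_le_mul_of_nonneg_left h hu.le
    have h2 : u * (g / u - 1) = g - u := by field_simp
    linarith

theorem eq_of_mul_log_sub_nonpos {u g : ℝ} (hu : 0 ≤ u) (hg : 0 < g)
    (h : u * Real.log u - u * Real.log g - u + g ≤ 0) : u = g := by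
  rcases hu.eq_or_lt with rfl | hu
  · simp at h; linarith
  · by_contra hne
    have h1 := Real.log_lt_sub_one_of_pos (div_pos hg hu) (by
      rw [Ne, div_eq_one_iff_eq hu.ne']; exact fun h => hne h.symm)
    rw [Real.log_div hg.ne' hu.ne'] at h1
    have := mul_lt_mul_of_pos_left h1 hu
    have h2 : u * (g / u - 1) = g - u := by field_simp
    linarith

/-- The minimizer of the entropy-regularized linear loss is the Gibbs distribution. -/
theorem exists_log_eq_of_isMinOn {k : ℕ} (hk : 0 < k) {y : Fin k → ℝ} {β : ℝ} (hβ : 0 < β)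
    {q : Fin k → ℝ} (hq : q ∈ stdSimplex ℝ (Fin k))
    (hmin : IsMinOn (fun u : Fin k → ℝ => ∑ b, y b * u b + β * ∑ b, u b * Real.log (u b))
      (stdSimplex ℝ (Fin k)) q) :
    (∀ b, 0 < q b) ∧ ∃ z : ℝ, ∀ b, y b = - β * Real.log (q b) - z := by
  set Z := ∑ b, Real.exp (-(y b) / β) with hZ
  have hZ0 : 0 < Z := Finset.sum_pos (fun b _ => Real.exp_pos _) ⟨⟨0, hk⟩, Finset.mem_univ _⟩
  set g : Fin k → ℝ := fun b => Real.exp (-(y b) / β) / Z with hg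
  have hg0 : ∀ b, 0 < g b := fun b => div_pos (Real.exp_pos _) hZ0
  have hg1 : ∑ b, g b = 1 := by rw [← Finset.sum_div, div_self hZ0.ne']
  have hlog : ∀ b, y b = - β * Real.log (g b) - β * Real.log Z := fun b => by
    rw [hg, Real.log_div (Real.exp_pos _).ne' hZ0.ne', Real.log_exp]
    field_simp
    ring
  -- On the simplex the objective is `β` times the relative entropy to the Gibbs distribution, up to
  -- a constant.
  have hF : ∀ u : Fin k → ℝ, ∑ b, u b = 1 → ∑ b, y b * u b + β * ∑ b, u b * Real.log (u b) =
      β * ∑ b, (u b * Real.log (u b) - u b * Real.log (g b) - u b + g b) - β * Real.log Z := by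
    intro u hu
    have h1 : ∑ b, y b * u b = - β * ∑ b, u b * Real.log (g b) - β * Real.log Z := by
      have : ∑ b, y b * u b = ∑ b, (- β * (u b * Real.log (g b)) - β * Real.log Z * u b) :=
        Finset.sum_congr rfl fun b _ => by rw [hlog b]; ring
      rw [this, Finset.sum_sub_distrib, ← Finset.mul_sum, ← Finset.mul_sum, hu, mul_one]
    rw [h1, Finset.sum_add_distrib, Finset.sum_sub_distrib, Finset.sum_sub_distrib, hu, hg1]
    ring
  have hle := hmin (show g ∈ stdSimplex ℝ (Fin k) from ⟨fun b => (hg0 b).le, hg1⟩)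
  simp only [Set.mem_ofPred_eq] at hle
  rw [hF q hq.2, hF g hg1] at hle
  have hle' : ∑ b, (q b * Real.log (q b) - q b * Real.log (g b) - q b + g b) ≤ 0 := by
    have : ∑ b, (g b * Real.log (g b) - g b * Real.log (g b) - g b + g b) = 0 :=
      Finset.sum_eq_zero fun b _ => by ring
    rw [this] at hle
    have : β * ∑ b, (q b * Real.log (q b) - q b * Real.log (g b) - q b + g b) ≤ β * 0 := by
      linarith
    exact le_of_mul_le_mul_left this hβ
  have hnn : ∀ b ∈ Finset.univ, 0 ≤ q b * Real.log (q b) - q b * Real.log (g b) - q b + g b :=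
    fun b _ => mul_log_sub_nonneg (hq.1 b) (hg0 b)
  have hqg : ∀ b, q b = g b := fun b => eq_of_mul_log_sub_nonpos (hq.1 b) (hg0 b)
    ((Finset.single_le_sum hnn (Finset.mem_univ b)).trans hle')
  exact ⟨fun b => by rw [hqg b]; exact hg0 b, β * Real.log Z, fun b => by rw [hqg b]; exact hlog b⟩

theorem sum_mul_log_eq_neg_entropy {k : ℕ} (q : Fin k → ℝ) :
    ∑ b, q b * Real.log (q b) = - entropy q := by
  simp [entropy, Real.negMulLog]

/-- One step of follow the regularized leader. -/
theorem ftrl_step {k : ℕ} (hk : 0 < k) {y : Fin k → ℝ} {β : ℝ} (hβ : 0 < β)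
    {q : Fin k → ℝ} (hq : q ∈ stdSimplex ℝ (Fin k))
    (hmin : IsMinOn (fun u : Fin k → ℝ => ∑ b, y b * u b + β * ∑ b, u b * Real.log (u b))
      (stdSimplex ℝ (Fin k)) q) (w : Fin k → ℝ) {u : Fin k → ℝ}
    (hu : u ∈ stdSimplex ℝ (Fin k)) :
    ∑ b, y b * q b - β * entropy q + ∑ b, w b * q b - β * psi q (fun b => w b / β) ≤
      ∑ b, (y b + w b) * u b - β * entropy u := by
  obtain ⟨hq0, z, hz⟩ := exists_log_eq_of_isMinOn hk hβ hq hmin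
  have hFq : ∑ b, y b * q b - β * entropy q = - z := by
    have : ∑ b, y b * q b = ∑ b, (- β * (q b * Real.log (q b)) - z * q b) :=
      Finset.sum_congr rfl fun b _ => by rw [hz b]; ring
    rw [this, Finset.sum_sub_distrib, ← Finset.mul_sum, ← Finset.mul_sum, hq.2,
      sum_mul_log_eq_neg_entropy]
    ring
  -- `g` is the unnormalized exponential-weights update of `q`. The gap between the two sides is
  -- exactly `β` times the relative entropy of `u` with respect to `g`.
  set g : Fin k → ℝ := fun b => q b * Real.exp (-(w b / β)) with hg
  have hg0 : ∀ b, 0 < g b := fun b => mul_pos (hq0 b) (Real.exp_pos _)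
  have hlg : ∀ b, Real.log (g b) = Real.log (q b) - w b / β := fun b => by
    rw [hg, Real.log_mul (hq0 b).ne' (Real.exp_pos _).ne', Real.log_exp]
    ring
  have hpsi : β * psi q (fun b => w b / β) = β * ∑ b, g b + ∑ b, w b * q b - β := by
    have : psi q (fun b => w b / β) = ∑ b, (g b + (w b * q b) / β - q b) :=
      Finset.sum_congr rfl fun b _ => by simp only [hg]; ring
    rw [this, Finset.sum_sub_distrib, Finset.sum_add_distrib, hq.2, ← Finset.sum_div]
    field_simp
  have hkl : 0 ≤ ∑ b, (u b * Real.log (u b) - u b * Real.log (g b) - u b + g b) :=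
    Finset.sum_nonneg fun b _ => mul_log_sub_nonneg (hu.1 b) (hg0 b)
  have hR : ∑ b, (y b + w b) * u b - β * entropy u =
      β * ∑ b, (u b * Real.log (u b) - u b * Real.log (g b) - u b + g b) - β * ∑ b, g b + β - z := by
    have h1 : ∑ b, (y b + w b) * u b = ∑ b, (- β * (u b * Real.log (g b)) - z * u b) :=
      Finset.sum_congr rfl fun b _ => by rw [hz b, hlg b]; field_simp; ring
    rw [h1, Finset.sum_add_distrib, Finset.sum_sub_distrib, Finset.sum_sub_distrib,
      Finset.sum_sub_distrib, ← Finset.mul_sum, ← Finset.mul_sum, hu.2,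
      sum_mul_log_eq_neg_entropy]
    ring
  rw [hFq, hR, hpsi]
  have := mul_nonneg hβ.le hkl
  linarith

/-! ### Stability-penalty-adaptive learning rates -/

/-- Factor `v = (√(x+v) - √x)(√(x+v) + √x)`; the second factor is at most `5√x` because `x + v ≤
10x`. -/
theorem div_sqrt_le_sqrt_add_sub_sqrt {x v : ℝ} (hx : 0 < x) (hv : 0 ≤ v) (hvx : v ≤ 9 * x) :
    v / √x ≤ 5 * (√(x + v) - √x) := by
  have hx' := Real.sqrt_pos.2 hx
  have h1 := Real.sq_sqrt hx.le
  have h2 := Real.sq_sqrt (show 0 ≤ x + v by linarith)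
  have h3 : √x ≤ √(x + v) := Real.sqrt_le_sqrt (by linarith)
  have h4 : √(x + v) ≤ 4 * √x := by
    rw [Real.sqrt_le_left (by positivity)]
    nlinarith
  rw [div_le_iff₀ hx']
  nlinarith [mul_nonneg (sub_nonneg.2 h3) (sub_nonneg.2 h4)]

theorem sqrt_add_le_add_sqrt {x y : ℝ} (hx : 0 ≤ x) (hy : 0 ≤ y) : √(x + y) ≤ √x + √y := by
  rw [Real.sqrt_le_left (by positivity)]
  nlinarith [Real.sq_sqrt hx, Real.sq_sqrt hy, mul_nonneg (Real.sqrt_nonneg x) (Real.sqrt_nonneg y)]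

theorem sqrt_add_le_sqrt_add_div_sqrt {x v : ℝ} (hx : 0 < x) (hv : 0 ≤ v) :
    √(x + v) ≤ √x + v / √x := by
  have hx' := Real.sqrt_pos.2 hx
  have h1 := Real.sq_sqrt hx.le
  rw [Real.sqrt_le_left (by positivity)]
  have h2 : (√x + v / √x) ^ 2 = √x ^ 2 + 2 * v + (v / √x) ^ 2 := by
    field_simp
    ring
  rw [h2, h1]
  nlinarith [sq_nonneg (v / √x)]

/-- Replacing `√w` by `√(w+x)` costs `x` times the drop of `1/√`, which telescopes separately. The
main term thus keeps the sharp constant 2. -/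
theorem div_sqrt_le_telescope {w x M : ℝ} (hw : 0 < w) (hx : 0 ≤ x) (hxM : x ≤ M) :
    x / √w ≤ 2 * (√(w + x) - √w) + M * (1 / √w - 1 / √(w + x)) := by
  have hw' := Real.sqrt_pos.2 hw
  have hwx' := Real.sqrt_pos.2 (show 0 < w + x by linarith)
  have h1 := Real.sq_sqrt hw.le
  have h2 := Real.sq_sqrt (show 0 ≤ w + x by linarith)
  have h3 : √w ≤ √(w + x) := Real.sqrt_le_sqrt (by linarith)
  have h4 : 1 / √(w + x) ≤ 1 / √w := one_div_le_one_div_of_le hw' h3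
  have h5 : x / √(w + x) ≤ 2 * (√(w + x) - √w) := by
    rw [div_le_iff₀ hwx']
    nlinarith [mul_nonneg (sub_nonneg.2 h3) (sub_nonneg.2 h3)]
  have h6 := mul_le_mul_of_nonneg_right hxM (sub_nonneg.2 h4)
  have h7 : x / √w = x / √(w + x) + x * (1 / √w - 1 / √(w + x)) := by ring
  linarith

section LearningRate

variable {V h β : ℕ → ℝ} {Vb lk c : ℝ}

/-- Bounding every entropy by `lk` gives `β t ≥ c / √lk * √(Vb + S t)`, where `S t` is the partial
sum of `V`; the quotients then telescope as differences of square roots. -/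
theorem sum_div_learningRate_le_sqrt (hVb : 0 < Vb) (hlk : 0 < lk) (hc : 0 < c)
    (hV0 : ∀ t, 0 ≤ V t) (hV : ∀ t, V t ≤ 9 * Vb) (hh : ∀ t, h t ≤ lk)
    (hh0 : ∀ t, 0 ≤ h t) (hβ0 : c * √Vb / √lk ≤ β 0)
    (hβ : ∀ t, β (t + 1) = β t + c * V t / √(Vb * lk + ∑ s ∈ Finset.range t, V s * h (s + 1)))
    (n : ℕ) :
    ∑ t ∈ Finset.range n, V t / β t ≤ 5 / c * √(lk * ∑ t ∈ Finset.range n, V t) := by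
  set S : ℕ → ℝ := fun t => ∑ s ∈ Finset.range t, V s with hS
  have hS0 : ∀ t, 0 ≤ S t := fun t => Finset.sum_nonneg fun s _ => hV0 s
  have hlk' := Real.sqrt_pos.2 hlk
  have hlow : ∀ t, c / √lk * √(Vb + S t) ≤ β t := by
    intro t
    induction t with
    | zero => simp only [hS, Finset.sum_range_zero, add_zero]; rw [div_mul_eq_mul_div]; exact hβ0
    | succ t ih =>
      rw [hβ]
      have hx : 0 < Vb + S t := by linarith [hS0 t]
      have hSs : S (t + 1) = S t + V t := Finset.sum_range_succ _ _
      have h1 := sqrt_add_le_sqrt_add_div_sqrt hx (hV0 t)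
      have h2 : √(Vb * lk + ∑ s ∈ Finset.range t, V s * h (s + 1)) ≤ √lk * √(Vb + S t) := by
        rw [← Real.sqrt_mul hlk.le]
        refine Real.sqrt_le_sqrt ?_
        have : ∑ s ∈ Finset.range t, V s * h (s + 1) ≤ S t * lk := by
          rw [hS, Finset.sum_mul]
          exact Finset.sum_le_sum fun s _ => mul_le_mul_of_nonneg_left (hh _) (hV0 s)
        linarith
      have hW : 0 < √(Vb * lk + ∑ s ∈ Finset.range t, V s * h (s + 1)) := by
        refine Real.sqrt_pos.2 ?_
        have := mul_pos hVb hlk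
        have : 0 ≤ ∑ s ∈ Finset.range t, V s * h (s + 1) :=
          Finset.sum_nonneg fun s _ => mul_nonneg (hV0 s) (hh0 _)
        linarith
      have h3 : c * V t / (√lk * √(Vb + S t)) ≤
          c * V t / √(Vb * lk + ∑ s ∈ Finset.range t, V s * h (s + 1)) :=
        div_le_div_of_nonneg_left (mul_nonneg hc.le (hV0 t)) hW h2
      have h4 := mul_le_mul_of_nonneg_left h1 (show 0 ≤ c / √lk by positivity)
      have hx' := Real.sqrt_pos.2 hx
      have h5 : c / √lk * (√(Vb + S t) + V t / √(Vb + S t)) =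
          c / √lk * √(Vb + S t) + c * V t / (√lk * √(Vb + S t)) := by
        field_simp
      rw [hSs, ← add_assoc]
      linarith
  have hterm : ∀ t, V t / β t ≤ √lk / c * (5 * (√(Vb + S (t + 1)) - √(Vb + S t))) := by
    intro t
    have hx : 0 < Vb + S t := by linarith [hS0 t]
    have hx' := Real.sqrt_pos.2 hx
    have hSs : S (t + 1) = S t + V t := Finset.sum_range_succ _ _
    have h1 : V t / β t ≤ V t / (c / √lk * √(Vb + S t)) :=
      div_le_div_of_nonneg_left (hV0 t) (by positivity) (hlow t)
    have h2 : V t / (c / √lk * √(Vb + S t)) = √lk / c * (V t / √(Vb + S t)) := by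
      field_simp
    rw [hSs, ← add_assoc]
    refine h1.trans (h2.le.trans (mul_le_mul_of_nonneg_left ?_ (by positivity)))
    exact div_sqrt_le_sqrt_add_sub_sqrt hx (hV0 t) (by linarith [hV t, hS0 t])
  refine (Finset.sum_le_sum fun t _ => hterm t).trans ?_
  rw [← Finset.mul_sum, ← Finset.mul_sum, Finset.sum_range_sub fun t => √(Vb + S t)]
  have h1 : √(Vb + S n) ≤ √Vb + √(S n) := sqrt_add_le_add_sqrt hVb.le (hS0 n)
  have h2 : S 0 = 0 := by simp [hS]
  rw [h2, add_zero, Real.sqrt_mul hlk.le]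
  have h3 : √lk / c * (5 * (√(Vb + S n) - √Vb)) ≤ √lk / c * (5 * √(S n)) := by
    refine mul_le_mul_of_nonneg_left ?_ (by positivity)
    linarith
  refine h3.trans (le_of_eq ?_)
  ring

/-- Bounding all denominators by the final one makes `β t` grow linearly in `Vb + S t`, so the
quotients sum to a logarithm. Here 40 is 10, from `Vb + S (t+1) ≤ 10 (Vb + S t)`, times 4, from `1 +
9n ≤ (1+n)⁴`. -/
theorem sum_div_learningRate_le_log (hVb : 0 < Vb) (hlk : 0 < lk) (hc : 0 < c)
    (hV0 : ∀ t, 0 ≤ V t) (hV : ∀ t, V t ≤ 9 * Vb)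
    (hh0 : ∀ t, 0 ≤ h t) (hβ0 : c * √Vb / √lk ≤ β 0)
    (hβ : ∀ t, β (t + 1) = β t + c * V t / √(Vb * lk + ∑ s ∈ Finset.range t, V s * h (s + 1)))
    {n : ℕ} (hn : 1 ≤ n) :
    ∑ t ∈ Finset.range n, V t / β t ≤
      40 / c * (√(Vb * lk + ∑ t ∈ Finset.range n, V t * h (t + 1)) * Real.log (1 + n)) := by
  set W : ℕ → ℝ := fun t => Vb * lk + ∑ s ∈ Finset.range t, V s * h (s + 1) with hW
  set S : ℕ → ℝ := fun t => ∑ s ∈ Finset.range t, V s with hS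
  have hS0 : ∀ t, 0 ≤ S t := fun t => Finset.sum_nonneg fun s _ => hV0 s
  have hlk' := Real.sqrt_pos.2 hlk
  have hVb' := Real.sqrt_pos.2 hVb
  have hWmono : Monotone W := monotone_nat_of_le_succ fun t => by
    simp only [hW, Finset.sum_range_succ]
    linarith [mul_nonneg (hV0 t) (hh0 (t + 1))]
  have hWpos : ∀ t, 0 < W t := fun t =>
    (mul_pos hVb hlk).trans_le (by simpa [hW] using hWmono (Nat.zero_le t))
  have hWn := Real.sqrt_pos.2 (hWpos n)
  have hlow : ∀ t ≤ n, c / √(W n) * (Vb + S t) ≤ β t := by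
    intro t
    induction t with
    | zero =>
      intro _
      refine le_trans ?_ hβ0
      have h1 : √Vb * √lk ≤ √(W n) := by
        rw [← Real.sqrt_mul hVb.le]
        exact Real.sqrt_le_sqrt (by simpa [hW] using hWmono (Nat.zero_le n))
      have h2 : S 0 = 0 := by simp [hS]
      rw [h2, add_zero, div_mul_eq_mul_div, div_le_div_iff₀ hWn hlk']
      have h3 := Real.mul_self_sqrt hVb.le
      calc c * Vb * √lk = c * √Vb * (√Vb * √lk) := by
            linear_combination -c * √lk * h3
        _ ≤ c * √Vb * √(W n) := mul_le_mul_of_nonneg_left h1 (by positivity)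
    | succ t ih =>
      intro ht
      have := ih (by omega)
      rw [hβ]
      have hSs : S (t + 1) = S t + V t := Finset.sum_range_succ _ _
      have h1 : c * V t / √(W n) ≤ c * V t / √(W t) :=
        div_le_div_of_nonneg_left (mul_nonneg hc.le (hV0 t)) (Real.sqrt_pos.2 (hWpos t))
          (Real.sqrt_le_sqrt (hWmono (by omega)))
      have h2 : c / √(W n) * (Vb + S (t + 1)) = c / √(W n) * (Vb + S t) + c * V t / √(W n) := by
        rw [hSs]; ring
      rw [h2]
      exact add_le_add this h1
  have hterm : ∀ t < n, V t / β t ≤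
      √(W n) / c * (10 * (Real.log (Vb + S (t + 1)) - Real.log (Vb + S t))) := by
    intro t ht
    have hx : 0 < Vb + S t := by linarith [hS0 t]
    have hSs : S (t + 1) = S t + V t := Finset.sum_range_succ _ _
    have h1 : V t / β t ≤ V t / (c / √(W n) * (Vb + S t)) :=
      div_le_div_of_nonneg_left (hV0 t) (by positivity) (hlow t ht.le)
    have h2 : V t / (c / √(W n) * (Vb + S t)) = √(W n) / c * (V t / (Vb + S t)) := by
      field_simp
    refine h1.trans (h2.le.trans (mul_le_mul_of_nonneg_left ?_ (by positivity)))
    have hx' : 0 < Vb + S (t + 1) := by linarith [hS0 (t + 1)]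
    rw [← Real.log_div hx'.ne' hx.ne']
    have h3 := Real.one_sub_inv_le_log_of_pos (div_pos hx' hx)
    have h4 : 1 - ((Vb + S (t + 1)) / (Vb + S t))⁻¹ = V t / (Vb + S (t + 1)) := by
      rw [inv_div, hSs]; rw [hSs] at hx'; field_simp; ring
    have h5 : V t / (Vb + S t) ≤ 10 * (V t / (Vb + S (t + 1))) := by
      rw [mul_div_assoc', div_le_div_iff₀ hx hx']
      have : Vb + S (t + 1) ≤ 10 * (Vb + S t) := by linarith [hV t, hS0 t]
      nlinarith [mul_le_mul_of_nonneg_left this (hV0 t)]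
    linarith
  refine (Finset.sum_le_sum fun t ht => hterm t (Finset.mem_range.1 ht)).trans ?_
  rw [← Finset.mul_sum, ← Finset.mul_sum, Finset.sum_range_sub fun t => Real.log (Vb + S t)]
  have hSn : S n ≤ 9 * n * Vb := by
    have := Finset.sum_le_card_nsmul (Finset.range n) V (9 * Vb) fun t _ => hV t
    rw [Finset.card_range, nsmul_eq_mul] at this
    simp only [hS]; linarith
  have hn1 : (1 : ℝ) ≤ n := by exact_mod_cast hn
  have hlog : Real.log (Vb + S n) - Real.log (Vb + S 0) ≤ 4 * Real.log (1 + n) := by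
    have h2 : S 0 = 0 := by simp [hS]
    rw [h2, add_zero, ← Real.log_div (by linarith [hS0 n]) hVb.ne']
    have h3 : (Vb + S n) / Vb ≤ (1 + (n : ℝ)) ^ 4 := by
      rw [div_le_iff₀ hVb]
      have h4 : 1 + 9 * (n : ℝ) ≤ (1 + (n : ℝ)) ^ 4 := by
        have : (1 + (n : ℝ)) ^ 4 = 1 + 4 * n + 6 * n ^ 2 + 4 * n ^ 3 + n ^ 4 := by ring
        rw [this]
        nlinarith [pow_nonneg (by linarith : (0 : ℝ) ≤ n) 3, pow_nonneg (by linarith : (0 : ℝ) ≤ n) 4]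
      nlinarith [mul_le_mul_of_nonneg_right h4 hVb.le]
    have h5 := Real.log_le_log (div_pos (by linarith [hS0 n]) hVb) h3
    rw [Real.log_pow] at h5
    exact_mod_cast h5
  calc √(W n) / c * (10 * (Real.log (Vb + S n) - Real.log (Vb + S 0)))
      ≤ √(W n) / c * (10 * (4 * Real.log (1 + n))) := by
        refine mul_le_mul_of_nonneg_left ?_ (by positivity)
        linarith
    _ = _ := by ring

/-- Each term is `c` times an increment of `W` divided by `√W`. The increments are at most `9 * Vb *
lk`, which yields the additive remainder. -/
theorem sum_learningRate_sub_mul_le (hVb : 0 < Vb) (hlk : 0 < lk) (hc : 0 < c)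
    (hV0 : ∀ t, 0 ≤ V t) (hV : ∀ t, V t ≤ 9 * Vb) (hh : ∀ t, h t ≤ lk) (hh0 : ∀ t, 0 ≤ h t)
    (hβ : ∀ t, β (t + 1) = β t + c * V t / √(Vb * lk + ∑ s ∈ Finset.range t, V s * h (s + 1)))
    (n : ℕ) :
    ∑ t ∈ Finset.range n, (β (t + 1) - β t) * h (t + 1) ≤
      2 * c * √(Vb * lk + ∑ t ∈ Finset.range n, V t * h (t + 1)) + 9 * c * √(Vb * lk) := by
  set W : ℕ → ℝ := fun t => Vb * lk + ∑ s ∈ Finset.range t, V s * h (s + 1) with hW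
  have hWpos : ∀ t, 0 < W t := fun t => by
    have := mul_pos hVb hlk
    have : 0 ≤ ∑ s ∈ Finset.range t, V s * h (s + 1) :=
      Finset.sum_nonneg fun s _ => mul_nonneg (hV0 s) (hh0 _)
    simp only [hW]; linarith
  have hterm : ∀ t, (β (t + 1) - β t) * h (t + 1) ≤ c * (2 * (√(W (t + 1)) - √(W t)) +
      9 * (Vb * lk) * (1 / √(W t) - 1 / √(W (t + 1)))) := by
    intro t
    have hWs : W (t + 1) = W t + V t * h (t + 1) := by
      simp only [hW, Finset.sum_range_succ, add_assoc]
    have h1 : (β (t + 1) - β t) * h (t + 1) = c * (V t * h (t + 1) / √(W t)) := by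
      rw [hβ]; simp only [hW]; ring
    rw [h1, hWs]
    refine mul_le_mul_of_nonneg_left (div_sqrt_le_telescope (hWpos t)
      (mul_nonneg (hV0 t) (hh0 _)) ?_) hc.le
    calc V t * h (t + 1) ≤ 9 * Vb * lk :=
          mul_le_mul (hV t) (hh _) (hh0 _) (by positivity)
      _ = _ := by ring
  refine (Finset.sum_le_sum fun t _ => hterm t).trans ?_
  rw [← Finset.mul_sum, Finset.sum_add_distrib, ← Finset.mul_sum, ← Finset.mul_sum,
    Finset.sum_range_sub fun t => √(W t), Finset.sum_range_sub' fun t => 1 / √(W t)]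
  have h0 : W 0 = Vb * lk := by simp [hW]
  have hp := Real.sqrt_pos.2 (mul_pos hVb hlk)
  have h2 : Vb * lk * (1 / √(Vb * lk)) = √(Vb * lk) := by
    rw [mul_one_div, Real.div_sqrt]
  have h3 : 0 ≤ Vb * lk * (1 / √(W n)) := by
    have := Real.sqrt_pos.2 (hWpos n); positivity
  rw [h0]
  have : 2 * (√(W n) - √(Vb * lk)) + 9 * (Vb * lk) * (1 / √(Vb * lk) - 1 / √(W n)) ≤
      2 * √(W n) + 9 * √(Vb * lk) := by
    rw [mul_sub, mul_assoc 9, mul_sub, h2]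
    linarith
  refine (mul_le_mul_of_nonneg_left this hc.le).trans (le_of_eq ?_)
  ring

end LearningRate

/-! ### Expectations over plays -/

theorem hist_snoc_of_le {k d T : ℕ} (ω : Fin T → Fin k × Fin d) (o : Fin k × Fin d) {t : ℕ}
    (ht : t ≤ T) : hist (Fin.snoc (α := fun _ => Fin k × Fin d) ω o) t = hist ω t := by
  unfold hist
  rw [List.ofFn_succ']
  simp only [Fin.snoc_castSucc, Fin.snoc_last]
  rw [List.concat_eq_append, List.take_append_of_le_length (by simpa using ht)]

namespace Game

variable {k d : ℕ} {Sym : Type*} (𝒢 : Game k d Sym) (π : Learner k Sym) (env : Environment k d)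

/-- The joint law of the next action and outcome. -/
def jointLaw (h : List (Fin k × Fin d)) (o : Fin k × Fin d) : ℝ :=
  π.law (𝒢.observe h) o.1 * env.law h o.2

theorem jointLaw_nonneg (h : List (Fin k × Fin d)) (o : Fin k × Fin d) :
    0 ≤ 𝒢.jointLaw π env h o :=
  mul_nonneg ((π.law_mem _).1 _) ((env.law_mem _).1 _)

theorem sum_jointLaw_mul (h : List (Fin k × Fin d)) (f : Fin k × Fin d → ℝ) :
    ∑ o, 𝒢.jointLaw π env h o * f o =
      ∑ x, env.law h x * ∑ a, π.law (𝒢.observe h) a * f (a, x) := by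
  rw [Fintype.sum_prod_type_right]
  refine Finset.sum_congr rfl fun x _ => ?_
  rw [Finset.mul_sum]
  exact Finset.sum_congr rfl fun a _ => by simp only [jointLaw]; ring

theorem sum_jointLaw (h : List (Fin k × Fin d)) : ∑ o, 𝒢.jointLaw π env h o = 1 := by
  have := 𝒢.sum_jointLaw_mul π env h fun _ => 1
  simp only [mul_one, (π.law_mem _).2, (env.law_mem _).2] at this
  exact this

theorem playProb_snoc {T : ℕ} (ω : Fin T → Fin k × Fin d) (o : Fin k × Fin d) :
    𝒢.playProb π env (Fin.snoc (α := fun _ => Fin k × Fin d) ω o) =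
      𝒢.playProb π env ω * 𝒢.jointLaw π env (hist ω T) o := by
  unfold playProb
  rw [Fin.prod_univ_castSucc]
  congr 1
  · refine Finset.prod_congr rfl fun t _ => ?_
    rw [Fin.snoc_castSucc, Fin.val_castSucc, hist_snoc_of_le ω o t.2.le]
  · rw [Fin.snoc_last, Fin.val_last, hist_snoc_of_le ω o le_rfl]
    rfl

theorem playProb_nonneg {T : ℕ} (ω : Fin T → Fin k × Fin d) : 0 ≤ 𝒢.playProb π env ω :=
  Finset.prod_nonneg fun t _ => 𝒢.jointLaw_nonneg π env (hist ω t) (ω t)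

theorem expect_succ (T : ℕ) (f : (Fin (T + 1) → Fin k × Fin d) → ℝ) :
    𝒢.expect π env (T + 1) f = 𝒢.expect π env T fun ω =>
      ∑ o, 𝒢.jointLaw π env (hist ω T) o * f (Fin.snoc (α := fun _ => Fin k × Fin d) ω o) := by
  unfold expect
  rw [← Equiv.sum_comp (Fin.snocEquiv fun _ => Fin k × Fin d), Fintype.sum_prod_type_right]
  refine Finset.sum_congr rfl fun ω _ => ?_
  rw [Finset.mul_sum]
  refine Finset.sum_congr rfl fun o _ => ?_
  have : Fin.snocEquiv (fun _ => Fin k × Fin d) (o, ω) =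
      Fin.snoc (α := fun _ => Fin k × Fin d) ω o := rfl
  rw [this, playProb_snoc, mul_assoc]

theorem expect_one (T : ℕ) : 𝒢.expect π env T (fun _ => 1) = 1 := by
  induction T with
  | zero => simp [expect, playProb]
  | succ T ih => rw [expect_succ]; simp only [mul_one, sum_jointLaw]; exact ih

variable {𝒢 π env} {T : ℕ}

theorem expect_mono {f g : (Fin T → Fin k × Fin d) → ℝ} (h : ∀ ω, f ω ≤ g ω) :
    𝒢.expect π env T f ≤ 𝒢.expect π env T g :=
  Finset.sum_le_sum fun ω _ => mul_le_mul_of_nonneg_left (h ω) (𝒢.playProb_nonneg π env ω)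

theorem expect_add (f g : (Fin T → Fin k × Fin d) → ℝ) :
    𝒢.expect π env T (fun ω => f ω + g ω) = 𝒢.expect π env T f + 𝒢.expect π env T g := by
  simp only [expect, mul_add, Finset.sum_add_distrib]

theorem expect_sub (f g : (Fin T → Fin k × Fin d) → ℝ) :
    𝒢.expect π env T (fun ω => f ω - g ω) = 𝒢.expect π env T f - 𝒢.expect π env T g := by
  simp only [expect, mul_sub, Finset.sum_sub_distrib]

theorem expect_const_mul (c : ℝ) (f : (Fin T → Fin k × Fin d) → ℝ) :
    𝒢.expect π env T (fun ω => c * f ω) = c * 𝒢.expect π env T f := by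
  simp only [expect, Finset.mul_sum]
  exact Finset.sum_congr rfl fun ω _ => by ring

theorem expect_const (c : ℝ) : 𝒢.expect π env T (fun _ => c) = c := by
  have := expect_const_mul (𝒢 := 𝒢) (π := π) (env := env) (T := T) c fun _ => 1
  simp only [mul_one, expect_one] at this
  exact this

theorem expect_sum {ι : Type*} (s : Finset ι) (f : ι → (Fin T → Fin k × Fin d) → ℝ) :
    𝒢.expect π env T (fun ω => ∑ i ∈ s, f i ω) = ∑ i ∈ s, 𝒢.expect π env T (f i) := by
  simp only [expect, Finset.mul_sum]
  exact Finset.sum_comm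

theorem expect_nonneg {f : (Fin T → Fin k × Fin d) → ℝ} (h : ∀ ω, 0 ≤ f ω) :
    0 ≤ 𝒢.expect π env T f :=
  Finset.sum_nonneg fun ω _ => mul_nonneg (𝒢.playProb_nonneg π env ω) (h ω)

theorem expect_sqrt_le {f : (Fin T → Fin k × Fin d) → ℝ} (h : ∀ ω, 0 ≤ f ω) :
    𝒢.expect π env T (fun ω => √(f ω)) ≤ √(𝒢.expect π env T f) := by
  have := Real.strictConcaveOn_sqrt.concaveOn.le_map_sum (t := Finset.univ)
    (w := 𝒢.playProb π env) (p := f) (fun ω _ => 𝒢.playProb_nonneg π env ω)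
    (by have := 𝒢.expect_one π env T; simpa [expect] using this) (fun ω _ => h ω)
  simpa [expect] using this

/-- The tower property. -/
theorem expect_hist_apply (φ : List (Fin k × Fin d) → Fin k × Fin d → ℝ) (t : Fin T) :
    𝒢.expect π env T (fun ω => φ (hist ω t) (ω t)) =
      𝒢.expect π env T (fun ω => ∑ o, 𝒢.jointLaw π env (hist ω t) o * φ (hist ω t) o) := by
  induction T with
  | zero => exact t.elim0
  | succ T ih =>
    rw [expect_succ, expect_succ]
    refine Fin.lastCases ?_ (fun t => ?_) t
    · congr 1
      funext ω
      simp only [Fin.snoc_last, Fin.val_last, hist_snoc_of_le ω _ le_rfl, ← Finset.sum_mul,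
        sum_jointLaw, one_mul]
    · simp only [Fin.snoc_castSucc, Fin.val_castSucc, hist_snoc_of_le _ _ t.2.le,
        ← Finset.sum_mul, sum_jointLaw, one_mul]
      exact ih t

/-- Action and outcome are independent given the past, so a bound that is uniform in the outcome
survives any adaptive environment. -/
theorem expect_hist_apply_le {φ : List (Fin k × Fin d) → Fin k × Fin d → ℝ}
    {ψ : List (Fin k × Fin d) → ℝ}
    (h : ∀ l x, ∑ a, π.law (𝒢.observe l) a * φ l (a, x) ≤ ψ l) (t : Fin T) :
    𝒢.expect π env T (fun ω => φ (hist ω t) (ω t)) ≤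
      𝒢.expect π env T (fun ω => ψ (hist ω t)) := by
  rw [expect_hist_apply]
  refine expect_mono fun ω => ?_
  rw [sum_jointLaw_mul]
  refine (Finset.sum_le_sum fun x _ =>
    mul_le_mul_of_nonneg_left (h (hist ω t) x) ((env.law_mem _).1 x)).trans ?_
  rw [← Finset.sum_mul, (env.law_mem _).2, one_mul]

/-- The expected loss of a fixed action is linear in the expected outcome counts `N`, so a best
comparator can be found among the actions over which the bias takes its maximum. -/
theorem regret_le_of_pareto (hk : 0 < k) (hd : 0 < d) :
    ∃ c, 𝒢.IsPareto c ∧ 𝒢.regret π env T ≤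
      𝒢.expect π env T (fun ω => ∑ t, (𝒢.loss (ω t).1 (ω t).2 - 𝒢.loss c (ω t).2)) := by
  classical
  let N : Fin d → ℝ := fun x => 𝒢.expect π env T fun ω => ∑ t, if (ω t).2 = x then 1 else 0
  have hN : ∀ x, 0 ≤ N x := fun x => expect_nonneg fun ω => Finset.sum_nonneg fun t _ => by
    split_ifs <;> norm_num
  have hloss : ∀ a, 𝒢.expect π env T (fun ω => ∑ t, 𝒢.loss a (ω t).2) =
      ∑ x, 𝒢.loss a x * N x := by
    intro a
    simp only [N, ← expect_const_mul]
    rw [← expect_sum]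
    congr 1
    funext ω
    simp only [Finset.mul_sum]
    rw [Finset.sum_comm]
    exact Finset.sum_congr rfl fun t _ => by simp
  obtain ⟨c, hc, hopt⟩ := 𝒢.exists_isPareto_optimal hk hd hN
  refine ⟨c, hc, ?_⟩
  have : Nonempty (Fin k) := ⟨⟨0, hk⟩⟩
  have hinf : 𝒢.expect π env T (fun ω => ∑ t, 𝒢.loss c (ω t).2) ≤
      ⨅ a : Fin k, 𝒢.expect π env T (fun ω => ∑ t, 𝒢.loss a (ω t).2) := by
    refine le_ciInf fun b => ?_
    rw [hloss, hloss]
    have := hopt b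
    rw [excess_eq_sub] at this
    linarith
  simp only [Finset.sum_sub_distrib]
  rw [expect_sub]
  unfold regret
  linarith

theorem regret_le_horizon (hk : 0 < k) : 𝒢.regret π env T ≤ T := by
  have : Nonempty (Fin k) := ⟨⟨0, hk⟩⟩
  have h1 : 𝒢.expect π env T (fun ω => ∑ t, 𝒢.loss (ω t).1 (ω t).2) ≤ T := by
    refine (expect_mono (g := fun _ => (T : ℝ)) fun ω => ?_).trans (expect_const _).le
    have := Finset.sum_le_card_nsmul Finset.univ (fun t => 𝒢.loss (ω t).1 (ω t).2) 1
      fun t _ => (𝒢.loss_mem _ _).2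
    simpa using this
  have h2 : 0 ≤ ⨅ a : Fin k, 𝒢.expect π env T (fun ω => ∑ t, 𝒢.loss a (ω t).2) :=
    le_ciInf fun a => expect_nonneg fun ω => Finset.sum_nonneg fun t _ => (𝒢.loss_mem _ _).1
  unfold regret
  linarith

end Game

/-! ### Entropy -/

theorem entropy_nonneg {k : ℕ} {q : Fin k → ℝ} (hq : q ∈ stdSimplex ℝ (Fin k)) :
    0 ≤ entropy q :=
  Finset.sum_nonneg fun a _ => Real.negMulLog_nonneg (hq.1 a)
    (hq.2 ▸ Finset.single_le_sum (fun b _ => hq.1 b) (Finset.mem_univ a))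

theorem entropy_le_log {k : ℕ} (hk : 0 < k) {q : Fin k → ℝ} (hq : q ∈ stdSimplex ℝ (Fin k)) :
    entropy q ≤ Real.log k := by
  have hkR : (0 : ℝ) < k := by exact_mod_cast hk
  have h : 0 ≤ ∑ b, (q b * Real.log (q b) - q b * Real.log (1 / k) - q b + 1 / k) :=
    Finset.sum_nonneg fun b _ => mul_log_sub_nonneg (hq.1 b) (by positivity)
  rw [Finset.sum_add_distrib, Finset.sum_sub_distrib, Finset.sum_sub_distrib, ← Finset.sum_mul,
    hq.2, sum_mul_log_eq_neg_entropy, one_div, Real.log_inv, Finset.sum_const, Finset.card_univ,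
    Fintype.card_fin, nsmul_eq_mul, mul_inv_cancel₀ hkR.ne'] at h
  linarith

/-- Distributions concentrated on one action have small entropy. -/
theorem entropy_le_of_concentrated {k T : ℕ} (hT : 0 < T) {q : Fin k → ℝ}
    (hq : q ∈ stdSimplex ℝ (Fin k)) (a : Fin k) :
    entropy q ≤ (1 - q a) * Real.log (k * T) + 1 / T := by
  classical
  have hkR : (0 : ℝ) < k := by exact_mod_cast Fin.pos a
  have hTR : (0 : ℝ) < T := by exact_mod_cast hT
  -- The reference measure has mass 1 at `a` and `1/(kT)` elsewhere. Its excess mass over 1 is at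
  -- most `1/T`, the additive term.
  set r : Fin k → ℝ := fun b => if b = a then 1 else 1 / (k * T) with hr
  have hr0 : ∀ b, 0 < r b := fun b => by simp only [hr]; split_ifs <;> positivity
  have h : 0 ≤ ∑ b, (q b * Real.log (q b) - q b * Real.log (r b) - q b + r b) :=
    Finset.sum_nonneg fun b _ => mul_log_sub_nonneg (hq.1 b) (hr0 b)
  have hrest : ∑ b ∈ Finset.univ.erase a, q b = 1 - q a := by
    rw [← hq.2, ← Finset.add_sum_erase _ _ (Finset.mem_univ a)]; ring
  have h1 : ∑ b, q b * Real.log (r b) = - ((1 - q a) * Real.log (k * T)) := by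
    rw [← Finset.add_sum_erase _ _ (Finset.mem_univ a), ← hrest, Finset.sum_mul]
    simp only [hr, if_true, Real.log_one, mul_zero, zero_add]
    rw [← Finset.sum_neg_distrib]
    refine Finset.sum_congr rfl fun b hb => ?_
    rw [if_neg (Finset.ne_of_mem_erase hb), one_div, Real.log_inv]
    ring
  have h2 : ∑ b, r b ≤ 1 + 1 / T := by
    rw [← Finset.add_sum_erase _ _ (Finset.mem_univ a)]
    have h3 : ∑ b ∈ Finset.univ.erase a, r b ≤ 1 / T := by
      have h4 : ∀ b ∈ Finset.univ.erase a, r b ≤ 1 / (k * T) := fun b hb => by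
        simp only [hr]; rw [if_neg (Finset.ne_of_mem_erase hb)]
      refine (Finset.sum_le_card_nsmul _ _ _ h4).trans ?_
      rw [nsmul_eq_mul]
      have : ((Finset.univ.erase a).card : ℝ) ≤ k := by
        have := Finset.card_le_univ (Finset.univ.erase a)
        rw [Fintype.card_fin] at this
        exact_mod_cast this
      calc _ ≤ (k : ℝ) * (1 / (k * T)) := mul_le_mul_of_nonneg_right this (by positivity)
        _ = 1 / T := by field_simp
    have h5 : r a = 1 := by simp [hr]
    linarith
  rw [Finset.sum_add_distrib, Finset.sum_sub_distrib, Finset.sum_sub_distrib, hq.2, h1,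
    sum_mul_log_eq_neg_entropy] at h
  linarith

/-! ### Parameters -/

namespace Model

variable {k m : ℕ}

theorem half_le_B (M : Model) (hk : 2 ≤ k) (hm : 1 ≤ m) : 1 / 2 ≤ M.B k m := by
  have hkR : (2 : ℝ) ≤ k := by exact_mod_cast hk
  have hmR : (1 : ℝ) ≤ m := by exact_mod_cast hm
  cases M with
  | FI => simp [B]
  | MAB => simp only [B]; linarith
  | PMlocal =>
    simp only [B]
    have : (4 : ℝ) ≤ (k : ℝ) ^ 2 := by nlinarith
    nlinarith

theorem Vbar_pos (M : Model) (hk : 2 ≤ k) (hm : 1 ≤ m) : 0 < M.Vbar k m := by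
  cases M <;> simp only [Vbar] <;> positivity

theorem one_le_r (M : Model) (hk : 2 ≤ k) : 1 ≤ M.r k := by
  have hkR : (2 : ℝ) ≤ k := by exact_mod_cast hk
  cases M <;> simp only [r] <;> linarith

theorem Vbar_le (M : Model) (hk : 2 ≤ k) : M.Vbar k m ≤ 2 * M.B k m ^ 2 := by
  have hkR : (2 : ℝ) ≤ k := by exact_mod_cast hk
  cases M with
  | FI => simp only [B, Vbar]; norm_num
  | MAB => simp only [B, Vbar]; nlinarith
  | PMlocal =>
    simp only [B, Vbar]
    have h : 0 ≤ (m : ℝ) ^ 2 * (k : ℝ) ^ 3 := by positivity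
    have : 2 * (2 * (m : ℝ) * (k : ℝ) ^ 2) ^ 2 = 8 * ((m : ℝ) ^ 2 * (k : ℝ) ^ 3) * k := by ring
    rw [this]
    nlinarith [mul_le_mul_of_nonneg_left hkR h]

/-- The sampling distribution gives each action a fraction `1 / r` of its weight. -/
theorem le_r_mul_of_feasible (M : Model) {q p : Fin k → ℝ} (hp : p ∈ M.feasible q)
    (a : Fin k) : q a ≤ M.r k * p a := by
  have hkR : (0 : ℝ) < k := by exact_mod_cast Fin.pos a
  cases M with
  | FI => have h : p = q := hp.2; simp [r, h]
  | MAB => have h : p = q := hp.2; simp [r, h]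
  | PMlocal =>
    have := hp.2 a
    rw [div_le_iff₀ (by positivity)] at this
    simp only [r]; linarith

end Model

/-! ### Regret along a play -/

/-- The first `t` terms of a sequence. -/
def initSeg {α : Type*} (o : ℕ → α) (t : ℕ) : List α := (List.range t).map o

theorem initSeg_succ {α : Type*} (o : ℕ → α) (t : ℕ) : initSeg o (t + 1) = initSeg o t ++ [o t] := by
  simp [initSeg, List.range_succ]

@[simp] theorem initSeg_zero {α : Type*} (o : ℕ → α) : initSeg o 0 = [] := rfl

@[simp] theorem length_initSeg {α : Type*} (o : ℕ → α) (t : ℕ) : (initSeg o t).length = t := by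
  simp [initSeg]

theorem take_initSeg {α : Type*} (o : ℕ → α) {s t : ℕ} (h : s ≤ t) :
    (initSeg o t).take s = initSeg o s := by
  simp [initSeg, ← List.map_take, List.take_range, h]

namespace Algorithm

variable {k d : ℕ} {Sym : Type*} {𝒢 : Game k d Sym} {M : Model} {T : ℕ} (alg : Algorithm 𝒢 M T)

/-- The loss estimate `ŷ_t` when `o` is observed after `h`. -/
def est (h : List (Fin k × Sym)) (o : Fin k × Sym) (b : Fin k) : ℝ :=
  alg.G h o.1 o.2 b / alg.p h o.1

/-- `V'_t` after the observations `h`. -/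
def val (h : List (Fin k × Sym)) : ℝ := 𝒢.optTrunc M (alg.q h) (1 / alg.β h)

theorem val_nonneg (h : List (Fin k × Sym)) : 0 ≤ alg.val h := le_max_left _ _

theorem β_mono_append (h : List (Fin k × Sym)) (o : Fin k × Sym) : alg.β h ≤ alg.β (h ++ [o]) := by
  rw [alg.β_succ]
  have : 0 ≤ √(Real.log (1 + T) / 2) * 𝒢.optTrunc M (alg.q h) (1 / alg.β h) /
      √(M.Vbar k 𝒢.numSym * entropy (alg.q []) +
        ∑ s ∈ Finset.range h.length,
          𝒢.optTrunc M (alg.q (h.take s)) (1 / alg.β (h.take s)) *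
            entropy (alg.q (h.take (s + 1)))) :=
    div_nonneg (mul_nonneg (Real.sqrt_nonneg _) (le_max_left _ _)) (Real.sqrt_nonneg _)
  linarith

theorem β_nil_le (h : List (Fin k × Sym)) : alg.β [] ≤ alg.β h := by
  induction h using List.reverseRecOn with
  | nil => exact le_rfl
  | append_singleton h o ih => exact ih.trans (alg.β_mono_append h o)

theorem isMinOn_initSeg (o : ℕ → Fin k × Sym) (n : ℕ) : IsMinOn
    (fun u : Fin k → ℝ => ∑ b, (∑ t ∈ Finset.range n, alg.est (initSeg o t) (o t) b) * u b +
      alg.β (initSeg o n) * ∑ b, u b * Real.log (u b))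
    (stdSimplex ℝ (Fin k)) (alg.q (initSeg o n)) := by
  have hsum : ∀ b, ∑ i : Fin (initSeg o n).length,
      alg.G ((initSeg o n).take i) ((initSeg o n).get i).1 ((initSeg o n).get i).2 b /
        alg.p ((initSeg o n).take i) ((initSeg o n).get i).1 =
      ∑ t ∈ Finset.range n, alg.est (initSeg o t) (o t) b := by
    intro b
    induction n with
    | zero => exact Finset.sum_eq_zero fun i _ => absurd i.2 (by simp)
    | succ n ih =>
      rw [Finset.sum_range_succ, ← ih, initSeg_succ]
      exact sum_take_get_append (fun h o => alg.est h o b) (initSeg o n) (o n)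
  have := alg.q_min (initSeg o n)
  simp only [hsum] at this
  exact this

theorem q_pos (hk : 0 < k) {h : List (Fin k × Sym)} (hβ : 0 < alg.β h) (b : Fin k) :
    0 < alg.q h b :=
  (exists_log_eq_of_isMinOn hk hβ (alg.q_mem h) (alg.q_min h)).1 b

/-- Without data the leader maximizes the entropy, so `V̄ H(q₁)` in the learning rate is `V̄ log k`.
-/
theorem entropy_q_nil (hk : 0 < k) (hβ : 0 < alg.β []) : entropy (alg.q []) = Real.log k := by
  have hkR : (0 : ℝ) < k := by exact_mod_cast hk
  refine le_antisymm (entropy_le_log hk (alg.q_mem [])) ?_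
  have h := alg.q_min [] (show (fun _ => 1 / (k : ℝ)) ∈ stdSimplex ℝ (Fin k) from
    ⟨fun _ => by positivity, by simp [hkR.ne']⟩)
  simp only [Set.mem_ofPred_eq, sum_mul_log_eq_neg_entropy] at h
  simp only [List.length_nil, Finset.univ_eq_empty, Finset.sum_empty, zero_mul,
    Finset.sum_const_zero, zero_add] at h
  have h2 := le_of_mul_le_mul_left h hβ
  have h3 : entropy (fun _ : Fin k => 1 / (k : ℝ)) = Real.log k := by
    simp only [entropy, Real.negMulLog, one_div, Real.log_inv, Finset.sum_const, Finset.card_univ,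
      Fintype.card_fin, nsmul_eq_mul]
    field_simp
  linarith

/-- The regret of follow the regularized leader with respect to the estimated losses. -/
theorem ftrl_regret_le (hk : 0 < k) (hβ : 0 < alg.β []) (o : ℕ → Fin k × Sym) (c : Fin k)
    (n : ℕ) :
    ∑ t ∈ Finset.range n, (∑ b, alg.est (initSeg o t) (o t) b * alg.q (initSeg o t) b -
        alg.est (initSeg o t) (o t) c -
        alg.β (initSeg o t) * psi (alg.q (initSeg o t))
          (fun b => alg.est (initSeg o t) (o t) b / alg.β (initSeg o t))) ≤
      alg.β [] * Real.log k + ∑ t ∈ Finset.range n,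
        (alg.β (initSeg o (t + 1)) - alg.β (initSeg o t)) * entropy (alg.q (initSeg o (t + 1))) := by
  classical
  set cum : ℕ → Fin k → ℝ := fun n b => ∑ t ∈ Finset.range n, alg.est (initSeg o t) (o t) b
    with hcum
  have hβn : ∀ n, 0 < alg.β (initSeg o n) := fun n => hβ.trans_le (alg.β_nil_le _)
  have hmin : ∀ n, IsMinOn (fun u : Fin k → ℝ => ∑ b, cum n b * u b +
      alg.β (initSeg o n) * ∑ b, u b * Real.log (u b)) (stdSimplex ℝ (Fin k))
      (alg.q (initSeg o n)) := alg.isMinOn_initSeg o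
  -- The potential is the optimal regularized value after `n` rounds. `ftrl_step` compares it with
  -- the next leader at the old `β`; changing to the new `β` costs the increment times the new
  -- entropy.
  have hpot : ∀ n, ∑ t ∈ Finset.range n,
      (∑ b, alg.est (initSeg o t) (o t) b * alg.q (initSeg o t) b -
        alg.β (initSeg o t) * psi (alg.q (initSeg o t))
          (fun b => alg.est (initSeg o t) (o t) b / alg.β (initSeg o t))) ≤
      alg.β [] * Real.log k + ∑ t ∈ Finset.range n,
        (alg.β (initSeg o (t + 1)) - alg.β (initSeg o t)) * entropy (alg.q (initSeg o (t + 1))) +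
      (∑ b, cum n b * alg.q (initSeg o n) b -
        alg.β (initSeg o n) * entropy (alg.q (initSeg o n))) := by
    intro n
    induction n with
    | zero => simp [hcum, alg.entropy_q_nil hk hβ]
    | succ n ih =>
      have hstep := ftrl_step hk (hβn n) (alg.q_mem _) (hmin n)
        (alg.est (initSeg o n) (o n)) (alg.q_mem (initSeg o (n + 1)))
      have hc : ∀ b, cum (n + 1) b = cum n b + alg.est (initSeg o n) (o n) b := fun b =>
        Finset.sum_range_succ _ _
      simp only [Finset.sum_range_succ _ n, hc]
      linarith
  -- The final potential is at most its value at the point mass on `c`, which has no entropy.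
  have hfin := hmin n (single_mem_stdSimplex ℝ c)
  simp only [Set.mem_ofPred_eq, sum_mul_log_eq_neg_entropy] at hfin
  have he : entropy (Pi.single c 1 : Fin k → ℝ) = 0 := by
    refine Finset.sum_eq_zero fun b _ => ?_
    rw [Pi.single_apply]; split_ifs <;> simp
  have hs : ∑ b, cum n b * (Pi.single c 1 : Fin k → ℝ) b = cum n c := by
    simp [Pi.single_apply]
  rw [he, hs, neg_zero, mul_zero, add_zero] at hfin
  have := hpot n
  rw [Finset.sum_sub_distrib] at this
  simp only [Finset.sum_sub_distrib]
  simp only [hcum] at hfin this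
  linarith

/-- The conditional expectation of the part of the regret that is not estimated. -/
theorem sum_p_mul_gap_le (hk : 0 < k) (hβ : 0 < alg.β []) (h : List (Fin k × Sym)) {c : Fin k}
    (hc : 𝒢.IsPareto c) (x : Fin d) :
    ∑ a, alg.p h a * (𝒢.loss a x - 𝒢.loss c x -
      (∑ b, alg.est h (a, 𝒢.feedback a x) b * alg.q h b - alg.est h (a, 𝒢.feedback a x) c -
        alg.β h * psi (alg.q h) (fun b => alg.est h (a, 𝒢.feedback a x) b / alg.β h))) ≤
      alg.val h / alg.β h + 1 / (T * alg.β h) := by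
  have hβh : 0 < alg.β h := hβ.trans_le (alg.β_nil_le h)
  have hp0 := Game.feasible_pos (fun b => alg.q_pos hk hβh b) (alg.p_mem h)
  have hp1 := (alg.p_mem h).1.2
  have hbr := (le_ciSup (f := fun x => ((∑ a, (alg.p h a - alg.q h a) * 𝒢.loss a x) / (1 / alg.β h) +
    𝒢.bias (alg.q h) (alg.G h) x / (1 / alg.β h) +
    1 / (1 / alg.β h) ^ 2 * ∑ a, alg.p h a * psi (alg.q h) fun b =>
      1 / alg.β h * alg.G h a (𝒢.feedback a x) b / alg.p h a))
    (Set.finite_range _).bddAbove x).trans (alg.near_min h)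
  have hle : 𝒢.optVal M (alg.q h) (1 / alg.β h) ≤ alg.val h := le_max_right _ _
  set β := alg.β h
  set p := alg.p h
  set q := alg.q h
  set G := alg.G h
  have hψ : ∀ a, psi q (fun b => alg.est h (a, 𝒢.feedback a x) b / β) =
      psi q (fun b => 1 / β * G a (𝒢.feedback a x) b / p a) := fun a => by
    congr 1
    funext b
    simp only [est]
    ring
  set Ψ := ∑ a, p a * psi q (fun b => 1 / β * G a (𝒢.feedback a x) b / p a) with hΨ
  -- Importance weighting: `p a` is positive, so averaging the estimate over the action recovers `∑
  -- a, G a`.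
  have hest : ∀ a b, p a * alg.est h (a, 𝒢.feedback a x) b = G a (𝒢.feedback a x) b :=
    fun a b => mul_div_cancel₀ _ (hp0 a).ne'
  have hL : ∑ a, p a * (𝒢.loss a x - 𝒢.loss c x -
      (∑ b, alg.est h (a, 𝒢.feedback a x) b * q b - alg.est h (a, 𝒢.feedback a x) c -
        β * psi q (fun b => alg.est h (a, 𝒢.feedback a x) b / β))) =
      ∑ a, p a * 𝒢.loss a x - 𝒢.loss c x - ∑ b, q b * ∑ a, G a (𝒢.feedback a x) b +
        ∑ a, G a (𝒢.feedback a x) c + β * Ψ := by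
    have h1 : ∀ a, p a * (𝒢.loss a x - 𝒢.loss c x -
      (∑ b, alg.est h (a, 𝒢.feedback a x) b * q b - alg.est h (a, 𝒢.feedback a x) c -
        β * psi q (fun b => alg.est h (a, 𝒢.feedback a x) b / β))) =
        p a * 𝒢.loss a x - p a * 𝒢.loss c x - ∑ b, q b * G a (𝒢.feedback a x) b +
        G a (𝒢.feedback a x) c +
        β * (p a * psi q (fun b => 1 / β * G a (𝒢.feedback a x) b / p a)) := by
      intro a
      have h2 : ∑ b, q b * G a (𝒢.feedback a x) b =
          p a * ∑ b, alg.est h (a, 𝒢.feedback a x) b * q b := by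
        rw [Finset.mul_sum]
        exact Finset.sum_congr rfl fun b _ => by rw [← hest]; ring
      rw [h2, ← hest a c, hψ]
      ring
    simp only [h1, Finset.sum_add_distrib, Finset.sum_sub_distrib, ← Finset.sum_mul, hp1, one_mul,
      ← Finset.mul_sum, hΨ]
    congr 3
    simp only [Finset.mul_sum]
    rw [Finset.sum_comm]
  rw [hL]
  have hbias : ∑ b, q b * 𝒢.loss b x - ∑ b, q b * ∑ a, G a (𝒢.feedback a x) b +
      (∑ a, G a (𝒢.feedback a x) c - 𝒢.loss c x) ≤ 𝒢.bias q G x := by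
    unfold Game.bias
    simp only [mul_sub, Finset.sum_sub_distrib]
    have := le_ciSup (f := fun c : {c : Fin k // 𝒢.IsPareto c} =>
      (∑ a, G a (𝒢.feedback a x) c - 𝒢.loss c x)) (Set.finite_range _).bddAbove ⟨c, hc⟩
    linarith
  have hlin : ∑ a, (p a - q a) * 𝒢.loss a x =
      ∑ a, p a * 𝒢.loss a x - ∑ a, q a * 𝒢.loss a x := by
    simp only [sub_mul, Finset.sum_sub_distrib]
  -- The objective with `η = 1/β`, divided by `β`.
  have hbr2 : ∑ a, p a * 𝒢.loss a x - ∑ a, q a * 𝒢.loss a x + 𝒢.bias q G x + β * Ψ ≤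
      (alg.val h + 1 / T) / β := by
    rw [le_div_iff₀ hβh]
    rw [hlin] at hbr
    simp only [one_div, div_inv_eq_mul, inv_pow] at hbr hle ⊢
    linarith
  have hrw : (alg.val h + 1 / T) / β = alg.val h / β + 1 / (T * β) := by
    rw [add_div, div_div]
  linarith

end Algorithm

/-! ### Regret bounds -/

/-- A play of `T` rounds as an infinite sequence. -/
def extend {α : Type*} {T : ℕ} (hT : 0 < T) (ω : Fin T → α) (t : ℕ) : α :=
  if h : t < T then ω ⟨t, h⟩ else ω ⟨0, hT⟩

theorem extend_val {α : Type*} {T : ℕ} (hT : 0 < T) (ω : Fin T → α) (t : Fin T) :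
    extend hT ω t = ω t := by
  simp [extend]

namespace Game

variable {k d : ℕ} {Sym : Type*} (𝒢 : Game k d Sym) {T : ℕ}

/-- The sequence of observations of a play. -/
def obsSeq (hT : 0 < T) (ω : Fin T → Fin k × Fin d) (t : ℕ) : Fin k × Sym :=
  ((extend hT ω t).1, 𝒢.feedback (extend hT ω t).1 (extend hT ω t).2)

theorem obsSeq_val (hT : 0 < T) (ω : Fin T → Fin k × Fin d) (t : Fin T) :
    𝒢.obsSeq hT ω t = ((ω t).1, 𝒢.feedback (ω t).1 (ω t).2) := by
  simp only [obsSeq, extend_val]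

theorem observe_hist (hT : 0 < T) (ω : Fin T → Fin k × Fin d) {t : ℕ} (ht : t ≤ T) :
    𝒢.observe (hist ω t) = initSeg (𝒢.obsSeq hT ω) t := by
  refine List.ext_getElem (by simp [observe, hist, ht]) fun i h1 h2 => ?_
  have hi : i < T := by simp at h2; omega
  simp [observe, hist, initSeg, obsSeq, extend, hi]

end Game

namespace Algorithm

variable {k d : ℕ} {Sym : Type*} {𝒢 : Game k d Sym} {M : Model} {T : ℕ} (alg : Algorithm 𝒢 M T)

theorem V_eq_val (hT : 0 < T) (ω : Fin T → Fin k × Fin d) (t : Fin T) :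
    alg.V ω t = alg.val (initSeg (𝒢.obsSeq hT ω) t) := by
  rw [← 𝒢.observe_hist hT ω t.2.le]
  rfl

/-- The penalty and stability terms along a play. -/
def pathBound (o : ℕ → Fin k × Sym) : ℝ :=
  alg.β [] * Real.log k + 1 / alg.β [] +
    ∑ t ∈ Finset.range T, alg.val (initSeg o t) / alg.β (initSeg o t) +
    ∑ t ∈ Finset.range T,
      (alg.β (initSeg o (t + 1)) - alg.β (initSeg o t)) * entropy (alg.q (initSeg o (t + 1)))

/-- The true regret is the regret on the estimates plus a gap with small conditional mean. The
tolerance `1/T` of the near-minimizers adds `1/(T β_t)` per round, at most `1/β₁` in all since `β`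
is nondecreasing. -/
theorem regret_le_expect_pathBound (hk : 0 < k) (hd : 0 < d) (hT : 0 < T) (hβ : 0 < alg.β [])
    (env : Environment k d) :
    𝒢.regret alg.toLearner env T ≤
      𝒢.expect alg.toLearner env T (fun ω => alg.pathBound (𝒢.obsSeq hT ω)) := by
  obtain ⟨c, hc, hreg⟩ := Game.regret_le_of_pareto (𝒢 := 𝒢) (π := alg.toLearner) (env := env)
    (T := T) hk hd
  refine hreg.trans ?_
  let R : List (Fin k × Sym) → Fin k × Sym → ℝ := fun h o =>
    ∑ b, alg.est h o b * alg.q h b - alg.est h o c -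
      alg.β h * psi (alg.q h) (fun b => alg.est h o b / alg.β h)
  let φ : List (Fin k × Fin d) → Fin k × Fin d → ℝ := fun l o =>
    𝒢.loss o.1 o.2 - 𝒢.loss c o.2 - R (𝒢.observe l) (o.1, 𝒢.feedback o.1 o.2)
  let ψ : List (Fin k × Fin d) → ℝ := fun l =>
    alg.val (𝒢.observe l) / alg.β (𝒢.observe l) + 1 / (T * alg.β (𝒢.observe l))
  have hsplit : 𝒢.expect alg.toLearner env T
      (fun ω => ∑ t, (𝒢.loss (ω t).1 (ω t).2 - 𝒢.loss c (ω t).2)) =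
      ∑ t : Fin T, 𝒢.expect alg.toLearner env T (fun ω => φ (hist ω t) (ω t)) +
      𝒢.expect alg.toLearner env T
        (fun ω => ∑ t ∈ Finset.range T, R (initSeg (𝒢.obsSeq hT ω) t) (𝒢.obsSeq hT ω t)) := by
    rw [← Game.expect_sum, ← Game.expect_add]
    congr 1
    funext ω
    rw [← Fin.sum_univ_eq_sum_range
      (fun t => R (initSeg (𝒢.obsSeq hT ω) t) (𝒢.obsSeq hT ω t)) T, ← Finset.sum_add_distrib]
    refine Finset.sum_congr rfl fun t _ => ?_
    rw [𝒢.obsSeq_val, ← 𝒢.observe_hist hT ω t.2.le]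
    simp only [φ]
    ring
  rw [hsplit]
  have h1 : ∑ t : Fin T, 𝒢.expect alg.toLearner env T (fun ω => φ (hist ω t) (ω t)) ≤
      ∑ t : Fin T, 𝒢.expect alg.toLearner env T (fun ω => ψ (hist ω t)) :=
    Finset.sum_le_sum fun t _ => Game.expect_hist_apply_le (π := alg.toLearner)
      (fun l x => alg.sum_p_mul_gap_le hk hβ (𝒢.observe l) hc x) t
  refine (add_le_add_left h1 _).trans ?_
  rw [← Game.expect_sum, ← Game.expect_add]
  refine Game.expect_mono fun ω => ?_
  have h2 := alg.ftrl_regret_le hk hβ (𝒢.obsSeq hT ω) c T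
  have h3 : ∑ t : Fin T, ψ (hist ω t) ≤ ∑ t ∈ Finset.range T,
      alg.val (initSeg (𝒢.obsSeq hT ω) t) / alg.β (initSeg (𝒢.obsSeq hT ω) t) + 1 / alg.β [] := by
    have hT0 : (0 : ℝ) < T := by exact_mod_cast hT
    have h4 : ∀ t : Fin T, ψ (hist ω t) ≤ alg.val (initSeg (𝒢.obsSeq hT ω) t) /
        alg.β (initSeg (𝒢.obsSeq hT ω) t) + 1 / (T * alg.β []) := fun t => by
      simp only [ψ]
      rw [𝒢.observe_hist hT ω t.2.le]
      refine add_le_add_right (one_div_le_one_div_of_le (by positivity) ?_) _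
      exact mul_le_mul_of_nonneg_left (alg.β_nil_le _) hT0.le
    refine (Finset.sum_le_sum fun t _ => h4 t).trans ?_
    rw [Finset.sum_add_distrib, Fin.sum_univ_eq_sum_range
      (fun t => alg.val (initSeg (𝒢.obsSeq hT ω) t) / alg.β (initSeg (𝒢.obsSeq hT ω) t)) T,
      Finset.sum_const, Finset.card_univ, Fintype.card_fin, nsmul_eq_mul]
    have : (T : ℝ) * (1 / (T * alg.β [])) = 1 / alg.β [] := by field_simp
    rw [this]
  simp only [pathBound]
  linarith

/-- The standing assumptions of the regret analysis. -/
structure Regular : Prop where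
  two_le_k : 2 ≤ k
  two_le_T : 2 ≤ T
  numSym_pos : 1 ≤ 𝒢.numSym
  val_le : ∀ h, alg.val h ≤ 9 * M.Vbar k 𝒢.numSym

theorem one_le_log_one_add (hT : 2 ≤ T) : 1 ≤ Real.log (1 + T) := by
  have hTR : (2 : ℝ) ≤ T := by exact_mod_cast hT
  rw [Real.le_log_iff_exp_le (by positivity)]
  linarith [Real.exp_one_lt_d9]

theorem log_one_add_le (hT : 2 ≤ T) : Real.log (1 + T) ≤ 2 * Real.log T := by
  have hTR : (2 : ℝ) ≤ T := by exact_mod_cast hT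
  have : Real.log (1 + T) ≤ Real.log ((T : ℝ) ^ 2) := Real.log_le_log (by positivity) (by nlinarith)
  rw [Real.log_pow] at this
  exact_mod_cast this

theorem le_log_natCast_of_two_le {n : ℕ} (hn : 2 ≤ n) : 0.69 ≤ Real.log n := by
  have : (2 : ℝ) ≤ n := by exact_mod_cast hn
  have h := Real.log_le_log (by norm_num) this
  linarith [Real.log_two_gt_d9]

theorem β_nil_pos (hk : 2 ≤ k) (hT : 2 ≤ T) (hm : 1 ≤ 𝒢.numSym) : 0 < alg.β [] := by
  rw [alg.β_one]
  have h1 := M.half_le_B hk hm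
  have h2 := one_le_log_one_add hT
  have h3 := le_log_natCast_of_two_le hk
  have : 0 < √(Real.log (1 + T) / Real.log k) :=
    Real.sqrt_pos.2 (div_pos (by linarith) (by linarith))
  exact mul_pos (by linarith) this

theorem sqrt_Vbar_le (M : Model) {m : ℕ} (hk : 2 ≤ k) (hm : 1 ≤ m) :
    √(M.Vbar k m) ≤ √2 * M.B k m := by
  have hB := M.half_le_B hk hm
  rw [Real.sqrt_le_left (by positivity), mul_pow, Real.sq_sqrt (by norm_num)]
  exact M.Vbar_le hk

variable {alg}

/-- This is what `V̄ ≤ 2B²` is for: the initial rate already dominates the lower bound that the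
recursion propagates. -/
theorem Regular.learningRate_zero (hR : alg.Regular) (o : ℕ → Fin k × Sym) :
    √(Real.log (1 + T) / 2) * √(M.Vbar k 𝒢.numSym) / √(Real.log k) ≤ alg.β (initSeg o 0) := by
  obtain ⟨hk, hT, hm, -⟩ := hR
  have h3 := le_log_natCast_of_two_le hk
  have h2 := one_le_log_one_add hT
  rw [initSeg_zero, alg.β_one, Real.sqrt_div (by linarith), Real.sqrt_div (by linarith),
    mul_div_assoc']
  refine div_le_div_of_nonneg_right ?_ (Real.sqrt_nonneg _)
  have hs2 : (0 : ℝ) < √2 := by positivity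
  rw [div_mul_eq_mul_div, div_le_iff₀ hs2]
  have := mul_le_mul_of_nonneg_left (sqrt_Vbar_le M hk hm) (Real.sqrt_nonneg (Real.log (1 + T)))
  linarith

theorem Regular.learningRate_succ (hR : alg.Regular) (o : ℕ → Fin k × Sym) (t : ℕ) :
    alg.β (initSeg o (t + 1)) = alg.β (initSeg o t) +
      √(Real.log (1 + T) / 2) * alg.val (initSeg o t) /
        √(M.Vbar k 𝒢.numSym * Real.log k + ∑ s ∈ Finset.range t,
          alg.val (initSeg o s) * entropy (alg.q (initSeg o (s + 1)))) := by
  have hβ := alg.β_nil_pos hR.two_le_k hR.two_le_T hR.numSym_pos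
  rw [initSeg_succ, alg.β_succ, alg.entropy_q_nil (by have := hR.two_le_k; omega) hβ,
    length_initSeg]
  have : ∀ s ∈ Finset.range t, 𝒢.optTrunc M (alg.q ((initSeg o t).take s))
      (1 / alg.β ((initSeg o t).take s)) * entropy (alg.q ((initSeg o t).take (s + 1))) =
      alg.val (initSeg o s) * entropy (alg.q (initSeg o (s + 1))) := fun s hs => by
    have := Finset.mem_range.1 hs
    rw [take_initSeg o (by omega), take_initSeg o (by omega)]
    rfl
  rw [Finset.sum_congr rfl this]
  rfl

/-- The terms of `pathBound` that do not depend on the play. -/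
theorem Regular.const_le (hR : alg.Regular) :
    alg.β [] * Real.log k + 1 / alg.β [] +
        11 * √(Real.log (1 + T) / 2) * √(M.Vbar k 𝒢.numSym * Real.log k) ≤
      16 * (M.B k 𝒢.numSym * √(Real.log k * Real.log (1 + T))) := by
  obtain ⟨hk, hT, hm, -⟩ := hR
  have h3 := le_log_natCast_of_two_le hk
  have h2 := one_le_log_one_add hT
  have hB := M.half_le_B hk hm
  have hlk : 0 < Real.log k := by linarith
  set B := M.B k 𝒢.numSym
  set lk := Real.log k
  set lt := Real.log (1 + (T : ℝ))
  have hslk := Real.sqrt_pos.2 hlk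
  have hslt := Real.sqrt_pos.2 (show 0 < lt by linarith)
  have e1 := Real.mul_self_sqrt hlk.le
  have e2 := Real.mul_self_sqrt (show 0 ≤ lt by linarith)
  have hβ : alg.β [] = B * (√lt / √lk) := by rw [alg.β_one, Real.sqrt_div (by linarith)]
  rw [Real.sqrt_mul hlk.le, Real.sqrt_mul (M.Vbar_pos hk hm).le, Real.sqrt_div (by linarith)]
  -- The three terms contribute 1, 4 and 11 to the constant 16.
  have i1 : alg.β [] * lk = B * (√lk * √lt) := by
    rw [hβ]
    nth_rewrite 2 [← e1]
    field_simp
  have i2 : 1 / alg.β [] ≤ 4 * (B * (√lk * √lt)) := by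
    have hB0 : 0 < B := by linarith
    have : 1 / alg.β [] = √lk / (B * √lt) := by rw [hβ]; field_simp
    rw [this, div_le_iff₀ (by positivity)]
    have : 4 * (B * (√lk * √lt)) * (B * √lt) = √lk * (4 * B ^ 2 * lt) := by
      linear_combination 4 * B ^ 2 * √lk * e2
    rw [this]
    have : 1 ≤ 4 * B ^ 2 * lt := by
      have : 1 ≤ 4 * B ^ 2 := by nlinarith
      nlinarith
    nlinarith [mul_le_mul_of_nonneg_left this hslk.le]
  have i3 : 11 * (√lt / √2) * (√(M.Vbar k 𝒢.numSym) * √lk) ≤ 11 * (B * (√lk * √lt)) := by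
    have hs2 : (0 : ℝ) < √2 := by positivity
    have := mul_le_mul_of_nonneg_left (sqrt_Vbar_le M hk hm)
      (show 0 ≤ 11 * (√lt / √2) * √lk by positivity)
    calc _ = 11 * (√lt / √2) * √lk * √(M.Vbar k 𝒢.numSym) := by ring
      _ ≤ _ := this
      _ = _ := by field_simp; ring
  linarith

/-- With `c² = log(1+T)/2` the penalty `2c√(log k · S)` is exactly the main term, and the stability
term `(5/c)√(log k · S)` is `5/log(1+T)` times it. The 11 in `const_le` is the remainder 9 of the
penalty plus 2 from splitting `√W`. -/
theorem Regular.pathBound_le_sqrt_sum (hR : alg.Regular) (o : ℕ → Fin k × Sym) :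
    alg.pathBound o ≤
      (1 + 5 / Real.log (1 + T)) * √(2 * (∑ t ∈ Finset.range T, alg.val (initSeg o t)) *
        Real.log k * Real.log (1 + T)) +
      16 * (M.B k 𝒢.numSym * √(Real.log k * Real.log (1 + T))) := by
  have hk := hR.two_le_k
  have hlk : 0 < Real.log k := by linarith [le_log_natCast_of_two_le hk]
  have hlt := one_le_log_one_add hR.two_le_T
  have hVb := M.Vbar_pos hk hR.numSym_pos
  have hc : 0 < √(Real.log (1 + T) / 2) := Real.sqrt_pos.2 (by linarith)
  have h0 : ∀ t, 0 ≤ alg.val (initSeg o t) := fun t => alg.val_nonneg _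
  have hh0 : ∀ t, 0 ≤ entropy (alg.q (initSeg o t)) := fun t => entropy_nonneg (alg.q_mem _)
  have hh : ∀ t, entropy (alg.q (initSeg o t)) ≤ Real.log k := fun t =>
    entropy_le_log (by omega) (alg.q_mem _)
  have hstab := sum_div_learningRate_le_sqrt (V := fun t => alg.val (initSeg o t))
    (h := fun t => entropy (alg.q (initSeg o t))) (β := fun t => alg.β (initSeg o t)) hVb hlk hc
    h0 (fun t => hR.val_le _) hh hh0 (hR.learningRate_zero o) (hR.learningRate_succ o) T
  have hpen := sum_learningRate_sub_mul_le (V := fun t => alg.val (initSeg o t))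
    (h := fun t => entropy (alg.q (initSeg o t))) (β := fun t => alg.β (initSeg o t)) hVb hlk hc
    h0 (fun t => hR.val_le _) hh hh0 (hR.learningRate_succ o) T
  beta_reduce at hstab hpen
  have hconst := hR.const_le
  set S := ∑ t ∈ Finset.range T, alg.val (initSeg o t) with hS
  have hS0 : 0 ≤ S := Finset.sum_nonneg fun t _ => h0 t
  set c := √(Real.log (1 + T) / 2) with hcdef
  have hc2 : c ^ 2 = Real.log (1 + T) / 2 := Real.sq_sqrt (by linarith)
  have hX : √(2 * S * Real.log k * Real.log (1 + T)) = 2 * c * √(Real.log k * S) := by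
    have : 2 * S * Real.log k * Real.log (1 + T) = (2 * c) ^ 2 * (Real.log k * S) := by
      rw [mul_pow, hc2]; ring
    rw [this, Real.sqrt_mul (by positivity), Real.sqrt_sq (by positivity)]
  have hW : √(M.Vbar k 𝒢.numSym * Real.log k + ∑ t ∈ Finset.range T,
      alg.val (initSeg o t) * entropy (alg.q (initSeg o (t + 1)))) ≤
      √(M.Vbar k 𝒢.numSym * Real.log k) + √(Real.log k * S) := by
    refine le_trans (Real.sqrt_le_sqrt ?_) (sqrt_add_le_add_sqrt (by positivity) (by positivity))
    refine add_le_add_right ?_ _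
    rw [hS, Finset.mul_sum]
    refine Finset.sum_le_sum fun t _ => ?_
    rw [mul_comm]
    exact mul_le_mul_of_nonneg_right (hh _) (h0 t)
  have hW2 := mul_le_mul_of_nonneg_left hW (show 0 ≤ 2 * c by positivity)
  have h5 : 5 / Real.log (1 + T) * (2 * c * √(Real.log k * S)) = 5 / c * √(Real.log k * S) := by
    have : Real.log (1 + T) = 2 * c ^ 2 := by rw [hc2]; ring
    rw [this]
    field_simp
  rw [hX, add_mul, h5]
  simp only [pathBound]
  linarith

/-- The logarithm in the stability bound equals `2c²`, so `40/c` becomes `80c`; the penalty adds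
`2c`. -/
theorem Regular.pathBound_le_sqrt_entropy (hR : alg.Regular) (o : ℕ → Fin k × Sym) :
    alg.pathBound o ≤
      82 * √(Real.log (1 + T) / 2) * √(M.Vbar k 𝒢.numSym * Real.log k +
        ∑ t ∈ Finset.range T, alg.val (initSeg o t) * entropy (alg.q (initSeg o (t + 1)))) +
      16 * (M.B k 𝒢.numSym * √(Real.log k * Real.log (1 + T))) := by
  have hk := hR.two_le_k
  have hT := hR.two_le_T
  have hlk : 0 < Real.log k := by linarith [le_log_natCast_of_two_le hk]
  have hlt := one_le_log_one_add hT
  have hVb := M.Vbar_pos hk hR.numSym_pos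
  have hc : 0 < √(Real.log (1 + T) / 2) := Real.sqrt_pos.2 (by linarith)
  have h0 : ∀ t, 0 ≤ alg.val (initSeg o t) := fun t => alg.val_nonneg _
  have hh0 : ∀ t, 0 ≤ entropy (alg.q (initSeg o t)) := fun t => entropy_nonneg (alg.q_mem _)
  have hh : ∀ t, entropy (alg.q (initSeg o t)) ≤ Real.log k := fun t =>
    entropy_le_log (by omega) (alg.q_mem _)
  have hstab := sum_div_learningRate_le_log (V := fun t => alg.val (initSeg o t))
    (h := fun t => entropy (alg.q (initSeg o t))) (β := fun t => alg.β (initSeg o t)) hVb hlk hc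
    h0 (fun t => hR.val_le _) hh0 (hR.learningRate_zero o) (hR.learningRate_succ o)
    (n := T) (by omega)
  have hpen := sum_learningRate_sub_mul_le (V := fun t => alg.val (initSeg o t))
    (h := fun t => entropy (alg.q (initSeg o t))) (β := fun t => alg.β (initSeg o t)) hVb hlk hc
    h0 (fun t => hR.val_le _) hh hh0 (hR.learningRate_succ o) T
  beta_reduce at hstab hpen
  have hconst := hR.const_le
  set W := √(M.Vbar k 𝒢.numSym * Real.log k + ∑ t ∈ Finset.range T,
      alg.val (initSeg o t) * entropy (alg.q (initSeg o (t + 1))))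
  set c := √(Real.log (1 + T) / 2) with hcdef
  have hc2 : c ^ 2 = Real.log (1 + T) / 2 := Real.sq_sqrt (by linarith)
  have h5 : 40 / c * (W * Real.log (1 + T)) = 80 * c * W := by
    have : Real.log (1 + T) = 2 * c ^ 2 := by rw [hc2]; ring
    rw [this]
    field_simp
    ring
  have h6 : 0 ≤ c * √(M.Vbar k 𝒢.numSym * Real.log k) := by positivity
  simp only [pathBound]
  linarith

/-- The total weight outside `a` controls the path bound. -/
theorem Regular.pathBound_le_sqrt_weight (hR : alg.Regular) (o : ℕ → Fin k × Sym)
    (a : Fin k) :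
    alg.pathBound o ≤
      246 * √(M.Vbar k 𝒢.numSym * Real.log T * Real.log (k * T) *
        ∑ t ∈ Finset.range T, (1 - alg.q (initSeg o t) a)) +
      426 * (M.B k 𝒢.numSym * √(Real.log k * Real.log (1 + T))) := by
  have hk := hR.two_le_k
  have hT := hR.two_le_T
  have hlk2 := le_log_natCast_of_two_le hk
  have hlk : 0 < Real.log k := by linarith
  have hlt := one_le_log_one_add hT
  have hVb := M.Vbar_pos hk hR.numSym_pos
  have hkT : 0 ≤ Real.log (k * T) := by
    rw [← Nat.cast_mul]
    exact Real.log_natCast_nonneg _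
  have hmain := hR.pathBound_le_sqrt_entropy o
  set Q := ∑ t ∈ Finset.range T, (1 - alg.q (initSeg o t) a) with hQ
  have hQ0 : 0 ≤ Q := Finset.sum_nonneg fun t _ => by
    have hq := alg.q_mem (initSeg o t)
    have := Finset.single_le_sum (fun b _ => hq.1 b) (Finset.mem_univ a)
    rw [hq.2] at this
    linarith
  have hent : ∑ t ∈ Finset.range T, entropy (alg.q (initSeg o (t + 1))) ≤
      Real.log (k * T) * Q + 1 + Real.log k := by
    -- The entropies are shifted by one round, at the cost of one boundary term.
    have h1 : ∑ t ∈ Finset.range T, entropy (alg.q (initSeg o (t + 1))) ≤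
        ∑ t ∈ Finset.range T, entropy (alg.q (initSeg o t)) + Real.log k := by
      have h2 := Finset.sum_range_succ (fun t => entropy (alg.q (initSeg o t))) T
      have h3 := Finset.sum_range_succ' (fun t => entropy (alg.q (initSeg o t))) T
      have h4 : 0 ≤ entropy (alg.q (initSeg o 0)) := entropy_nonneg (alg.q_mem _)
      have h5 : entropy (alg.q (initSeg o T)) ≤ Real.log k :=
        entropy_le_log (by omega) (alg.q_mem _)
      linarith
    have h2 : ∑ t ∈ Finset.range T, entropy (alg.q (initSeg o t)) ≤ Real.log (k * T) * Q + 1 := by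
      refine (Finset.sum_le_sum fun t _ =>
        entropy_le_of_concentrated (T := T) (by omega) (alg.q_mem _) a).trans ?_
      rw [Finset.sum_add_distrib, ← Finset.sum_mul, Finset.sum_const, Finset.card_range,
        nsmul_eq_mul, mul_one_div_cancel (by positivity), mul_comm]
    linarith
  set Vb := M.Vbar k 𝒢.numSym
  have hW : Vb * Real.log k + ∑ t ∈ Finset.range T,
      alg.val (initSeg o t) * entropy (alg.q (initSeg o (t + 1))) ≤
      5 ^ 2 * (Vb * Real.log k) + 3 ^ 2 * (Vb * Real.log (k * T) * Q) := by
    have h1 : ∑ t ∈ Finset.range T,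
        alg.val (initSeg o t) * entropy (alg.q (initSeg o (t + 1))) ≤
        9 * Vb * ∑ t ∈ Finset.range T, entropy (alg.q (initSeg o (t + 1))) := by
      rw [Finset.mul_sum]
      exact Finset.sum_le_sum fun t _ =>
        mul_le_mul_of_nonneg_right (hR.val_le _) (entropy_nonneg (alg.q_mem _))
    have h2 := mul_le_mul_of_nonneg_left hent (show 0 ≤ 9 * Vb by positivity)
    -- Uses `log k ≥ 0.69`. Altogether `1 + 9 + 15 = 25 = 5²`, which leads to `246 = 82 · 3` and
    -- `426 = 82 · 5 + 16`.
    have h3 : 9 * Vb ≤ 15 * (Vb * Real.log k) := by nlinarith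
    linarith
  have hsq := (Real.sqrt_le_sqrt hW).trans
    (sqrt_add_le_add_sqrt (show 0 ≤ 5 ^ 2 * (Vb * Real.log k) by positivity)
      (show 0 ≤ 3 ^ 2 * (Vb * Real.log (k * T) * Q) by positivity))
  rw [Real.sqrt_mul (by norm_num), Real.sqrt_mul (by norm_num : (0 : ℝ) ≤ 3 ^ 2),
    Real.sqrt_sq (by norm_num), Real.sqrt_sq (by norm_num)] at hsq
  set c := √(Real.log (1 + T) / 2) with hcdef
  have hc : 0 < c := Real.sqrt_pos.2 (by linarith)
  have h1 : c * √(Vb * Real.log (k * T) * Q) ≤ √(Vb * Real.log T * Real.log (k * T) * Q) := by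
    rw [hcdef, ← Real.sqrt_mul (by linarith)]
    refine Real.sqrt_le_sqrt ?_
    have h2 : Real.log (1 + T) / 2 ≤ Real.log T := by linarith [log_one_add_le hT]
    have h3 := mul_le_mul_of_nonneg_right h2 (show 0 ≤ Vb * Real.log (k * T) * Q by positivity)
    linarith
  have h2 : c * √(Vb * Real.log k) ≤ M.B k 𝒢.numSym * √(Real.log k * Real.log (1 + T)) := by
    have h3 := sqrt_Vbar_le M hk hR.numSym_pos
    have hs2 : (0 : ℝ) < √2 := by positivity
    have hs3 : (0 : ℝ) < √(Real.log (1 + T)) := Real.sqrt_pos.2 (by linarith)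
    rw [hcdef, Real.sqrt_div (by linarith), Real.sqrt_mul hVb.le, Real.sqrt_mul hlk.le]
    calc _ = √(Real.log (1 + T)) / √2 * √(Real.log k) * √Vb := by ring
      _ ≤ √(Real.log (1 + T)) / √2 * √(Real.log k) * (√2 * M.B k 𝒢.numSym) :=
        mul_le_mul_of_nonneg_left h3 (by positivity)
      _ = _ := by field_simp
  have h3 := mul_le_mul_of_nonneg_left hsq (show 0 ≤ 82 * c by positivity)
  linarith

end Algorithm

/-! ### The self-bounding argument and the two regimes -/

/-- By the inequality of the means `c√(Xx) ≤ x/2 + c²X/2`, and half of `x` is absorbed on the left.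
-/
theorem le_of_le_add_sqrt {x b c X C : ℝ} (hb : 0 ≤ b) (hc : 0 ≤ c) (hX : 0 ≤ X) (hC : 0 ≤ C)
    (h : x ≤ b + c * √(X * (x + C))) : x ≤ 2 * b + 2 * c * √(C * X) + c ^ 2 * X := by
  rcases le_or_gt x 0 with hx | hx
  · exact hx.trans (by positivity)
  · have h1 : √(X * (x + C)) ≤ √(X * x) + √(C * X) := by
      rw [mul_add, mul_comm C X]
      exact sqrt_add_le_add_sqrt (by positivity) (by positivity)
    have h2 : c * √(X * x) ≤ x / 2 + c ^ 2 * X / 2 := by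
      rw [Real.sqrt_mul hX]
      have e1 := Real.sq_sqrt hX
      have e2 := Real.sq_sqrt hx.le
      nlinarith [sq_nonneg (c * √X - √x)]
    have h3 := mul_le_mul_of_nonneg_left h1 hc
    linarith

namespace Algorithm

variable {k d : ℕ} {Sym : Type*} {𝒢 : Game k d Sym} {M : Model} {T : ℕ} {alg : Algorithm 𝒢 M T}

theorem sqrt_log_le (hT : 2 ≤ T) : √(Real.log k * Real.log (1 + T)) ≤
    3 / 2 * √(Real.log k * Real.log T) := by
  have h1 := log_one_add_le hT
  have hk : 0 ≤ Real.log k := Real.log_natCast_nonneg k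
  have hlT : 0 ≤ Real.log T := Real.log_natCast_nonneg T
  rw [Real.sqrt_le_left (by positivity), mul_pow, Real.sq_sqrt (by positivity)]
  nlinarith [mul_le_mul_of_nonneg_left h1 hk, mul_nonneg hk hlT]

theorem Regular.regret_adversarial (hR : alg.Regular) (hd : 0 < d) (env : Environment k d) :
    𝒢.regret alg.toLearner env T ≤
      (1 + 5 / Real.log (1 + T)) *
        𝒢.expect alg.toLearner env T (fun ω =>
          √(2 * (∑ t : Fin T, alg.V ω t) * Real.log k * Real.log (1 + T))) +
      24 * (M.B k 𝒢.numSym * √(Real.log k * Real.log T)) := by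
  have hk := hR.two_le_k
  have hT := hR.two_le_T
  have hT0 : 0 < T := by omega
  have hβ := alg.β_nil_pos hk hT hR.numSym_pos
  have hB := M.half_le_B hk hR.numSym_pos
  refine (alg.regret_le_expect_pathBound (by omega) hd hT0 hβ env).trans ?_
  refine (Game.expect_mono fun ω => hR.pathBound_le_sqrt_sum (𝒢.obsSeq hT0 ω)).trans ?_
  rw [Game.expect_add, Game.expect_const, Game.expect_const_mul]
  have h1 : ∀ ω : Fin T → Fin k × Fin d, ∑ t ∈ Finset.range T, alg.val (initSeg (𝒢.obsSeq hT0 ω) t) =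
      ∑ t : Fin T, alg.V ω t := fun ω => by
    rw [← Fin.sum_univ_eq_sum_range (fun t => alg.val (initSeg (𝒢.obsSeq hT0 ω) t)) T]
    exact Finset.sum_congr rfl fun t _ => (alg.V_eq_val hT0 ω t).symm
  simp only [h1]
  have h2 := mul_le_mul_of_nonneg_left (sqrt_log_le (k := k) hT)
    (show 0 ≤ M.B k 𝒢.numSym by linarith)
  linarith

/-- In a self-bounding environment, the weight outside the optimal action is controlled by the
regret. -/
theorem expect_weight_le (hk : 2 ≤ k) (hT : 0 < T) {env : Environment k d}
    {Δ : Fin k → ℝ} {C : ℝ} {a : Fin k} (hΔ : ∀ b, 0 ≤ Δ b) (hgap : 0 < gapMin Δ a)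
    (hsb : 𝒢.SelfBounding env Δ C T) :
    𝒢.expect alg.toLearner env T (fun ω => ∑ t ∈ Finset.range T,
      (1 - alg.q (initSeg (𝒢.obsSeq hT ω) t) a)) ≤
      M.r k / gapMin Δ a * (𝒢.regret alg.toLearner env T + C) := by
  classical
  have hr := M.one_le_r hk
  set g := gapMin Δ a with hg
  have hgΔ : ∀ b, b ≠ a → g ≤ Δ b := fun b hb =>
    ciInf_le (Set.finite_range fun b : {b : Fin k // b ≠ a} => Δ b).bddBelow ⟨b, hb⟩
  -- Stated for `-Δ` because the conditional bound is an upper bound. Sampling keeps a fraction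
  -- `1/r` of each weight, and every action other than `a` costs at least the gap.
  have hstep : ∀ (l : List (Fin k × Fin d)) (x : Fin d), ∑ b, alg.toLearner.law (𝒢.observe l) b *
      (- Δ b) ≤ - (g / M.r k * (1 - alg.q (𝒢.observe l) a)) := by
    intro l x
    set h := 𝒢.observe l
    have hq := alg.q_mem h
    have hrest : 1 - alg.q h a = ∑ b ∈ Finset.univ.erase a, alg.q h b := by
      rw [← hq.2, ← Finset.add_sum_erase _ _ (Finset.mem_univ a)]; ring
    have hp0 := (alg.p_mem h).1.1
    simp only [mul_neg, Finset.sum_neg_distrib, neg_le_neg_iff]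
    change _ ≤ ∑ b, alg.p h b * Δ b
    rw [← Finset.add_sum_erase _ _ (Finset.mem_univ a), hrest, Finset.mul_sum]
    have h1 : ∑ b ∈ Finset.univ.erase a, g / M.r k * alg.q h b ≤
        ∑ b ∈ Finset.univ.erase a, alg.p h b * Δ b := by
      refine Finset.sum_le_sum fun b hb => ?_
      have h2 := M.le_r_mul_of_feasible (alg.p_mem h) b
      have h3 := mul_le_mul_of_nonneg_left (hgΔ b (Finset.ne_of_mem_erase hb)) (hp0 b)
      calc g / M.r k * alg.q h b ≤ g / M.r k * (M.r k * alg.p h b) :=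
            mul_le_mul_of_nonneg_left h2 (div_nonneg hgap.le (by linarith))
        _ = alg.p h b * g := by field_simp
        _ ≤ _ := h3
    have := mul_nonneg (hp0 a) (hΔ a)
    linarith
  have hsum : ∑ t : Fin T, 𝒢.expect alg.toLearner env T (fun ω => - Δ (ω t).1) ≤
      ∑ t : Fin T, 𝒢.expect alg.toLearner env T (fun ω =>
        - (g / M.r k * (1 - alg.q (𝒢.observe (hist ω t)) a))) :=
    Finset.sum_le_sum fun t _ => Game.expect_hist_apply_le (π := alg.toLearner)
      (φ := fun _ o => - Δ o.1) hstep t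
  rw [← Game.expect_sum, ← Game.expect_sum] at hsum
  have h1 : (fun ω : Fin T → Fin k × Fin d => ∑ t : Fin T,
      - (g / M.r k * (1 - alg.q (𝒢.observe (hist ω t)) a))) = fun ω =>
      (- (g / M.r k)) * ∑ t ∈ Finset.range T, (1 - alg.q (initSeg (𝒢.obsSeq hT ω) t) a) := by
    funext ω
    rw [← Fin.sum_univ_eq_sum_range (fun t => 1 - alg.q (initSeg (𝒢.obsSeq hT ω) t) a) T,
      Finset.mul_sum]
    refine Finset.sum_congr rfl fun t _ => ?_
    rw [𝒢.observe_hist hT ω t.2.le]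
    ring
  have h2 : (fun ω : Fin T → Fin k × Fin d => ∑ t : Fin T, - Δ (ω t).1) =
      fun ω => (-1) * ∑ t, Δ (ω t).1 := by
    funext ω
    rw [Finset.sum_neg_distrib]; ring
  rw [h1, h2, Game.expect_const_mul, Game.expect_const_mul] at hsum
  have h3 := hsb alg.toLearner
  rw [Game.expect_sub, Game.expect_const] at h3
  set E := 𝒢.expect alg.toLearner env T (fun ω => ∑ t ∈ Finset.range T,
      (1 - alg.q (initSeg (𝒢.obsSeq hT ω) t) a))
  have h4 : g / M.r k * E ≤ 𝒢.regret alg.toLearner env T + C := by linarith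
  calc E = M.r k / g * (g / M.r k * E) := by field_simp
    _ ≤ _ := mul_le_mul_of_nonneg_left h4 (div_nonneg (by linarith) hgap.le)

theorem Regular.regret_selfBounding (hR : alg.Regular) (hd : 0 < d) {env : Environment k d}
    {Δ : Fin k → ℝ} {C : ℝ} {a : Fin k} (hΔ : ∀ b, 0 ≤ Δ b) (hC : 0 ≤ C)
    (hgap : 0 < gapMin Δ a) (hsb : 𝒢.SelfBounding env Δ C T) :
    𝒢.regret alg.toLearner env T ≤
      246 ^ 2 * (M.r k * M.Vbar k 𝒢.numSym * Real.log T * Real.log (k * T) / gapMin Δ a) +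
      492 * √(C * M.r k * M.Vbar k 𝒢.numSym * Real.log T * Real.log (k * T) / gapMin Δ a) +
      1278 * (M.B k 𝒢.numSym * √(Real.log k * Real.log T)) := by
  have hk := hR.two_le_k
  have hT := hR.two_le_T
  have hT0 : 0 < T := by omega
  have hβ := alg.β_nil_pos hk hT hR.numSym_pos
  have hB := M.half_le_B hk hR.numSym_pos
  have hVb := M.Vbar_pos hk hR.numSym_pos
  have hr := M.one_le_r hk
  have hkT : 0 ≤ Real.log (k * T) := by
    rw [← Nat.cast_mul]
    exact Real.log_natCast_nonneg _
  have hlT : 0 ≤ Real.log T := Real.log_natCast_nonneg T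
  have hreg := alg.regret_le_expect_pathBound (by omega) hd hT0 hβ env
  have h1 := hreg.trans (Game.expect_mono fun ω =>
    hR.pathBound_le_sqrt_weight (𝒢.obsSeq hT0 ω) a)
  rw [Game.expect_add, Game.expect_const, Game.expect_const_mul] at h1
  set A := M.Vbar k 𝒢.numSym * Real.log T * Real.log (k * T) with hA
  have hA0 : 0 ≤ A := by positivity
  have h2 := Game.expect_sqrt_le (𝒢 := 𝒢) (π := alg.toLearner) (env := env) (T := T)
    (f := fun ω => A * ∑ t ∈ Finset.range T, (1 - alg.q (initSeg (𝒢.obsSeq hT0 ω) t) a))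
    (fun ω => mul_nonneg hA0 (Finset.sum_nonneg fun t _ => by
      have hq := alg.q_mem (initSeg (𝒢.obsSeq hT0 ω) t)
      have := Finset.single_le_sum (fun b _ => hq.1 b) (Finset.mem_univ a)
      rw [hq.2] at this
      linarith))
  rw [Game.expect_const_mul] at h2
  have h3 := mul_le_mul_of_nonneg_left (expect_weight_le (alg := alg) hk hT0 hΔ hgap hsb) hA0
  have h4 := h2.trans (Real.sqrt_le_sqrt h3)
  set X := M.r k * M.Vbar k 𝒢.numSym * Real.log T * Real.log (k * T) / gapMin Δ a with hX
  have hX0 : 0 ≤ X := div_nonneg (by positivity) hgap.le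
  have h5 : A * (M.r k / gapMin Δ a * (𝒢.regret alg.toLearner env T + C)) =
      X * (𝒢.regret alg.toLearner env T + C) := by
    rw [hA, hX]; ring
  rw [h5] at h4
  have h6 : C * M.r k * M.Vbar k 𝒢.numSym * Real.log T * Real.log (k * T) / gapMin Δ a = C * X := by
    rw [hX]; ring
  rw [h6]
  have h7 := mul_le_mul_of_nonneg_left (sqrt_log_le (k := k) hT)
    (show 0 ≤ M.B k 𝒢.numSym by linarith)
  -- Here `639 = 426 · 3/2`, after replacing `log(1+T)` by `log T`.
  have h8 := le_of_le_add_sqrt (x := 𝒢.regret alg.toLearner env T)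
    (b := 639 * (M.B k 𝒢.numSym * √(Real.log k * Real.log T))) (c := 246) (X := X) (C := C)
    (by positivity) (by norm_num) hX0 hC (by linarith)
  linarith

/-- The value bound holds unless the number of actions exceeds the horizon. -/
theorem regular_of_isModel (alg : Algorithm 𝒢 M T) (hk : 2 ≤ k) (hT : 2 ≤ T) (hd : 0 < d)
    (hG : 𝒢.IsModel M) (hkT : M = .PMlocal → k ≤ T + 1) : alg.Regular where
  two_le_k := hk
  two_le_T := hT
  numSym_pos := 𝒢.one_le_numSym (by omega) hd
  val_le h := by
    have hm := 𝒢.one_le_numSym (by omega) hd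
    have hβ := alg.β_nil_pos hk hT hm
    have hβh : 0 < alg.β h := hβ.trans_le (alg.β_nil_le h)
    refine 𝒢.optTrunc_le_Vbar hG hk hd (alg.q_mem h) (alg.q_pos (by omega) hβh)
      (one_div_pos.2 hβh) fun hM => ?_
    rw [one_div, inv_mul_le_iff₀ hβh, mul_one]
    refine le_trans ?_ (alg.β_nil_le h)
    rw [alg.β_one]
    refine le_mul_of_one_le_right (by linarith [M.half_le_B hk hm]) ?_
    -- `β₁ ≥ B` amounts to `log k ≤ log(1+T)`; this is where `k ≤ T + 1` enters.
    rw [Real.one_le_sqrt, one_le_div (by linarith [le_log_natCast_of_two_le hk])]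
    refine Real.log_le_log (by positivity) ?_
    have : (k : ℝ) ≤ T + 1 := by exact_mod_cast hkT hM
    linarith

end Algorithm

end

end PM

theorem corollary3 : ∃ K : ℝ, 0 < K ∧
    ∀ (k d T : ℕ) (Sym : Type*) (𝒢 : PM.Game k d Sym) (M : PM.Model),
      2 ≤ k → 2 ≤ T → 𝒢.IsModel M →
      Nonempty (PM.Algorithm 𝒢 M T) ∧
      ∀ (alg : PM.Algorithm 𝒢 M T) (env : PM.Environment k d),
        (𝒢.regret alg.toLearner env T ≤
          (1 + K / Real.log (1 + T)) *
            𝒢.expect alg.toLearner env T (fun ω =>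
              √(2 * (∑ t : Fin T, alg.V ω t) * Real.log k * Real.log (1 + T))) +
          K * (M.B k 𝒢.numSym * √(Real.log k * Real.log T))) ∧
        ∀ (Δ : Fin k → ℝ) (C : ℝ) (astar : Fin k),
          (∀ a, Δ a ∈ Set.Icc (0 : ℝ) 2) → 0 ≤ C → 0 < PM.gapMin Δ astar →
          𝒢.SelfBounding env Δ C T →
          𝒢.regret alg.toLearner env T ≤
            K * (M.r k * M.Vbar k 𝒢.numSym * Real.log T * Real.log (k * T) / PM.gapMin Δ astar +
              √(C * M.r k * M.Vbar k 𝒢.numSym * Real.log T * Real.log (k * T) /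
                PM.gapMin Δ astar) +
              M.B k 𝒢.numSym * √(Real.log k * Real.log T)) := by
  refine ⟨246 ^ 2, by norm_num, fun k d T Sym 𝒢 M hk hT hG =>
    ⟨PM.Game.nonempty_algorithm (by omega) M (by omega), fun alg env => ?_⟩⟩
  -- Without outcomes there is no environment.
  have hd : 0 < d := by
    rcases Nat.eq_zero_or_pos d with rfl | h
    · have := (env.law_mem []).2
      simp at this
    · exact h
  have hm := 𝒢.one_le_numSym (by omega) hd
  have hB := M.half_le_B hk hm
  have hVb := M.Vbar_pos hk hm
  have hr := M.one_le_r hk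
  have hlt := PM.Algorithm.one_le_log_one_add hT
  have hlT := PM.Algorithm.le_log_natCast_of_two_le hT
  have hlk := PM.Algorithm.le_log_natCast_of_two_le hk
  have hkT : 0 ≤ Real.log (k * T) := by
    rw [← Nat.cast_mul]
    exact Real.log_natCast_nonneg _
  set E := 𝒢.expect alg.toLearner env T (fun ω =>
    √(2 * (∑ t : Fin T, alg.V ω t) * Real.log k * Real.log (1 + T)))
  have hE : 0 ≤ E := PM.Game.expect_nonneg fun ω => Real.sqrt_nonneg _
  set R := M.B k 𝒢.numSym * √(Real.log k * Real.log T) with hR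
  have hR0 : 0 ≤ R := by positivity
  have hX0 : ∀ (Δ : Fin k → ℝ) (a : Fin k), 0 < PM.gapMin Δ a →
      0 ≤ M.r k * M.Vbar k 𝒢.numSym * Real.log T * Real.log (k * T) / PM.gapMin Δ a :=
    fun Δ a hg => div_nonneg (by positivity) hg.le
  by_cases hcase : M = .PMlocal → k ≤ T + 1
  · have hreg := alg.regular_of_isModel hk hT hd hG hcase
    refine ⟨?_, fun Δ C a hΔ hC hgap hsb => ?_⟩
    · have h1 := hreg.regret_adversarial hd env
      have h2 : (1 + 5 / Real.log (1 + T)) * E ≤ (1 + 246 ^ 2 / Real.log (1 + T)) * E := by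
        refine mul_le_mul_of_nonneg_right (add_le_add_right ?_ 1) hE
        exact div_le_div_of_nonneg_right (by norm_num) (by linarith)
      linarith
    · have h1 := hreg.regret_selfBounding hd (fun b => (hΔ b).1) hC hgap hsb
      have h2 := Real.sqrt_nonneg
        (C * M.r k * M.Vbar k 𝒢.numSym * Real.log T * Real.log (k * T) / PM.gapMin Δ a)
      have h3 := hX0 Δ a hgap
      linarith
  · push Not at hcase
    obtain ⟨rfl, hlarge⟩ := hcase
    -- With more actions than rounds, `B ≥ 2k` and `√(log k · log T) ≥ 1/2` make `R` exceed the
    -- trivial regret bound `T`.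
    have hsmall : 𝒢.regret alg.toLearner env T ≤ R := by
      refine (PM.Game.regret_le_horizon (by omega)).trans ?_
      have h1 : (T : ℝ) ≤ k := by exact_mod_cast (by omega : T ≤ k)
      have h2 : (1 / 2 : ℝ) ≤ √(Real.log k * Real.log T) := by
        refine Real.le_sqrt_of_sq_le ?_
        nlinarith
      have h3 : (2 : ℝ) * k ≤ PM.Model.B k 𝒢.numSym .PMlocal := by
        simp only [PM.Model.B]
        have hk2 : (2 : ℝ) ≤ k := by exact_mod_cast hk
        have hm1 : (1 : ℝ) ≤ 𝒢.numSym := by exact_mod_cast hm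
        have h4 : (k : ℝ) ≤ (k : ℝ) ^ 2 := by nlinarith
        nlinarith
      have hk0 : (0 : ℝ) ≤ k := by positivity
      calc (T : ℝ) ≤ 2 * k * (1 / 2) := by linarith
        _ ≤ R := mul_le_mul h3 h2 (by norm_num) (by linarith)
    refine ⟨?_, fun Δ C a hΔ hC hgap hsb => ?_⟩
    · have : 0 ≤ (1 + 246 ^ 2 / Real.log (1 + T)) * E :=
        mul_nonneg (by have : 0 ≤ 246 ^ 2 / Real.log (1 + T) := by positivity
                       linarith) hE
      linarith
    · have h2 := Real.sqrt_nonneg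
        (C * PM.Model.r k .PMlocal * PM.Model.Vbar k 𝒢.numSym .PMlocal * Real.log T *
          Real.log (k * T) / PM.gapMin Δ a)
      have h3 := hX0 Δ a hgap
      linarith
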